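/- \textbf{Setting.} For a security parameter $k$, bilinear groups are chosen from an arbitrary distribution over descriptions of bilinear groups: groups $\mathbb G,\mathbb G_T$ of prime order $p>2^k$ with a map $e:\mathbb G\times\mathbb G\to\mathbb G_T$ such that $e(x^a,y^b)=e(x,y)^{ab}$ for $a,b\in\mathbb Z$ and $e(x,y)\ne 1$ for $x,y\neq 1$. Descriptions and group elements have representations of polynomial length. Algorithms are probabilistic polynomial time (PPT), group operations, exponentiation, the pairing, recognition of group elements, and uniform sampling below a given integer being efficient. \textbf{Common part of the two schemes.} \emph{Setup}: $g$ is a random generator of $\mathbb G$, $h\in\mathbb G$ and $\alpha\in\mathbb Z_p^*$ are random; the master secret key is $\alpha$ and the master public key is $(g,g_1=g^\alpha,h)$. \emph{Encryption} of $m\in\mathbb G_T$ for $\mathsf{ID}\in\mathbb Z_p$: choose $s\in\mathbb Z_p^*$ at random and output $\big((g_1g^{-\mathsf{ID}})^s,\ e(g,g)^s,\ m\cdot e(g,h)^s\big)$. \textbf{Gentry's IBE.} The key for $\mathsf{ID}\ne\alpha$ is $\big((h\,g^{-t_{\mathsf{ID}}})^{1/(\alpha-\mathsf{ID})},\,t_{\mathsf{ID}}\big)$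 with random $t_{\mathsf{ID}}\in\mathbb Z_p$. \textbf{Accountable variant.} Key generation for $\mathsf{ID}$ is a protocol. The user sends a commitment $R=g^{-t_0}(g_1g^{-\mathsf{ID}})^{\theta}$ and proves knowledge of $(t_0,\theta)$ by Okamoto's witness-indistinguishable three-move protocol: he sends $T\in\mathbb G$, receives a random challenge $c\in\mathbb Z_p$, and answers $(z_1,z_2)\in\mathbb Z_p^2$; the proof is accepted if $g^{-z_1}(g_1g^{-\mathsf{ID}})^{z_2}=T\,R^{c}$. If the proof is rejected, the PKG returns $\bot$. Otherwise it picks a random $t_1\in\mathbb Z_p^*$ and returns $\big((h\,R\,g^{-t_1})^{1/(\alpha-\mathsf{ID})},\,t_1\big)$, which the honest user turns into $\big((h\,g^{-(t_0+t_1)})^{1/(\alpha-\mathsf{ID})},\,t_0+t_1\big)$. In both schemes the answer is $\bot$ if $\mathsf{ID}=\alpha$. \textbf{IND-ID-CPA game.} The adversary receives $k$, the description and the order of the groups, and the master public key. It may at any time request the key generation for identities of its choice, in the accountable scheme by playing the (possibly dishonest) user of the protocol, one execution at a time. Once, it submits $\mathsf{ID}^\star$ and $m_0,m_1\in\mathbb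 G_T$, and receives an encryption of $m_{d^\star}$ for $\mathsf{ID}^\star$, where $d^\star\in\{0,1\}$ is random; finally it outputs a guess $d$ of $d^\star$. Key generation for $\mathsf{ID}^\star$ must never be requested; if the adversary breaks this rule or the format of the game, the outcome is a fair coin. The advantage is $|\Pr[\text{the outcome is }1]-1/2|$, where the outcome is $1$ if $d=d^\star$. A successful adversary is one that is PPT in the game (its total running time is bounded by a polynomial in $k$, for all random choices) and has non-negligible advantage. \textbf{Theorem.} If there is a successful IND-ID-CPA adversary against the accountable scheme, then there is a successful IND-ID-CPA adversary against Gentry's IBE. This holds under each of the following two conventions on repeated identities: (i) identities may be repeated in key generation requests, and both PKGs answer each request with fresh randomness; (ii) the adversary against the accountable scheme only makes key generation requests for distinct identities, and the PKG of Gentry's IBE always uses the same $t_{\mathsf{ID}}$ for the same $\mathsf{ID}$. -/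

import Mathlib

noncomputable section

namespace AIBE

/-! ## Bilinear groups -/

/-- A symmetric bilinear group: two groups of the same prime order `p`, a nondegenerate bilinear
map, and a representation of the elements of both groups by natural numbers. -/
structure BilinearGroup where
  p : ℕ
  prime_p : p.Prime
  G : Type
  GT : Type
  [commGroupG : CommGroup G]
  [commGroupGT : CommGroup GT]
  [fintypeG : Fintype G]
  [fintypeGT : Fintype GT]
  card_G : Fintype.card G = p
  card_GT : Fintype.card GT = p
  e : G → G → GT
  e_zpow : ∀ (x y : G) (a b : ℤ), e (x ^ a) (y ^ b) = e x y ^ (a * b)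
  e_ne_one : ∀ x y : G, x ≠ 1 → y ≠ 1 → e x y ≠ 1
  encG : G → ℕ
  encG_injective : Function.Injective encG
  encGT : GT → ℕ
  encGT_injective : Function.Injective encGT

namespace BilinearGroup

variable (𝔾 : BilinearGroup)

instance : CommGroup 𝔾.G := 𝔾.commGroupG
instance : CommGroup 𝔾.GT := 𝔾.commGroupGT
instance : Fintype 𝔾.G := 𝔾.fintypeG
instance : Fintype 𝔾.GT := 𝔾.fintypeGT
instance : Fact 𝔾.p.Prime := ⟨𝔾.prime_p⟩

instance : Nontrivial 𝔾.G :=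
  Fintype.one_lt_card_iff_nontrivial.mp (by rw [𝔾.card_G]; exact 𝔾.prime_p.one_lt)

instance : Nonempty {x : 𝔾.G // x ≠ 1} :=
  let ⟨x, hx⟩ := exists_ne (1 : 𝔾.G)
  ⟨⟨x, hx⟩⟩

instance : Fintype {x : 𝔾.G // x ≠ 1} := Fintype.ofFinite _

/-- The group element represented by a natural number, if there is one. -/
def decG (n : ℕ) : Option 𝔾.G := Function.partialInv 𝔾.encG n

/-- The target-group element represented by a natural number, if there is one. -/
def decGT (n : ℕ) : Option 𝔾.GT := Function.partialInv 𝔾.encGT n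

end BilinearGroup

/-- Generation of bilinear groups. Groups are described by natural numbers, and `gen k` is the
distribution of the description that is selected for the security parameter `k`. The order of a
selected group exceeds `2 ^ k`; its description and its elements have polynomially many bits. -/
structure BilinearFamily where
  group : ℕ → BilinearGroup
  gen : ℕ → PMF ℕ
  two_pow_lt : ∀ k, ∀ d ∈ (gen k).support, 2 ^ k < (group d).p
  len : Polynomial ℕ
  size_desc : ∀ k, ∀ d ∈ (gen k).support, d.size ≤ len.eval k
  size_encG : ∀ k, ∀ d ∈ (gen k).support, ∀ x, ((group d).encG x).size ≤ len.eval k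
  size_encGT : ∀ k, ∀ d ∈ (gen k).support, ∀ x, ((group d).encGT x).size ≤ len.eval k

/-! ## Probabilistic machines

A register machine with logarithmic cost: registers hold natural numbers, an instruction costs one
plus the bit lengths of its operands. A program has finitely many instructions and thus uses
finitely many registers. Group operations and the pairing are efficient by assumption, and are
instructions that act on representations. -/

/-- The registers of a machine. -/
abbrev Mem := ℕ → ℕ

/-- Instructions; the first argument is the register that receives the result. -/
inductive Instr where
  | const (r n : ℕ)
  | copy (r a : ℕ)
  | add (r a b : ℕ)
  | sub (r a b : ℕ)
  | mul (r a b : ℕ)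
  | div (r a b : ℕ)
  | mod (r a b : ℕ)
  /-- A uniformly random natural number below the content of register `a`. -/
  | rand (r a : ℕ)
  /-- Is the content of `a` a representation of an element of the first group? -/
  | testG (r a : ℕ)
  | mulG (r a b : ℕ)
  /-- The power of the group element in `a` to the exponent in `b`. -/
  | powG (r a b : ℕ)
  /-- Is the content of `a` a representation of an element of the target group? -/
  | testGT (r a : ℕ)
  | mulGT (r a b : ℕ)
  | powGT (r a b : ℕ)
  | pair (r a b : ℕ)

/-- The cost of an instruction in the memory `m`. -/
def Instr.cost (m : Mem) : Instr → ℕ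
  | .const _ n => 1 + n.size
  | .copy _ a | .rand _ a | .testG _ a | .testGT _ a => 1 + (m a).size
  | .add _ a b | .sub _ a b | .mul _ a b | .div _ a b | .mod _ a b
  | .mulG _ a b | .powG _ a b | .mulGT _ a b | .powGT _ a b | .pair _ a b =>
      1 + (m a).size + (m b).size

/-- The distribution of the result of an instruction. A group operation on numbers that do not
represent group elements yields `0`. -/
def Instr.result (𝔾 : BilinearGroup) (m : Mem) : Instr → PMF ℕ
  | .const _ n => pure n
  | .copy _ a => pure (m a)
  | .add _ a b => pure (m a + m b)
  | .sub _ a b => pure (m a - m b)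
  | .mul _ a b => pure (m a * m b)
  | .div _ a b => pure (m a / m b)
  | .mod _ a b => pure (m a % m b)
  | .rand _ a =>
      match m a with
      | 0 => pure 0
      | n + 1 => (PMF.uniformOfFintype (Fin (n + 1))).map (fun i => (i : ℕ))
  | .testG _ a => pure (if (𝔾.decG (m a)).isSome then 1 else 0)
  | .mulG _ a b =>
      pure (match 𝔾.decG (m a), 𝔾.decG (m b) with
        | some x, some y => 𝔾.encG (x * y)
        | _, _ => 0)
  | .powG _ a b =>
      pure (match 𝔾.decG (m a) with
        | some x => 𝔾.encG (x ^ m b)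
        | none => 0)
  | .testGT _ a => pure (if (𝔾.decGT (m a)).isSome then 1 else 0)
  | .mulGT _ a b =>
      pure (match 𝔾.decGT (m a), 𝔾.decGT (m b) with
        | some x, some y => 𝔾.encGT (x * y)
        | _, _ => 0)
  | .powGT _ a b =>
      pure (match 𝔾.decGT (m a) with
        | some x => 𝔾.encGT (x ^ m b)
        | none => 0)
  | .pair _ a b =>
      pure (match 𝔾.decG (m a), 𝔾.decG (m b) with
        | some x, some y => 𝔾.encGT (𝔾.e x y)
        | _, _ => 0)

/-- The register that an instruction overwrites. -/
def Instr.target : Instr → ℕ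
  | .const r _ | .copy r _ | .add r _ _ | .sub r _ _ | .mul r _ _ | .div r _ _ | .mod r _ _
  | .rand r _ | .testG r _ | .mulG r _ _ | .powG r _ _ | .testGT r _ | .mulGT r _ _
  | .powGT r _ _ | .pair r _ _ => r

/-- Programs. -/
inductive Prog where
  | skip
  | instr (i : Instr)
  | seq (P Q : Prog)
  /-- Run `P` if register `r` is nonzero, and `Q` otherwise. -/
  | ite (r : ℕ) (P Q : Prog)
  /-- Run `P` as long as register `r` is nonzero. -/
  | while (r : ℕ) (P : Prog)

/-- Iteration of a loop body, at most `fuel` times. Each test of the loop register costs one unit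
of time, so that a `fuel` equal to the available time `t` is no restriction. -/
def runWhile (r : ℕ) (body : ℕ → Mem → PMF (Option (ℕ × Mem))) :
    (fuel t : ℕ) → Mem → PMF (Option (ℕ × Mem))
  | 0, _, _ => pure none
  | _ + 1, 0, _ => pure none
  | fuel + 1, t + 1, m =>
      if m r = 0 then pure (some (t, m))
      else do
        match ← body t m with
        | none => pure none
        | some (t', m') => runWhile r body fuel t' m'

/-- Execution of a program with time `t` available: the remaining time and the final memory, or
`none` if the program does not halt within time `t`. -/
def Prog.run (𝔾 : BilinearGroup) : Prog → (t : ℕ) → Mem → PMF (Option (ℕ × Mem))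
  | .skip, t, m => pure (some (t, m))
  | .instr i, t, m =>
      if i.cost m ≤ t then
        (i.result 𝔾 m).map (fun v => some (t - i.cost m, Function.update m i.target v))
      else pure none
  | .seq P Q, t, m => do
      match ← P.run 𝔾 t m with
      | none => pure none
      | some (t', m') => Q.run 𝔾 t' m'
  | .ite _ _ _, 0, _ => pure none
  | .ite r P Q, t + 1, m => if m r = 0 then Q.run 𝔾 t m else P.run 𝔾 t m
  | .while r P, t, m => runWhile r (P.run 𝔾) t t m

/-- Deliver a message: registers `0` to `7` are the communication registers, and the message
replaces their content. The other registers keep what the machine has stored there. -/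
def deliver (msg : List ℕ) (m : Mem) : Mem := fun r => if r < 8 then msg.getD r 0 else m r

/-- One activation of an interactive machine. It costs one unit of time in addition to the
cost of the program; the machine leaves its answer in the communication registers. -/
def activate (𝔾 : BilinearGroup) (A : Prog) : (t : ℕ) → Mem → PMF (Option (ℕ × Mem))
  | 0, _ => pure none
  | t + 1, m => A.run 𝔾 t m

/-! ## The two schemes -/

/-- The power of a group element to an exponent modulo `p`. -/
def zpow {p : ℕ} {H : Type} [Group H] (x : H) (a : ZMod p) : H := x ^ a.val

/-- Master public key `(g, g₁, h)`. -/
structure MPK (𝔾 : BilinearGroup) where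
  g : 𝔾.G
  g₁ : 𝔾.G
  h : 𝔾.G

/-- Setup: `g` is a uniformly random generator, `h` is a uniformly random group element,
`g₁ = g ^ α`, and the master secret key `α` is uniform in `(ℤ/pℤ)ˣ`. -/
def setup (𝔾 : BilinearGroup) : PMF (MPK 𝔾 × ZMod 𝔾.p) := do
  let g ← PMF.uniformOfFintype {x : 𝔾.G // x ≠ 1}
  let h ← PMF.uniformOfFintype 𝔾.G
  let α ← PMF.uniformOfFintype (ZMod 𝔾.p)ˣ
  pure (⟨g.1, zpow g.1 (α : ZMod 𝔾.p), h⟩, (α : ZMod 𝔾.p))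

/-- `g₁ · g ^ (-ID)`. -/
def idBase {𝔾 : BilinearGroup} (pk : MPK 𝔾) (ID : ZMod 𝔾.p) : 𝔾.G := pk.g₁ * zpow pk.g (-ID)

/-- Encryption, common to both schemes. -/
def encrypt {𝔾 : BilinearGroup} (pk : MPK 𝔾) (ID : ZMod 𝔾.p) (msg : 𝔾.GT) :
    PMF (𝔾.G × 𝔾.GT × 𝔾.GT) := do
  let s ← PMF.uniformOfFintype (ZMod 𝔾.p)ˣ
  pure (zpow (idBase pk ID) (s : ZMod 𝔾.p), zpow (𝔾.e pk.g pk.g) (s : ZMod 𝔾.p),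
    msg * zpow (𝔾.e pk.g pk.h) (s : ZMod 𝔾.p))

/-- What happens when a private key for the same identity is requested again.
`fresh`: each request is answered with fresh randomness.
`once`: users obtain at most one key per identity, and the PKG of Gentry's scheme uses the same
random exponent whenever it extracts a key for the same identity. -/
inductive Repetition where
  | fresh
  | once

/-- The exponents that Gentry's PKG has used so far. -/
abbrev GentryState (𝔾 : BilinearGroup) := ZMod 𝔾.p → Option (ZMod 𝔾.p)

/-- Gentry's choice of the exponent `t_ID` for the identity `ID`, uniform in `ℤ/pℤ`. -/
def gentryExponent {𝔾 : BilinearGroup} (rep : Repetition) (σ : GentryState 𝔾) (ID : ZMod 𝔾.p) :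
    PMF (ZMod 𝔾.p) :=
  match rep, σ ID with
  | .once, some t => pure t
  | _, _ => PMF.uniformOfFintype (ZMod 𝔾.p)

/-- Key extraction in Gentry's scheme: the machine receives `(d, t_ID)` with
`d = (h · g ^ (-t_ID)) ^ (1 / (α - ID))`, preceded by a `1`. If `ID = α` no key exists, and the
machine receives `0`. -/
def gentryKeygen {𝔾 : BilinearGroup} (rep : Repetition) (pk : MPK 𝔾) (α : ZMod 𝔾.p)
    (σ : GentryState 𝔾) (ID : ZMod 𝔾.p) (t : ℕ) (m : Mem) :
    PMF (Option (GentryState 𝔾 × ℕ × Mem)) := do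
  let tID ← gentryExponent rep σ ID
  let d := zpow (pk.h * zpow pk.g (-tID)) (α - ID)⁻¹
  let reply := if ID = α then [0] else [1, 𝔾.encG d, tID.val]
  pure (some (Function.update σ ID (some tID), t, deliver reply m))

/-- Verification in Okamoto's three-move proof of knowledge of `(t₀, θ)` with
`R = g ^ (-t₀) · (g₁ · g ^ (-ID)) ^ θ`, where `T` is the first message, `c` the challenge and
`(z₁, z₂)` the response. -/
def okamotoAccepts {𝔾 : BilinearGroup} (pk : MPK 𝔾) (ID : ZMod 𝔾.p) (R T : 𝔾.G)
    (c z₁ z₂ : ZMod 𝔾.p) : Prop :=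
  zpow pk.g (-z₁) * zpow (idBase pk ID) z₂ = T * zpow R c

/-- Verification on the messages of the user, which need not represent group elements. The
commitment of an accepted proof is returned. -/
def checkProof {𝔾 : BilinearGroup} (pk : MPK 𝔾) (ID : ZMod 𝔾.p) (R T : ℕ)
    (c : ZMod 𝔾.p) (z₁ z₂ : ℕ) : Option 𝔾.G :=
  open scoped Classical in
  match 𝔾.decG R, 𝔾.decG T with
  | some R, some T => if okamotoAccepts pk ID R T c z₁ z₂ then some R else none
  | _, _ => none

/-- The accountable key generation protocol, the machine `A` playing the user. The registers `2`
and `3` hold the commitment `R` and the first message of the proof. The PKG sends a random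
challenge, and `A` answers with `(z₁, z₂)` in the registers `1` and `2`. If the proof is accepted,
`A` receives `(d', t₁)` with `d' = (h · R · g ^ (-t₁)) ^ (1 / (α - ID))`, preceded by a `1`. If it
is not, or if `ID = α`, then `A` receives `0`. -/
def accountableKeygen {𝔾 : BilinearGroup} (A : Prog) (pk : MPK 𝔾) (α : ZMod 𝔾.p)
    (_ : Unit) (ID : ZMod 𝔾.p) (t : ℕ) (m : Mem) :
    PMF (Option (Unit × ℕ × Mem)) := do
  let c ← PMF.uniformOfFintype (ZMod 𝔾.p)
  match ← activate 𝔾 A t (deliver [c.val] m) with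
  | none => pure none
  | some (t', m') =>
      match checkProof pk ID (m 2) (m 3) c (m' 1) (m' 2) with
      | none => pure (some ((), t', deliver [0] m'))
      | some R =>
          let t₁ ← PMF.uniformOfFintype (ZMod 𝔾.p)ˣ
          let d' := zpow (pk.h * R * zpow pk.g (-(t₁ : ZMod 𝔾.p))) (α - ID)⁻¹
          let reply := if ID = α then [0] else [1, 𝔾.encG d', (t₁ : ZMod 𝔾.p).val]
          pure (some ((), t', deliver reply m'))

/-! ## The IND-ID-CPA game -/

/-- The outcome of a run in which the adversary breaks the rules: a fair coin. -/
def coin : PMF (Option Bool) := (PMF.uniformOfFintype Bool).map some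

/-- The IND-ID-CPA game from the moment at which the adversary `A` is activated with memory `m` and
time `t`. The outcome is `some true` if `A` guesses the challenge bit, `some false` if not, and
`none` if `A` does not halt in time, or repeats an identity although `distinct = true`.

Register `0` of the answer of `A` says what `A` wants; numbers stand for their residues modulo `p`.
* `0`: run the key generation for the identity in register `1`. Afterwards `A` is activated again.
* `1`: get a challenge ciphertext for the identity in register `1` and the two messages in
  the registers `2` and `3`; this is done once.
* `2`: guess; the guessed bit is `1` if and only if register `1` is nonzero.

`keygen` is the key generation, with state `σ`, `asked` are the identities of the requests so far,
and `chal` consists of the challenge identity and the challenge bit, once these are determined.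
Each activation costs time, so that a `fuel` equal to `t` is no restriction. -/
def play {𝔾 : BilinearGroup} {S : Type} (A : Prog) (pk : MPK 𝔾) (distinct : Bool)
    (keygen : S → ZMod 𝔾.p → ℕ → Mem → PMF (Option (S × ℕ × Mem))) :
    (fuel t : ℕ) → (m : Mem) → (σ : S) → (asked : List (ZMod 𝔾.p)) →
      (chal : Option (ZMod 𝔾.p × Bool)) → PMF (Option Bool)
  | 0, _, _, _, _, _ => pure none
  | fuel + 1, t, m, σ, asked, chal => do
      match ← activate 𝔾 A t m with
      | none => pure none
      | some (t', m') =>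
          let ID : ZMod 𝔾.p := (m' 1 : ZMod 𝔾.p)
          match m' 0, chal with
          | 0, _ =>
              if chal.map Prod.fst = some ID then coin
              else if distinct = true ∧ ID ∈ asked then pure none
              else do
                match ← keygen σ ID t' m' with
                | none => pure none
                | some (σ', t'', m'') =>
                    play A pk distinct keygen fuel t'' m'' σ' (ID :: asked) chal
          | 1, none =>
              match 𝔾.decGT (m' 2), 𝔾.decGT (m' 3) with
              | some m₀, some m₁ =>
                  if ID ∈ asked then coin
                  else do
                    let b ← PMF.uniformOfFintype Bool
                    let C ← encrypt pk ID (if b then m₁ else m₀)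
                    play A pk distinct keygen fuel t'
                      (deliver [𝔾.encG C.1, 𝔾.encGT C.2.1, 𝔾.encGT C.2.2] m') σ asked
                      (some (ID, b))
              | _, _ => coin
          | 2, some (_, b) => pure (some (decide (m' 1 ≠ 0) == b))
          | _, _ => coin

/-- The memory of an adversary at the start of the game: security parameter, description and order
of the group, master public key, and zeros. -/
def startMem {𝔾 : BilinearGroup} (k d : ℕ) (pk : MPK 𝔾) : Mem :=
  deliver [k, d, 𝔾.p, 𝔾.encG pk.g, 𝔾.encG pk.g₁, 𝔾.encG pk.h] (fun _ => 0)

/-- The IND-ID-CPA game for Gentry's scheme, with total time `T` for the adversary. -/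
def gentryGame (F : BilinearFamily) (rep : Repetition) (A : Prog) (T k : ℕ) :
    PMF (Option Bool) := do
  let d ← F.gen k
  let (pk, α) ← setup (F.group d)
  play A pk false (gentryKeygen rep pk α) T T (startMem k d pk) (fun _ => none) [] none

/-- The IND-ID-CPA game for the accountable scheme, with total time `T` for the adversary. -/
def accountableGame (F : BilinearFamily) (rep : Repetition) (A : Prog) (T k : ℕ) :
    PMF (Option Bool) := do
  let d ← F.gen k
  let (pk, α) ← setup (F.group d)
  play A pk (match rep with | .fresh => false | .once => true)
    (accountableKeygen A pk α) T T (startMem k d pk) () [] none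

/-- `A` is an admissible adversary that runs in polynomial time `T` in the game `game`, whatever
the random choices are: the outcome `none` has probability zero. -/
def RunsIn (game : Prog → ℕ → ℕ → PMF (Option Bool)) (A : Prog) (T : Polynomial ℕ) : Prop :=
  ∀ k, game A (T.eval k) k none = 0

/-- The advantage `|Pr[game = 1] - 1/2|`. -/
def advantage (game : Prog → ℕ → ℕ → PMF (Option Bool)) (A : Prog) (T : Polynomial ℕ) (k : ℕ) :
    ℝ :=
  |(game A (T.eval k) k (some true)).toReal - 1 / 2|

/-- `f` vanishes faster than any inverse polynomial. -/
def Negligible (f : ℕ → ℝ) : Prop :=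
  Asymptotics.SuperpolynomialDecay Filter.atTop (fun k : ℕ => (k : ℝ)) f

/-- `A` is a successful attacker: it runs in polynomial time, and its advantage is not
negligible. -/
def Breaks (game : Prog → ℕ → ℕ → PMF (Option Bool)) (A : Prog) : Prop :=
  ∃ T : Polynomial ℕ, RunsIn game A T ∧ ¬ Negligible (advantage game A T)

end AIBE

end

noncomputable section

namespace AIBE

open scoped ENNReal

/-! ## Expectations -/

/-! The adversary `reduction A n E` against Gentry's scheme runs `A` as a subroutine and translates
keys. Since `g₁ g^(-ID) = g^(α - ID)`, a Gentry key `((h g^(-t))^(1/(α-ID)), t)` and a witness `(t₀,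
θ)` for the commitment `R` give the accountable PKG's answer for `t₁ = t - t₀`: multiply the first
component by `g^θ` (`convert_key`). For uniform `t` the exponent `t - t₀` is uniform in `ℤ/p`,
whereas the PKG draws `t₁ ≠ 0`; if `t = t₀` the reduction gives up, which costs `1/p` (`unit_loss`).
All other messages pass through unchanged.

The witness comes from rewinding. The reduction plays the verifier itself. If the proof is accepted,
it resets `A` to the state before the challenge and tries at most `N` fresh challenges, until a
second accepted transcript with a different challenge appears; two such transcripts yield `(t₀, θ)`
by special soundness (`extract`). Let `a` be the probability of acceptance from this state. A retry
fails with probability at most `1 - a + 1/p`, so the first proof is accepted and all retries fail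
with probability at most `a · min(1, 1 - a + 1/p)^N ≤ 1/(N+1) + 1/p`, whatever `a` is
(`extraction_loss`). Afterwards `A` continues from its state after the first transcript, so the
extraction does not bias its view. If extraction fails, a malformed message turns the outcome into a
fair coin.

The comparison of the games is one inequality (`simulates`, `game_le`): if a value of outcomes
vanishes at `none` and exceeds the value of a fair coin by at most `l`, its expectation in the
accountable game is at most that in Gentry's game plus `l · T · (1/(N+1) + 2/p)`. For the indicator
of a proper outcome (`l = 0`) this says that the reduction halts in time; for the indicators of the
two proper outcomes (`l = 1`) it bounds the advantage. With `N = (k+2)^E` and `E` large, the loss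
cannot compensate a non-negligible advantage.

Only lower bounds are needed for the reduction, hence the one-sided calculus `Det`, `Ach` and the
one-sided embedding `wp_frame`. `A` lives in the registers below `n`; the private registers, counted
from `n`, hold: 1 initialised; 2-4 `p, g, g₁`; 5 `N`; 6 code of the challenge identity; 7 request
pending; 8-10 `ID, R, T`; 11 `g₁ g^(-ID)`; 12 validity of `R, T`; 13-14 challenge and acceptance;
15-17 first transcript; 18-19 witness; 20 retries left; 21 witness found; 22-27 scratch; from 40 the
state of `A` before the challenge, from `40 + n` its state after the first transcript. -/

/-- The expectation of `f` under `μ`. -/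
def ev {α : Type} (μ : PMF α) (f : α → ℝ≥0∞) : ℝ≥0∞ := ∑' a, μ a * f a

section ev
variable {α β : Type}

lemma ev_mono {μ : PMF α} {f g : α → ℝ≥0∞} (h : ∀ a, μ a ≠ 0 → f a ≤ g a) : ev μ f ≤ ev μ g := by
  refine ENNReal.tsum_le_tsum fun a => ?_
  by_cases ha : μ a = 0
  · simp [ha]
  · exact mul_le_mul_right (h a ha) _

lemma ev_congr {μ : PMF α} {f g : α → ℝ≥0∞} (h : ∀ a, μ a ≠ 0 → f a = g a) : ev μ f = ev μ g :=
  le_antisymm (ev_mono fun a ha => (h a ha).le) (ev_mono fun a ha => (h a ha).ge)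

@[simp] lemma ev_pure (a : α) (f : α → ℝ≥0∞) : ev (pure a : PMF α) f = f a := by
  change ev (PMF.pure a) f = f a
  unfold ev
  rw [tsum_eq_single a]
  · simp
  · intro b hb
    simp [hb]

@[simp] lemma ev_bind (μ : PMF α) (κ : α → PMF β) (f : β → ℝ≥0∞) :
    ev (μ >>= κ) f = ev μ fun a => ev (κ a) f := by
  change ev (μ.bind κ) f = _
  simp only [ev, PMF.bind_apply, ← ENNReal.tsum_mul_right, ← ENNReal.tsum_mul_left]
  rw [ENNReal.tsum_comm]
  simp only [mul_assoc]

@[simp] lemma ev_map (μ : PMF α) (φ : α → β) (f : β → ℝ≥0∞) :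
    ev (μ.map φ) f = ev μ fun a => f (φ a) := by
  rw [← PMF.bind_pure_comp]
  exact (ev_bind μ (fun a => pure (φ a)) f).trans (by simp)

@[simp] lemma ev_const (μ : PMF α) (c : ℝ≥0∞) : (ev μ fun _ => c) = c := by
  simp [ev, ENNReal.tsum_mul_right, μ.tsum_coe]

lemma ev_add (μ : PMF α) (f g : α → ℝ≥0∞) : (ev μ fun a => f a + g a) = ev μ f + ev μ g := by
  simp [ev, mul_add, ENNReal.tsum_add]

lemma ev_mul_left (μ : PMF α) (c : ℝ≥0∞) (f : α → ℝ≥0∞) : (ev μ fun a => c * f a) = c * ev μ f := by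
  simp [ev, mul_left_comm, ENNReal.tsum_mul_left]

lemma ev_uniform [Fintype α] [Nonempty α] (f : α → ℝ≥0∞) :
    ev (PMF.uniformOfFintype α) f = (Fintype.card α : ℝ≥0∞)⁻¹ * ∑ a, f a := by
  simp [ev, Finset.mul_sum]

lemma uniform_ne_zero [Fintype α] [Nonempty α] (a : α) : PMF.uniformOfFintype α a ≠ 0 := by
  simp

lemma ev_indicator (μ : PMF α) (b : α) [DecidableEq α] :
    (ev μ fun a => if a = b then 1 else 0) = μ b := by
  unfold ev
  rw [tsum_eq_single b]
  · simp
  · intro a ha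
    simp [ha]

lemma ev_indicator_ne (μ : PMF α) (b : α) [DecidableEq α] :
    (ev μ fun a => if a = b then 0 else 1) = 1 - μ b := by
  have h : (ev μ fun a => (if a = b then 0 else 1)) + μ b = 1 := by
    rw [← ev_indicator μ b, ← ev_add]
    rw [← ev_const μ 1]
    exact ev_congr fun a _ => by split_ifs <;> simp
  exact ENNReal.eq_sub_of_add_eq (PMF.apply_ne_top μ b) h

lemma ev_le {μ : PMF α} {f : α → ℝ≥0∞} {c : ℝ≥0∞} (h : ∀ a, μ a ≠ 0 → f a ≤ c) : ev μ f ≤ c :=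
  (ev_mono h).trans (ev_const μ c).le

lemma le_ev {μ : PMF α} {f : α → ℝ≥0∞} {c : ℝ≥0∞} (h : ∀ a, μ a ≠ 0 → c ≤ f a) : c ≤ ev μ f :=
  (ev_const μ c).ge.trans (ev_mono h)

lemma bind_apply_eq_zero {μ : PMF α} {κ : α → PMF β} {b : β} :
    (μ >>= κ) b = 0 ↔ ∀ a, μ a ≠ 0 → κ a b = 0 := by
  change (μ.bind κ) b = 0 ↔ _
  simp only [PMF.bind_apply, ENNReal.tsum_eq_zero, mul_eq_zero]
  exact forall_congr' fun a => by tauto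

lemma bind_apply_ne_zero {μ : PMF α} {κ : α → PMF β} {b : β} :
    (μ >>= κ) b ≠ 0 ↔ ∃ a, μ a ≠ 0 ∧ κ a b ≠ 0 := by
  rw [ne_eq, bind_apply_eq_zero]
  push Not
  rfl

lemma pure_apply_ne_zero {a b : α} : (pure a : PMF α) b ≠ 0 ↔ b = a := by
  change PMF.pure a b ≠ 0 ↔ b = a
  simp

lemma pure_apply_eq_zero {a b : α} : (pure a : PMF α) b = 0 ↔ b ≠ a := by
  rw [← not_iff_not, not_not]
  exact pure_apply_ne_zero

lemma map_apply_ne_zero {μ : PMF α} {φ : α → β} {b : β} :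
    (μ.map φ) b ≠ 0 ↔ ∃ a, μ a ≠ 0 ∧ b = φ a := by
  rw [← PMF.mem_support_iff, PMF.mem_support_map_iff]
  simp only [PMF.mem_support_iff, eq_comm]

end ev

/-! ## Values of programs -/

/-- A value of time and memory, extended by `0` to runs that are out of time. -/
def cont (g : ℕ → Mem → ℝ≥0∞) : Option (ℕ × Mem) → ℝ≥0∞
  | none => 0
  | some s => g s.1 s.2

@[simp] lemma cont_none (g : ℕ → Mem → ℝ≥0∞) : cont g none = 0 := rfl
@[simp] lemma cont_some (g : ℕ → Mem → ℝ≥0∞) (s : ℕ × Mem) : cont g (some s) = g s.1 s.2 := rfl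

/-- The expectation of `g` at the end of a run of `P`. -/
def wp (𝔾 : BilinearGroup) (P : Prog) (t : ℕ) (m : Mem) (g : ℕ → Mem → ℝ≥0∞) : ℝ≥0∞ :=
  ev (P.run 𝔾 t m) (cont g)

section wp
variable {𝔾 : BilinearGroup}

lemma wp_mono {P : Prog} {t : ℕ} {m : Mem} {f g : ℕ → Mem → ℝ≥0∞}
    (h : ∀ t' m', P.run 𝔾 t m (some (t', m')) ≠ 0 → f t' m' ≤ g t' m') :
    wp 𝔾 P t m f ≤ wp 𝔾 P t m g := by
  refine ev_mono fun o ho => ?_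
  rcases o with _ | ⟨t', m'⟩
  · simp
  · exact h t' m' ho

lemma wp_skip (t : ℕ) (m : Mem) (g : ℕ → Mem → ℝ≥0∞) : wp 𝔾 .skip t m g = g t m := by
  simp [wp, Prog.run]

lemma wp_instr (i : Instr) (t : ℕ) (m : Mem) (g : ℕ → Mem → ℝ≥0∞) :
    wp 𝔾 (.instr i) t m g = if i.cost m ≤ t then
      ev (i.result 𝔾 m) fun v => g (t - i.cost m) (Function.update m i.target v) else 0 := by
  unfold wp Prog.run
  split_ifs <;> simp

lemma wp_seq (P Q : Prog) (t : ℕ) (m : Mem) (g : ℕ → Mem → ℝ≥0∞) :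
    wp 𝔾 (.seq P Q) t m g = wp 𝔾 P t m fun t' m' => wp 𝔾 Q t' m' g := by
  unfold wp
  rw [Prog.run, ev_bind]
  congr 1
  funext o
  rcases o with _ | ⟨t', m'⟩ <;> simp

lemma wp_ite_succ (r : ℕ) (P Q : Prog) (t : ℕ) (m : Mem) (g : ℕ → Mem → ℝ≥0∞) :
    wp 𝔾 (.ite r P Q) (t + 1) m g = if m r = 0 then wp 𝔾 Q t m g else wp 𝔾 P t m g := by
  unfold wp
  rw [Prog.run]
  split_ifs <;> rfl

lemma ev_runWhile_succ (r : ℕ) (body : ℕ → Mem → PMF (Option (ℕ × Mem))) (fuel t : ℕ) (m : Mem)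
    (g : ℕ → Mem → ℝ≥0∞) :
    ev (runWhile r body (fuel + 1) (t + 1) m) (cont g) = if m r = 0 then g t m else
      ev (body t m) (cont fun t' m' => ev (runWhile r body fuel t' m') (cont g)) := by
  rw [runWhile]
  split_ifs
  · simp
  · rw [ev_bind]
    congr 1
    funext o
    rcases o with _ | ⟨t', m'⟩ <;> simp

lemma runWhile_time_le {r : ℕ} {body : ℕ → Mem → PMF (Option (ℕ × Mem))}
    (hb : ∀ t m s, body t m (some s) ≠ 0 → s.1 ≤ t) :
    ∀ fuel t m s, runWhile r body fuel t m (some s) ≠ 0 → s.1 ≤ t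
  | 0, t, m, s, h => by simp [runWhile, pure_apply_ne_zero] at h
  | fuel + 1, 0, m, s, h => by simp [runWhile, pure_apply_ne_zero] at h
  | fuel + 1, t + 1, m, s, h => by
    rw [runWhile] at h
    split_ifs at h
    · rw [pure_apply_ne_zero, Option.some.injEq] at h
      simp [h]
    · obtain ⟨o, ho, h⟩ := bind_apply_ne_zero.1 h
      rcases o with _ | ⟨t', m'⟩
      · simp [pure_apply_ne_zero] at h
      · have h1 := runWhile_time_le hb fuel t' m' s h
        have h2 : t' ≤ t := hb _ _ _ ho
        omega

lemma run_time_le : ∀ (P : Prog) (t : ℕ) (m : Mem) (s : ℕ × Mem),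
    P.run 𝔾 t m (some s) ≠ 0 → s.1 ≤ t
  | .skip, t, m, s, h => by
    rw [Prog.run, pure_apply_ne_zero, Option.some.injEq] at h
    simp [h]
  | .instr i, t, m, s, h => by
    rw [Prog.run] at h
    split_ifs at h
    · obtain ⟨v, -, hv⟩ := map_apply_ne_zero.1 h
      rw [Option.some.injEq] at hv
      simp [hv]
    · simp [pure_apply_ne_zero] at h
  | .seq P Q, t, m, s, h => by
    rw [Prog.run] at h
    obtain ⟨o, ho, h⟩ := bind_apply_ne_zero.1 h
    rcases o with _ | ⟨t', m'⟩
    · simp [pure_apply_ne_zero] at h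
    · exact (run_time_le Q _ _ _ h).trans (run_time_le P _ _ _ ho)
  | .ite r P Q, 0, m, s, h => by simp [Prog.run, pure_apply_ne_zero] at h
  | .ite r P Q, t + 1, m, s, h => by
    rw [Prog.run] at h
    split_ifs at h
    · exact (run_time_le Q _ _ _ h).trans (Nat.le_succ t)
    · exact (run_time_le P _ _ _ h).trans (Nat.le_succ t)
  | .while r P, t, m, s, h => runWhile_time_le (fun _ _ _ => run_time_le P _ _ _) t t m s h

/-- More fuel only replaces runs of value `0` by others. A loop is started with fuel equal to its
time, and a body may consume much time but only one unit of fuel, so the two must be compared when a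
loop is unrolled. -/
lemma runWhile_fuel_mono (r : ℕ) (body : ℕ → Mem → PMF (Option (ℕ × Mem)))
    (g : ℕ → Mem → ℝ≥0∞) : ∀ (fuel fuel' t : ℕ) (m : Mem), fuel ≤ fuel' →
    ev (runWhile r body fuel t m) (cont g) ≤ ev (runWhile r body fuel' t m) (cont g)
  | 0, fuel', t, m, _ => by simp [runWhile]
  | fuel + 1, fuel', 0, m, _ => by simp [runWhile]
  | fuel + 1, 0, t + 1, m, h => by omega
  | fuel + 1, fuel' + 1, t + 1, m, h => by
    rw [ev_runWhile_succ, ev_runWhile_succ]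
    split_ifs
    · rfl
    · refine ev_mono fun o _ => ?_
      rcases o with _ | ⟨t', m'⟩
      · simp
      · exact runWhile_fuel_mono r body g fuel fuel' t' m' (by omega)

/-- The right side has fuel `t` left after one iteration, the left side only the remaining time `t'
≤ t`; monotonicity in the fuel gives this direction, the only one that lower bounds need. -/
lemma wp_while_unroll (r : ℕ) (P : Prog) (t : ℕ) (m : Mem) (g : ℕ → Mem → ℝ≥0∞) :
    (if m r = 0 then g t m else wp 𝔾 P t m fun t' m' => wp 𝔾 (.while r P) t' m' g) ≤
      wp 𝔾 (.while r P) (t + 1) m g := by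
  change _ ≤ ev (runWhile r (P.run 𝔾) (t + 1) (t + 1) m) (cont g)
  rw [ev_runWhile_succ]
  split_ifs
  · rfl
  · refine ev_mono fun o ho => ?_
    rcases o with _ | ⟨t', m'⟩
    · simp
    · exact runWhile_fuel_mono r _ g _ _ t' m' (run_time_le P _ _ _ ho)

end wp

/-! ## Embedding a machine into a larger memory -/

/-- All registers contain numbers of at most `M` bits. -/
def Bounded (M : ℕ) (m : Mem) : Prop := ∀ r, (m r).size ≤ M

lemma Bounded.update {M : ℕ} {m : Mem} (h : Bounded M m) (r : ℕ) {v : ℕ} (hv : v.size ≤ M) :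
    Bounded M (Function.update m r v) := by
  intro i
  by_cases hi : i = r
  · subst hi; simpa using hv
  · simpa [Function.update_of_ne hi] using h i

/-- The memory whose first `n` registers are those of `x`, followed by the registers of `w`. -/
def mem (n : ℕ) (x w : Mem) : Mem := fun r => if r < n then x r else w (r - n)

lemma mem_of_lt {n r : ℕ} (h : r < n) (x w : Mem) : mem n x w r = x r := if_pos h

@[simp] lemma mem_add (n r : ℕ) (x w : Mem) : mem n x w (n + r) = w r := by simp [mem]

@[simp] lemma update_mem_add (n r v : ℕ) (x w : Mem) :
    Function.update (mem n x w) (n + r) v = mem n x (Function.update w r v) := by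
  funext i
  by_cases hi : i < n
  · rw [Function.update_of_ne (by omega), mem_of_lt hi, mem_of_lt hi]
  · obtain ⟨j, rfl⟩ := Nat.exists_eq_add_of_le (not_lt.1 hi)
    simp [Function.update_apply]

lemma update_mem_of_lt {n r : ℕ} (h : r < n) (v : ℕ) (x w : Mem) :
    Function.update (mem n x w) r v = mem n (Function.update x r v) w := by
  funext i
  by_cases hi : i < n
  · simp [Function.update_apply, mem_of_lt hi]
  · rw [Function.update_of_ne (by omega)]
    simp [mem, hi]

lemma mem_congr {n : ℕ} {x y : Mem} (h : ∀ r < n, x r = y r) (w : Mem) :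
    mem n x w = mem n y w := by
  funext i
  by_cases hi : i < n
  · rw [mem_of_lt hi, mem_of_lt hi, h i hi]
  · simp [mem, hi]

lemma deliver_mem {n : ℕ} (hn : 8 ≤ n) (l : List ℕ) (x w : Mem) :
    deliver l (mem n x w) = mem n (deliver l x) w := by
  funext i
  by_cases hi : i < n
  · simp [deliver, mem_of_lt hi]
  · have : ¬ i < 8 := by omega
    simp [deliver, mem, hi, this]

lemma deliver_congr {n : ℕ} (l : List ℕ) {x y : Mem} (h : ∀ r, 8 ≤ r → r < n → x r = y r)
    (w : Mem) : mem n (deliver l x) w = mem n (deliver l y) w := by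
  refine mem_congr (fun r hr => ?_) w
  by_cases h8 : r < 8
  · simp [deliver, h8]
  · simpa [deliver, h8] using h r (by omega) hr

lemma Bounded.deliver {M : ℕ} {m : Mem} (h : Bounded M m) {l : List ℕ}
    (hl : ∀ v ∈ l, Nat.size v ≤ M) : Bounded M (deliver l m) := by
  intro r
  unfold AIBE.deliver
  split_ifs
  · rw [List.getD_eq_getElem?_getD]
    rcases hr : l[r]? with _ | v
    · simp
    · exact hl v (List.mem_of_getElem? hr)
  · exact h r

lemma Bounded.mem {M n : ℕ} {x w : Mem} (hx : Bounded M x) (hw : Bounded M w) :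
    Bounded M (mem n x w) := by
  intro r
  unfold AIBE.mem
  split_ifs
  exacts [hx r, hw _]

/-- All registers of an instruction are below the bound. -/
def Instr.bound : Instr → ℕ
  | .const r _ => r + 1
  | .copy r a | .rand r a | .testG r a | .testGT r a => max r a + 1
  | .add r a b | .sub r a b | .mul r a b | .div r a b | .mod r a b
  | .mulG r a b | .powG r a b | .mulGT r a b | .powGT r a b | .pair r a b => max r (max a b) + 1

/-- All registers of a program are below the bound. -/
def Prog.bound : Prog → ℕ
  | .skip => 0
  | .instr i => i.bound
  | .seq P Q => max P.bound Q.bound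
  | .ite r P Q => max (r + 1) (max P.bound Q.bound)
  | .while r P => max (r + 1) P.bound

lemma Instr.target_lt {i : Instr} {n : ℕ} (h : i.bound ≤ n) : i.target < n := by
  cases i <;> simp only [Instr.bound, Instr.target] at h ⊢ <;> omega

lemma Instr.cost_mem {i : Instr} {n : ℕ} (h : i.bound ≤ n) (x w : Mem) :
    i.cost (mem n x w) = i.cost x := by
  cases i <;> simp only [Instr.bound, Instr.cost] at h ⊢ <;>
    repeat rw [mem_of_lt (by omega)]

lemma Instr.result_mem {𝔾 : BilinearGroup} {i : Instr} {n : ℕ} (h : i.bound ≤ n) (x w : Mem) :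
    i.result 𝔾 (mem n x w) = i.result 𝔾 x := by
  cases i <;> simp only [Instr.bound, Instr.result] at h ⊢ <;>
    repeat rw [mem_of_lt (by omega)]

/-- The representations of group elements have at most `M` bits. -/
structure BilinearGroup.SizeLE (𝔾 : BilinearGroup) (M : ℕ) : Prop where
  one_le : 1 ≤ M
  encG : ∀ x, (𝔾.encG x).size ≤ M
  encGT : ∀ x, (𝔾.encGT x).size ≤ M

lemma size_add_le (a b : ℕ) : (a + b).size ≤ 1 + a.size + b.size := by
  rw [Nat.size_le]
  have ha := Nat.lt_size_self a
  have hb := Nat.lt_size_self b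
  have h1 : 2 ^ a.size ≤ 2 ^ (a.size + b.size) := Nat.pow_le_pow_right (by norm_num) (by omega)
  have h2 : 2 ^ b.size ≤ 2 ^ (a.size + b.size) := Nat.pow_le_pow_right (by norm_num) (by omega)
  rw [add_assoc, pow_add]
  omega

lemma size_mul_le (a b : ℕ) : (a * b).size ≤ a.size + b.size := by
  rw [Nat.size_le, pow_add]
  exact Nat.mul_lt_mul'' (Nat.lt_size_self a) (Nat.lt_size_self b)

lemma size_sub_le (a b : ℕ) : (a - b).size ≤ a.size := Nat.size_le_size (Nat.sub_le a b)

lemma size_mod_le (a b : ℕ) : (a % b).size ≤ a.size := Nat.size_le_size (Nat.mod_le a b)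

lemma size_div_le (a b : ℕ) : (a / b).size ≤ a.size := Nat.size_le_size (Nat.div_le_self a b)

/-- Logarithmic cost pays for the length of an arithmetic or random result, and group operations
return representations, bounded by `SizeLE`. Thus a machine with at most `M` units of time never
leaves `Bounded M`. -/
lemma Instr.size_result {𝔾 : BilinearGroup} {M : ℕ} (hM : 𝔾.SizeLE M) {i : Instr} {m : Mem}
    (hc : i.cost m ≤ M) {v : ℕ} (hv : i.result 𝔾 m v ≠ 0) : v.size ≤ M := by
  have h1 := hM.one_le
  have hG := hM.encG
  have hGT := hM.encGT
  cases i with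
  | rand r a =>
    simp only [Instr.result, Instr.cost] at hv hc
    refine le_trans ?_ (le_trans (Nat.le_add_left (m a).size 1) hc)
    split at hv
    · rw [pure_apply_ne_zero] at hv
      simp [hv]
    · rename_i n hn
      obtain ⟨_, hv, rfl⟩ := map_apply_ne_zero.1 hv
      obtain ⟨j, -, hv⟩ := bind_apply_ne_zero.1 hv
      rw [pure_apply_ne_zero] at hv
      rw [hn, hv]
      exact Nat.size_le_size (by have := j.2; omega)
  | const r n => simp only [Instr.result, Instr.cost, pure_apply_ne_zero] at hv hc; subst hv; omega
  | copy r a => simp only [Instr.result, Instr.cost, pure_apply_ne_zero] at hv hc; subst hv; omega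
  | add r a b =>
    simp only [Instr.result, Instr.cost, pure_apply_ne_zero] at hv hc; subst hv
    exact (size_add_le _ _).trans hc
  | sub r a b =>
    simp only [Instr.result, Instr.cost, pure_apply_ne_zero] at hv hc; subst hv
    exact (size_sub_le _ _).trans (by omega)
  | mul r a b =>
    simp only [Instr.result, Instr.cost, pure_apply_ne_zero] at hv hc; subst hv
    exact (size_mul_le _ _).trans (by omega)
  | div r a b =>
    simp only [Instr.result, Instr.cost, pure_apply_ne_zero] at hv hc; subst hv
    exact (size_div_le _ _).trans (by omega)
  | mod r a b =>
    simp only [Instr.result, Instr.cost, pure_apply_ne_zero] at hv hc; subst hv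
    exact (size_mod_le _ _).trans (by omega)
  | testG r a | testGT r a =>
    simp only [Instr.result, Instr.cost, pure_apply_ne_zero] at hv hc; subst hv
    split_ifs <;> simp [h1]
  | mulG r a b | powG r a b | mulGT r a b | powGT r a b | pair r a b =>
    simp only [Instr.result, Instr.cost, pure_apply_ne_zero] at hv hc; subst hv
    split <;> simp [hG, hGT]

/-- With more time and in a larger memory, a machine does at least as well. -/
def Frames (n M : ℕ) (body : ℕ → Mem → PMF (Option (ℕ × Mem))) : Prop :=
  ∀ t ≤ M, ∀ m, Bounded M m → ∀ (s : ℕ) (w : Mem) (f h : ℕ → Mem → ℝ≥0∞),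
    (∀ t' ≤ t, ∀ m', Bounded M m' → f t' m' ≤ h (t' + s) (mem n m' w)) →
    ev (body t m) (cont f) ≤ ev (body (t + s) (mem n m w)) (cont h)

lemma runWhile_frame {n M r : ℕ} (hr : r < n) {body : ℕ → Mem → PMF (Option (ℕ × Mem))}
    (hb : Frames n M body) : ∀ fuel fuel' : ℕ, fuel ≤ fuel' → ∀ t ≤ M, ∀ m, Bounded M m →
    ∀ (s : ℕ) (w : Mem) (f h : ℕ → Mem → ℝ≥0∞),
    (∀ t' ≤ t, ∀ m', Bounded M m' → f t' m' ≤ h (t' + s) (mem n m' w)) →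
    ev (runWhile r body fuel t m) (cont f) ≤
      ev (runWhile r body fuel' (t + s) (mem n m w)) (cont h)
  | 0, _, _, t, _, m, _, s, w, f, h, _ => by simp [runWhile]
  | fuel + 1, _, _, 0, _, m, _, s, w, f, h, _ => by simp [runWhile]
  | fuel + 1, 0, hle, t + 1, _, m, _, s, w, f, h, _ => by omega
  | fuel + 1, fuel' + 1, hle, t + 1, ht, m, hm, s, w, f, h, hfh => by
    rw [show t + 1 + s = t + s + 1 by omega, ev_runWhile_succ, ev_runWhile_succ, mem_of_lt hr]
    split_ifs
    · exact hfh t (by omega) m hm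
    · refine hb t (by omega) m hm s w _ _ fun t' ht' m' hm' => ?_
      exact runWhile_frame hr hb fuel fuel' (by omega) t' (by omega) m' hm' s w f h
        fun t'' ht'' => hfh t'' (by omega)

/-- A program touches only registers below its bound, and its costs do not depend on the others, so
the two runs coincide as long as the shorter one has time. It is an inequality because extra time
may rescue runs that otherwise count as `0`. -/
lemma run_frame {𝔾 : BilinearGroup} {n M : ℕ} (hM : 𝔾.SizeLE M) :
    ∀ P : Prog, P.bound ≤ n → Frames n M (P.run 𝔾)
  | .skip, _, t, _, m, hm, s, w, f, h, hfh => by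
    simpa [Prog.run] using hfh t le_rfl m hm
  | .instr i, hP, t, ht, m, hm, s, w, f, h, hfh => by
    change wp 𝔾 _ _ _ _ ≤ wp 𝔾 _ _ _ _
    have hP : i.bound ≤ n := hP
    rw [wp_instr, wp_instr, Instr.cost_mem hP, Instr.result_mem hP]
    split_ifs with h1 h2
    · refine ev_mono fun v hv => ?_
      rw [update_mem_of_lt (Instr.target_lt hP), Nat.sub_add_comm h1]
      exact hfh _ (by omega) _ (hm.update _ (Instr.size_result hM (by omega) hv))
    · omega
    · simp
    · simp
  | .seq P Q, hP, t, ht, m, hm, s, w, f, h, hfh => by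
    change wp 𝔾 _ _ _ _ ≤ wp 𝔾 _ _ _ _
    rw [wp_seq, wp_seq]
    simp only [Prog.bound, max_le_iff] at hP
    refine run_frame hM P hP.1 t ht m hm s w _ _ fun t' ht' m' hm' => ?_
    exact run_frame hM Q hP.2 t' (by omega) m' hm' s w _ _ fun t'' ht'' => hfh t'' (by omega)
  | .ite r P Q, hP, 0, ht, m, hm, s, w, f, h, hfh => by simp [Prog.run]
  | .ite r P Q, hP, t + 1, ht, m, hm, s, w, f, h, hfh => by
    change wp 𝔾 _ _ _ _ ≤ wp 𝔾 _ _ _ _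
    simp only [Prog.bound, max_le_iff] at hP
    rw [show t + 1 + s = t + s + 1 by omega, wp_ite_succ, wp_ite_succ, mem_of_lt (by omega)]
    split_ifs
    · exact run_frame hM Q hP.2.2 t (by omega) m hm s w _ _ fun t' ht' => hfh t' (by omega)
    · exact run_frame hM P hP.2.1 t (by omega) m hm s w _ _ fun t' ht' => hfh t' (by omega)
  | .while r P, hP, t, ht, m, hm, s, w, f, h, hfh => by
    simp only [Prog.bound, max_le_iff] at hP
    exact runWhile_frame (by omega) (run_frame hM P hP.2) t (t + s) (by omega) t ht m hm s w f h hfh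

lemma wp_frame {𝔾 : BilinearGroup} {n M : ℕ} (hM : 𝔾.SizeLE M) {P : Prog} (hP : P.bound ≤ n)
    {t : ℕ} (ht : t ≤ M) {m : Mem} (hm : Bounded M m) (s : ℕ) (w : Mem)
    {f h : ℕ → Mem → ℝ≥0∞}
    (hfh : ∀ t' ≤ t, ∀ m', Bounded M m' → P.run 𝔾 t m (some (t', m')) ≠ 0 →
      f t' m' ≤ h (t' + s) (mem n m' w)) :
    wp 𝔾 P t m f ≤ wp 𝔾 P (t + s) (mem n m w) h := by
  classical
  -- Replacing `f` by `0` off the support leaves the left side unchanged and makes the hypothesis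
  -- necessary on reachable results only.
  refine le_trans (wp_mono (g := fun t' m' =>
    if P.run 𝔾 t m (some (t', m')) ≠ 0 then f t' m' else 0) fun t' m' h' => by simp [h']) ?_
  refine run_frame hM P hP t ht m hm s w _ _ fun t' ht' m' hm' => ?_
  split_ifs with h'
  · exact hfh t' ht' m' hm' h'
  · simp

variable {𝔾 : BilinearGroup}

/-! ## Lower bounds for programs that have enough time -/

/-- Given time `b` more than is needed afterwards, the value of `P` is at least `q`, if the value
afterwards is at least `v`. -/
def Ach (𝔾 : BilinearGroup) (P : Prog) (b : ℕ) (m : Mem) (v : Mem → ℝ≥0∞) (q : ℝ≥0∞) : Prop :=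
  ∀ (t : ℕ) (g : ℕ → Mem → ℝ≥0∞), (∀ t' ≥ t, ∀ m', v m' ≤ g t' m') → q ≤ wp 𝔾 P (t + b) m g

/-- In time `b`, the program `P` turns the memory `m` into `m'`. -/
def Det (𝔾 : BilinearGroup) (P : Prog) (b : ℕ) (m m' : Mem) : Prop :=
  ∀ t, ∃ t' ≥ t, ∀ g : ℕ → Mem → ℝ≥0∞, g t' m' ≤ wp 𝔾 P (t + b) m g

lemma Ach.mono {P : Prog} {b b' : ℕ} {m : Mem} {v v' : Mem → ℝ≥0∞} {q q' : ℝ≥0∞}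
    (h : Ach 𝔾 P b m v q) (hb : b ≤ b') (hv : ∀ m', v m' ≤ v' m') (hq : q' ≤ q) :
    Ach 𝔾 P b' m v' q' := by
  intro t g hg
  have := h (t + (b' - b)) g fun t' ht' m' => (hv m').trans (hg t' (by omega) m')
  rw [show t + (b' - b) + b = t + b' by omega] at this
  exact hq.trans this

lemma Det.mono {P : Prog} {b b' : ℕ} {m m' : Mem} (h : Det 𝔾 P b m m') (hb : b ≤ b') :
    Det 𝔾 P b' m m' := by
  intro t
  obtain ⟨t', ht', h'⟩ := h (t + (b' - b))
  rw [show t + (b' - b) + b = t + b' by omega] at h'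
  exact ⟨t', by omega, h'⟩

lemma Det.ach {P : Prog} {b : ℕ} {m m' : Mem} (h : Det 𝔾 P b m m') (v : Mem → ℝ≥0∞) :
    Ach 𝔾 P b m v (v m') := by
  intro t g hg
  obtain ⟨t', ht', h'⟩ := h t
  exact (hg t' ht' m').trans (h' g)

lemma Det.skip (m : Mem) : Det 𝔾 .skip 0 m m :=
  fun t => ⟨t, le_rfl, fun g => (wp_skip _ _ g).ge⟩

lemma Det.seq {P Q : Prog} {b c : ℕ} {m m' m'' : Mem} (hP : Det 𝔾 P b m m')
    (hQ : Det 𝔾 Q c m' m'') : Det 𝔾 (.seq P Q) (b + c) m m'' := by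
  intro t
  obtain ⟨t₁, ht₁, h₁⟩ := hP (t + c)
  obtain ⟨t₂, ht₂, h₂⟩ := hQ (t + (t₁ - (t + c)))
  rw [show t + (t₁ - (t + c)) + c = t₁ by omega] at h₂
  refine ⟨t₂, by omega, fun g => ?_⟩
  rw [wp_seq, show t + (b + c) = t + c + b by omega]
  exact (h₂ g).trans (h₁ fun t' m' => wp 𝔾 Q t' m' g)

lemma Det.ite_pos {r : ℕ} {P Q : Prog} {b : ℕ} {m m' : Mem} (hr : m r ≠ 0)
    (h : Det 𝔾 P b m m') : Det 𝔾 (.ite r P Q) (b + 1) m m' := by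
  intro t
  obtain ⟨t', ht', h'⟩ := h t
  refine ⟨t', ht', fun g => ?_⟩
  rw [← add_assoc, wp_ite_succ, if_neg hr]
  exact h' g

lemma Det.ite_neg {r : ℕ} {P Q : Prog} {b : ℕ} {m m' : Mem} (hr : m r = 0)
    (h : Det 𝔾 Q b m m') : Det 𝔾 (.ite r P Q) (b + 1) m m' := by
  intro t
  obtain ⟨t', ht', h'⟩ := h t
  refine ⟨t', ht', fun g => ?_⟩
  rw [← add_assoc, wp_ite_succ, if_pos hr]
  exact h' g

lemma Det.while_done {r : ℕ} {P : Prog} {m : Mem} (hr : m r = 0) :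
    Det 𝔾 (.while r P) 1 m m := by
  refine fun t => ⟨t, le_rfl, fun g => ?_⟩
  have := wp_while_unroll (𝔾 := 𝔾) r P t m g
  rwa [if_pos hr] at this

lemma Det.while_step {r : ℕ} {P : Prog} {b c : ℕ} {m m' m'' : Mem} (hr : m r ≠ 0)
    (h : Det 𝔾 P b m m') (h' : Det 𝔾 (.while r P) c m' m'') :
    Det 𝔾 (.while r P) (b + c + 1) m m'' := by
  intro t
  obtain ⟨t', ht', h''⟩ := h.seq h' t
  refine ⟨t', ht', fun g => (h'' g).trans ?_⟩
  have := wp_while_unroll (𝔾 := 𝔾) r P (t + (b + c)) m g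
  rw [if_neg hr] at this
  rw [wp_seq]
  exact this

/-- Time left over by `P` is passed on as surplus to `Q`; this is why `Ach` quantifies over all `t`
and accepts every final time at least `t`. -/
lemma Ach.seq {P Q : Prog} {b c : ℕ} {m : Mem} {u v : Mem → ℝ≥0∞} {q : ℝ≥0∞}
    (hP : Ach 𝔾 P b m u q) (hQ : ∀ m', Ach 𝔾 Q c m' v (u m')) :
    Ach 𝔾 (.seq P Q) (b + c) m v q := by
  intro t g hg
  rw [wp_seq, show t + (b + c) = t + c + b by omega]
  refine hP (t + c) _ fun t' ht' m' => ?_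
  have := hQ m' (t + (t' - (t + c))) g fun t'' ht'' => hg t'' (by omega)
  rwa [show t + (t' - (t + c)) + c = t' by omega] at this

lemma Det.seq_ach {P Q : Prog} {b c : ℕ} {m m' : Mem} {v : Mem → ℝ≥0∞} {q : ℝ≥0∞}
    (hP : Det 𝔾 P b m m') (hQ : Ach 𝔾 Q c m' v q) : Ach 𝔾 (.seq P Q) (b + c) m v q := by
  intro t g hg
  obtain ⟨t₁, ht₁, h₁⟩ := hP (t + c)
  rw [wp_seq, show t + (b + c) = t + c + b by omega]
  refine le_trans ?_ (h₁ _)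
  have := hQ (t + (t₁ - (t + c))) g fun t'' ht'' => hg t'' (by omega)
  rwa [show t + (t₁ - (t + c)) + c = t₁ by omega] at this

lemma Ach.ite_pos {r : ℕ} {P Q : Prog} {b : ℕ} {m : Mem} {v : Mem → ℝ≥0∞} {q : ℝ≥0∞}
    (hr : m r ≠ 0) (h : Ach 𝔾 P b m v q) : Ach 𝔾 (.ite r P Q) (b + 1) m v q := by
  intro t g hg
  rw [← add_assoc, wp_ite_succ, if_neg hr]
  exact h t g hg

lemma Ach.ite_neg {r : ℕ} {P Q : Prog} {b : ℕ} {m : Mem} {v : Mem → ℝ≥0∞} {q : ℝ≥0∞}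
    (hr : m r = 0) (h : Ach 𝔾 Q b m v q) : Ach 𝔾 (.ite r P Q) (b + 1) m v q := by
  intro t g hg
  rw [← add_assoc, wp_ite_succ, if_pos hr]
  exact h t g hg

lemma Ach.while_step {r : ℕ} {P : Prog} {b c : ℕ} {m : Mem} {u v : Mem → ℝ≥0∞} {q : ℝ≥0∞}
    (hr : m r ≠ 0) (h : Ach 𝔾 P b m u q) (h' : ∀ m', Ach 𝔾 (.while r P) c m' v (u m')) :
    Ach 𝔾 (.while r P) (b + c + 1) m v q := by
  intro t g hg
  have h1 := wp_while_unroll (𝔾 := 𝔾) r P (t + (b + c)) m g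
  rw [if_neg hr] at h1
  refine le_trans ?_ h1
  have := h.seq h' t g hg
  rwa [wp_seq] at this

/-- Sampling a number below the content of a register. -/
lemma Ach.rand {r a p : ℕ} [NeZero p] {m : Mem} (ha : m a = p) (v : Mem → ℝ≥0∞) :
    Ach 𝔾 (.instr (.rand r a)) (1 + p.size) m v
      (ev (PMF.uniformOfFintype (ZMod p)) fun c => v (Function.update m r c.val)) := by
  intro t g hg
  obtain ⟨q, rfl⟩ : ∃ q, p = q + 1 := Nat.exists_eq_succ_of_ne_zero (NeZero.ne p)
  have hc : (Instr.rand r a).cost m = 1 + (q + 1).size := by simp [Instr.cost, ha]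
  rw [wp_instr, hc, if_pos (Nat.le_add_left _ _)]
  simp only [Instr.result, ha, ev_map, ev_bind, ev_pure]
  change _ ≤ ev (PMF.uniformOfFintype (Fin (q + 1))) _
  -- `ZMod (q + 1)` is `Fin (q + 1)` by definition, so the two averages are compared term by term.
  rw [ev_uniform, ev_uniform, ZMod.card, Fintype.card_fin]
  refine mul_le_mul_right (Finset.sum_le_sum fun i _ => ?_) _
  exact hg _ (by omega) _

/-- A machine that is embedded into a larger memory. -/
lemma Ach.frame {n M : ℕ} (hM : 𝔾.SizeLE M) {P : Prog} (hP : P.bound ≤ n)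
    {t : ℕ} (ht : t ≤ M) {x : Mem} (hx : Bounded M x) (w : Mem)
    {f : ℕ → Mem → ℝ≥0∞} {v : Mem → ℝ≥0∞}
    (hfv : ∀ t' ≤ t, ∀ x', Bounded M x' → P.run 𝔾 t x (some (t', x')) ≠ 0 →
      f t' x' ≤ v (mem n x' w)) :
    Ach 𝔾 P t (mem n x w) v (wp 𝔾 P t x f) := by
  intro s g hg
  rw [add_comm s t]
  exact wp_frame hM hP ht hx s w fun t' ht' x' hx' h' =>
    (hfv t' ht' x' hx' h').trans (hg _ (by omega) _)

/-! ## Straight-line programs -/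

/-- Multiplication of representations. -/
def mulN (𝔾 : BilinearGroup) (a b : ℕ) : ℕ :=
  match 𝔾.decG a, 𝔾.decG b with
  | some x, some y => 𝔾.encG (x * y)
  | _, _ => 0

/-- Powers of representations. -/
def powN (𝔾 : BilinearGroup) (a b : ℕ) : ℕ :=
  match 𝔾.decG a with
  | some x => 𝔾.encG (x ^ b)
  | none => 0

/-- Recognition of representations. -/
def testN (𝔾 : BilinearGroup) (a : ℕ) : ℕ := if (𝔾.decG a).isSome then 1 else 0

@[simp] lemma decG_encG (x : 𝔾.G) : 𝔾.decG (𝔾.encG x) = some x :=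
  Function.partialInv_left 𝔾.encG_injective x

lemma encG_of_decG {a : ℕ} {x : 𝔾.G} (h : 𝔾.decG a = some x) : 𝔾.encG x = a :=
  (𝔾.encG_injective.isPartialInv x a).1 h

@[simp] lemma mulN_encG (x y : 𝔾.G) : mulN 𝔾 (𝔾.encG x) (𝔾.encG y) = 𝔾.encG (x * y) := by
  simp [mulN]

@[simp] lemma powN_encG (x : 𝔾.G) (b : ℕ) : powN 𝔾 (𝔾.encG x) b = 𝔾.encG (x ^ b) := by
  simp [powN]

lemma size_mulN {M : ℕ} (hM : 𝔾.SizeLE M) (a b : ℕ) : (mulN 𝔾 a b).size ≤ M := by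
  unfold mulN
  split <;> simp [hM.encG]

lemma size_powN {M : ℕ} (hM : 𝔾.SizeLE M) (a b : ℕ) : (powN 𝔾 a b).size ≤ M := by
  unfold powN
  split <;> simp [hM.encG]

lemma testN_le (a : ℕ) : testN 𝔾 a ≤ 1 := by
  unfold testN
  split_ifs <;> simp

/-- Deterministic instructions that do not involve the target group. -/
inductive Op where
  | const (r n : ℕ)
  | copy (r a : ℕ)
  | add (r a b : ℕ)
  | sub (r a b : ℕ)
  | mul (r a b : ℕ)
  | div (r a b : ℕ)
  | mod (r a b : ℕ)
  | testG (r a : ℕ)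
  | mulG (r a b : ℕ)
  | powG (r a b : ℕ)

/-- The instruction. -/
def Op.instr : Op → Instr
  | .const r n => .const r n
  | .copy r a => .copy r a
  | .add r a b => .add r a b
  | .sub r a b => .sub r a b
  | .mul r a b => .mul r a b
  | .div r a b => .div r a b
  | .mod r a b => .mod r a b
  | .testG r a => .testG r a
  | .mulG r a b => .mulG r a b
  | .powG r a b => .powG r a b

/-- The register that receives the result. -/
def Op.target : Op → ℕ
  | .const r _ | .copy r _ | .add r _ _ | .sub r _ _ | .mul r _ _ | .div r _ _ | .mod r _ _
  | .testG r _ | .mulG r _ _ | .powG r _ _ => r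

/-- The result. -/
def Op.val (𝔾 : BilinearGroup) (m : Mem) : Op → ℕ
  | .const _ n => n
  | .copy _ a => m a
  | .add _ a b => m a + m b
  | .sub _ a b => m a - m b
  | .mul _ a b => m a * m b
  | .div _ a b => m a / m b
  | .mod _ a b => m a % m b
  | .testG _ a => testN 𝔾 (m a)
  | .mulG _ a b => mulN 𝔾 (m a) (m b)
  | .powG _ a b => powN 𝔾 (m a) (m b)

/-- Straight-line programs. -/
def block : List Op → Prog
  | [] => .skip
  | o :: l => .seq (.instr o.instr) (block l)

/-- The effect of a straight-line program. -/
def exec (𝔾 : BilinearGroup) : List Op → Mem → Mem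
  | [], m => m
  | o :: l, m => exec 𝔾 l (Function.update m o.target (o.val 𝔾 m))

/-- All results of a straight-line program have at most `M` bits. -/
def Fits (𝔾 : BilinearGroup) (M : ℕ) : List Op → Mem → Prop
  | [], _ => True
  | o :: l, m => (o.val 𝔾 m).size ≤ M ∧ Fits 𝔾 M l (Function.update m o.target (o.val 𝔾 m))

lemma Op.det {M : ℕ} {o : Op} {m : Mem} (hm : Bounded M m) (ho : (o.val 𝔾 m).size ≤ M) :
    Det 𝔾 (.instr o.instr) (1 + 2 * M) m (Function.update m o.target (o.val 𝔾 m)) := by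
  have hc : o.instr.cost m ≤ 1 + 2 * M := by
    cases o with
    | const r n => simp only [Op.val, Op.instr, Instr.cost] at ho ⊢; omega
    | copy r a | testG r a => simp only [Op.instr, Instr.cost]; have := hm a; omega
    | add r a b | sub r a b | mul r a b | div r a b | mod r a b | mulG r a b | powG r a b =>
      simp only [Op.instr, Instr.cost]; have := hm a; have := hm b; omega
  have hr : o.instr.result 𝔾 m = pure (o.val 𝔾 m) := by cases o <;> rfl
  have ht : o.instr.target = o.target := by cases o <;> rfl
  refine fun t => ⟨t + (1 + 2 * M) - o.instr.cost m, by omega, fun g => ?_⟩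
  rw [wp_instr, if_pos (by omega), hr, ev_pure, ht]

lemma block_det {M : ℕ} : ∀ (l : List Op) (m : Mem), Bounded M m → Fits 𝔾 M l m →
    Det 𝔾 (block l) (l.length * (1 + 2 * M)) m (exec 𝔾 l m)
  | [], m, _, _ => (Det.skip m).mono (Nat.zero_le _)
  | o :: l, m, hm, h => by
    refine ((Op.det hm h.1).seq (block_det l _ (hm.update _ h.1) h.2)).mono ?_
    rw [List.length_cons, add_mul, one_mul, add_comm]

lemma exec_bounded {M : ℕ} : ∀ (l : List Op) (m : Mem), Bounded M m → Fits 𝔾 M l m →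
    Bounded M (exec 𝔾 l m)
  | [], _, hm, _ => hm
  | _ :: l, _, hm, h => exec_bounded l _ (hm.update _ h.1) h.2

lemma exec_append : ∀ (l l' : List Op) (m : Mem),
    exec 𝔾 (l ++ l') m = exec 𝔾 l' (exec 𝔾 l m)
  | [], _, _ => rfl
  | _ :: l, l', _ => exec_append l l' _

lemma fits_append {M : ℕ} : ∀ (l l' : List Op) (m : Mem),
    Fits 𝔾 M (l ++ l') m ↔ Fits 𝔾 M l m ∧ Fits 𝔾 M l' (exec 𝔾 l m)
  | [], l', m => by simp [Fits, exec]
  | _ :: l, l', m => by simp [Fits, exec, fits_append l l', and_assoc]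

/-- Copy `k` registers from `src` on to the registers from `dst` on. -/
def copyOps (dst src : ℕ) : ℕ → List Op
  | 0 => []
  | k + 1 => copyOps dst src k ++ [.copy (dst + k) (src + k)]

@[simp] lemma length_copyOps (dst src k : ℕ) : (copyOps dst src k).length = k := by
  induction k <;> simp_all [copyOps]

/-- Disjointness of the two ranges ensures that no source register is overwritten before it is read.
-/
lemma exec_copyOps {dst src : ℕ} (k : ℕ) (h : src + k ≤ dst ∨ dst + k ≤ src) (m : Mem) :
    exec 𝔾 (copyOps dst src k) m =
      fun r => if dst ≤ r ∧ r < dst + k then m (src + (r - dst)) else m r := by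
  induction k with
  | zero => funext r; simp [copyOps, exec]
  | succ k ih =>
    rw [copyOps, exec_append, ih (by omega)]
    funext r
    simp only [exec, Op.target, Op.val, Function.update_apply]
    by_cases hr : r = dst + k
    · subst hr
      rw [if_pos rfl, if_neg (by omega), if_pos (by omega)]
      congr 1
      omega
    · rw [if_neg hr]
      by_cases h1 : dst ≤ r ∧ r < dst + k
      · rw [if_pos h1, if_pos (by omega)]
      · rw [if_neg h1, if_neg (by omega)]

lemma fits_copyOps {M dst src : ℕ} (k : ℕ) {m : Mem} (hm : Bounded M m) :
    Fits 𝔾 M (copyOps dst src k) m := by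
  induction k with
  | zero => trivial
  | succ k ih => exact (fits_append _ _ _).2 ⟨ih, exec_bounded _ _ hm ih _, trivial⟩

attribute [simp] exec Op.target Op.val Fits block

/-- `M` bounds the bit lengths of all numbers in a game. -/
structure BilinearGroup.Room (𝔾 : BilinearGroup) (M N : ℕ) : Prop extends 𝔾.SizeLE M where
  size_p : 2 * 𝔾.p.size + 2 ≤ M
  size_N : N.size ≤ M

lemma size_le_of_le_one {M a : ℕ} (hM : 1 ≤ M) (h : a ≤ 1) : a.size ≤ M :=
  (Nat.size_le_size h).trans hM

lemma BilinearGroup.Room.of_lt {M N a : ℕ} (h : 𝔾.Room M N) (ha : a ≤ 2 * 𝔾.p) : a.size ≤ M := by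
  have h1 := size_mul_le 2 𝔾.p
  have h2 := h.size_p
  have h3 : Nat.size 2 = 2 := by decide
  have := Nat.size_le_size ha
  omega

lemma BilinearGroup.Room.mul {M N a b : ℕ} (h : 𝔾.Room M N) (ha : a ≤ 𝔾.p) (hb : b ≤ 𝔾.p) :
    (a * b).size ≤ M := by
  have h1 := size_mul_le a b
  have h2 := h.size_p
  have := Nat.size_le_size ha
  have := Nat.size_le_size hb
  omega

lemma BilinearGroup.mod_lt (𝔾 : BilinearGroup) (a : ℕ) : a % 𝔾.p < 𝔾.p :=
  Nat.mod_lt a 𝔾.prime_p.pos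

/-! ## Inversion modulo `p` -/

/-- One step of the exponentiation of `22` to the power `26`, with result in `27`. -/
def powBody (n : ℕ) : Prog :=
  .seq (block [.const (n + 23) 2, .mod (n + 24) (n + 26) (n + 23)]) <|
  .seq (.ite (n + 24) (block [.mul (n + 27) (n + 27) (n + 22), .mod (n + 27) (n + 27) (n + 2)])
    .skip)
  (block [.mul (n + 22) (n + 22) (n + 22), .mod (n + 22) (n + 22) (n + 2),
    .div (n + 26) (n + 26) (n + 23)])

lemma powBody_spec {n M N : ℕ} (hR : 𝔾.Room M N) {x w : Mem} (hx : Bounded M x) (hw : Bounded M w)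
    (hp : w 2 = 𝔾.p) (h22 : w 22 < 𝔾.p) (h27 : w 27 < 𝔾.p) :
    ∃ w', Det 𝔾 (powBody n) (7 * (1 + 2 * M) + 1) (mem n x w) (mem n x w') ∧ Bounded M w' ∧
      (∀ i, (i < 22 ∨ 28 ≤ i) → w' i = w i) ∧ w' 22 < 𝔾.p ∧ w' 27 < 𝔾.p ∧ w' 26 = w 26 / 2 ∧
      (w' 22 : ZMod 𝔾.p) = w 22 * w 22 ∧
      (w' 27 : ZMod 𝔾.p) = w 27 * (w 22 : ZMod 𝔾.p) ^ (w 26 % 2) := by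
  have h2 : Nat.size 2 ≤ M := hR.of_lt (by have := 𝔾.prime_p.two_le; omega)
  have hm := 𝔾.mod_lt
  have hf1 : Fits 𝔾 M [.const (n + 23) 2, .mod (n + 24) (n + 26) (n + 23)] (mem n x w) := by
    simpa [h2] using (size_mod_le _ _).trans (hw 26)
  have d1 := block_det _ _ (hx.mem hw) hf1
  simp only [exec, Op.target, Op.val, update_mem_add, mem_add] at d1
  set w1 := Function.update w 23 2 with hw1
  set w2 := Function.update w1 24 (w1 26 % w1 23) with hw2
  have b2 : Bounded M w2 := by
    refine (hw.update _ h2).update _ ((size_mod_le _ _).trans ?_)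
    simpa [hw1] using hw 26
  obtain ⟨w3, d3, b3, k3, k27, e27⟩ : ∃ w3, Det 𝔾 (.ite (n + 24)
      (block [.mul (n + 27) (n + 27) (n + 22), .mod (n + 27) (n + 27) (n + 2)]) .skip)
      (2 * (1 + 2 * M) + 1) (mem n x w2) (mem n x w3) ∧ Bounded M w3 ∧
      (∀ i, i ≠ 27 → w3 i = w2 i) ∧ w3 27 < 𝔾.p ∧
      (w3 27 : ZMod 𝔾.p) = w 27 * (w 22 : ZMod 𝔾.p) ^ (w 26 % 2) := by
    by_cases h24 : w2 24 = 0
    · refine ⟨w2, ((Det.skip _).ite_neg (by simpa using h24)).mono (by omega), b2,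
        fun i _ => rfl, by simpa [hw2, hw1] using h27, ?_⟩
      have : w 26 % 2 = 0 := by simpa [hw2, hw1] using h24
      simp [this, hw2, hw1]
    · have : w 26 % 2 = 1 := by
        have : w 26 % 2 ≠ 0 := by simpa [hw2, hw1] using h24
        omega
      have hf : Fits 𝔾 M [.mul (n + 27) (n + 27) (n + 22), .mod (n + 27) (n + 27) (n + 2)]
          (mem n x w2) := by
        simp [hw2, hw1, hp]
        exact ⟨hR.mul h27.le h22.le, hR.of_lt (by have := hm (w 27 * w 22); omega)⟩
      have d := block_det _ _ (hx.mem b2) hf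
      simp only [exec, Op.target, Op.val, update_mem_add, mem_add] at d
      refine ⟨_, d.ite_pos (by simpa using h24), ?_, ?_, ?_, ?_⟩
      · have hb := exec_bounded _ _ (hx.mem b2) hf
        intro i
        simpa using hb (n + i)
      · intro i hi
        simp [hi]
      · simpa [hw2, hw1, hp] using hm _
      · simp [hw2, hw1, hp, this]
  have hf4 : Fits 𝔾 M [.mul (n + 22) (n + 22) (n + 22), .mod (n + 22) (n + 22) (n + 2),
      .div (n + 26) (n + 26) (n + 23)] (mem n x w3) := by
    simp [k3, hw2, hw1, hp]
    exact ⟨hR.mul h22.le h22.le, hR.of_lt (by have := hm (w 22 * w 22); omega),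
      (size_div_le _ _).trans (hw 26)⟩
  have d4 := block_det _ _ (hx.mem b3) hf4
  have b4 := exec_bounded _ _ (hx.mem b3) hf4
  simp only [exec, Op.target, Op.val, update_mem_add, mem_add] at d4 b4
  refine ⟨_, (d1.seq (d3.seq d4)).mono (by simp; omega), fun i => by simpa using b4 (n + i),
    ?_, ?_, ?_, ?_, ?_, ?_⟩
  · intro i hi
    have h1 : i ≠ 22 := by omega
    have h2 : i ≠ 26 := by omega
    have h3 : i ≠ 27 := by omega
    have h4 : i ≠ 23 := by omega
    have h5 : i ≠ 24 := by omega
    simp [h1, h2, h4, h5, k3 i h3, hw2, hw1]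
  · simpa [k3, hw2, hw1, hp] using hm _
  · simpa using k27
  · simp [k3, hw2, hw1]
  · simp [k3, hw2, hw1, hp]
  · simpa using e27

/-- Square and multiply: modulo `p`, the product of register `27` with register `22` to the power in
`26` is invariant. The exponent is halved in each round, so `k` rounds suffice below `2 ^ k`. -/
lemma powLoop_spec {n M N : ℕ} (hR : 𝔾.Room M N) {x : Mem} (hx : Bounded M x) :
    ∀ (k : ℕ) (w : Mem), Bounded M w → w 2 = 𝔾.p → w 22 < 𝔾.p → w 27 < 𝔾.p → w 26 < 2 ^ k →
    ∃ w', Det 𝔾 (.while (n + 26) (powBody n)) (k * (7 * (1 + 2 * M) + 2) + 1)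
      (mem n x w) (mem n x w') ∧ Bounded M w' ∧
      (∀ i, (i < 22 ∨ 28 ≤ i) → w' i = w i) ∧ w' 27 < 𝔾.p ∧
      (w' 27 : ZMod 𝔾.p) = w 27 * (w 22 : ZMod 𝔾.p) ^ w 26 := by
  intro k
  induction k with
  | zero =>
    intro w hw hp h22 h27 h26
    have h0 : w 26 = 0 := by omega
    exact ⟨w, (Det.while_done (by simpa using h0)).mono (by omega), hw, fun _ _ => rfl, h27,
      by simp [h0]⟩
  | succ k ih =>
    intro w hw hp h22 h27 h26
    by_cases h0 : w 26 = 0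
    · exact ⟨w, (Det.while_done (by simpa using h0)).mono (by omega), hw, fun _ _ => rfl, h27,
        by simp [h0]⟩
    obtain ⟨w1, d1, b1, k1, l22, l27, e26, e22, e27⟩ := powBody_spec (n := n) hR hx hw hp h22 h27
    obtain ⟨w2, d2, b2, k2, l27', e27'⟩ := ih w1 b1 (by rw [k1 2 (by omega), hp]) l22 l27
      (by rw [e26]; omega)
    refine ⟨w2, (d1.while_step (by simpa using h0) d2).mono ?_, b2, fun i hi => ?_, l27', ?_⟩
    · exact le_of_eq (by ring)
    · rw [k2 i hi, k1 i hi]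
    · rw [e27', e27, e22, e26, mul_assoc, ← pow_two, ← pow_mul, ← pow_add, Nat.mod_add_div]

/-- The inverse of `22` modulo `p` in `27`. -/
def invert (n : ℕ) : Prog :=
  .seq (block [.const (n + 27) 1, .const (n + 23) 2, .sub (n + 26) (n + 2) (n + 23)])
    (.while (n + 26) (powBody n))

/-- Fermat's little theorem: the inverse is the power with exponent `p - 2`. This exponent has at
most `M` bits, which gives the number of rounds in the time bound. -/
lemma invert_spec {n M N : ℕ} (hR : 𝔾.Room M N) {x w : Mem} (hx : Bounded M x) (hw : Bounded M w)
    (hp : w 2 = 𝔾.p) (h22 : w 22 < 𝔾.p) (h0 : (w 22 : ZMod 𝔾.p) ≠ 0) :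
    ∃ w', Det 𝔾 (invert n) (3 * (1 + 2 * M) + (M * (7 * (1 + 2 * M) + 2) + 1))
      (mem n x w) (mem n x w') ∧ Bounded M w' ∧
      (∀ i, (i < 22 ∨ 28 ≤ i) → w' i = w i) ∧ w' 27 < 𝔾.p ∧
      (w' 27 : ZMod 𝔾.p) = (w 22 : ZMod 𝔾.p)⁻¹ := by
  have h2 : Nat.size 2 ≤ M := hR.of_lt (by have := 𝔾.prime_p.two_le; omega)
  have hM := hR.one_le
  have hf : Fits 𝔾 M [.const (n + 27) 1, .const (n + 23) 2, .sub (n + 26) (n + 2) (n + 23)]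
      (mem n x w) := by
    simp [h2, hM, hp]
    exact hR.of_lt (by omega)
  have d := block_det _ _ (hx.mem hw) hf
  have b := exec_bounded _ _ (hx.mem hw) hf
  simp only [exec, Op.target, Op.val, update_mem_add, mem_add] at d b
  set w1 := Function.update w 27 1 with hw1
  set w2 := Function.update w1 23 2 with hw2
  set w3 := Function.update w2 26 (w2 2 - w2 23) with hw3
  have b3 : Bounded M w3 := fun i => by simpa using b (n + i)
  obtain ⟨w', d', b', k', l', e'⟩ := powLoop_spec (n := n) hR hx M w3 b3 (by simp [hw3, hw2, hw1, hp])
    (by simpa [hw3, hw2, hw1] using h22) (by simpa [hw3, hw2, hw1] using 𝔾.prime_p.one_lt)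
    (Nat.size_le.1 (b3 26))
  refine ⟨w', d.seq d', b', fun i hi => ?_, l', ?_⟩
  · have h1 : i ≠ 23 := by omega
    have h2 : i ≠ 26 := by omega
    have h3 : i ≠ 27 := by omega
    simp [k' i hi, hw3, hw2, hw1, h1, h2, h3]
  · rw [e']
    have hp' : w3 26 = 𝔾.p - 2 := by simp [hw3, hw2, hw1, hp]
    rw [hp', show w3 27 = 1 by simp [hw3, hw2, hw1], show w3 22 = w 22 by simp [hw3, hw2, hw1],
      Nat.cast_one, one_mul]
    refine eq_inv_of_mul_eq_one_left ?_
    rw [← pow_succ, show 𝔾.p - 2 + 1 = 𝔾.p - 1 by have := 𝔾.prime_p.two_le; omega]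
    exact ZMod.pow_card_sub_one_eq_one h0

/-! ## Exponents modulo `p` -/

/-- The group has order `p`, so exponents matter only modulo `p`. All laws of `zpow` below are
reduced to natural exponents in this way. -/
lemma pow_eq_zpow (x : 𝔾.G) (a : ℕ) : x ^ a = zpow x (a : ZMod 𝔾.p) := by
  rw [zpow, ZMod.val_natCast, ← 𝔾.card_G, pow_mod_card]

lemma zpow_add (x : 𝔾.G) (a b : ZMod 𝔾.p) : zpow x (a + b) = zpow x a * zpow x b := by
  rw [← ZMod.natCast_zmod_val a, ← ZMod.natCast_zmod_val b, ← Nat.cast_add, ← pow_eq_zpow,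
    ← pow_eq_zpow, ← pow_eq_zpow, pow_add]

lemma zpow_mul (x : 𝔾.G) (a b : ZMod 𝔾.p) : zpow x (a * b) = zpow (zpow x a) b := by
  rw [← ZMod.natCast_zmod_val a, ← ZMod.natCast_zmod_val b, ← Nat.cast_mul, ← pow_eq_zpow,
    ← pow_eq_zpow, ← pow_eq_zpow, pow_mul]

lemma mul_zpow (x y : 𝔾.G) (a : ZMod 𝔾.p) : zpow (x * y) a = zpow x a * zpow y a := mul_pow x y _

@[simp] lemma zpow_zero (x : 𝔾.G) : zpow x (0 : ZMod 𝔾.p) = 1 := by simp [zpow]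

@[simp] lemma zpow_one (x : 𝔾.G) : zpow x (1 : ZMod 𝔾.p) = x := by
  rw [← Nat.cast_one, ← pow_eq_zpow, pow_one]

lemma zpow_neg (x : 𝔾.G) (a : ZMod 𝔾.p) : zpow x (-a) = (zpow x a)⁻¹ := by
  rw [eq_inv_iff_mul_eq_one, ← zpow_add]
  simp

lemma zpow_sub (x : 𝔾.G) (a b : ZMod 𝔾.p) : zpow x (a - b) = zpow x a * (zpow x b)⁻¹ := by
  rw [sub_eq_add_neg, zpow_add, zpow_neg]

lemma cast_neg_mod (a : ℕ) : ((𝔾.p - a % 𝔾.p : ℕ) : ZMod 𝔾.p) = -(a : ZMod 𝔾.p) := by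
  rw [Nat.cast_sub (𝔾.mod_lt a).le]
  simp

/-- Two accepted proofs with the same first message and different challenges yield a witness. -/
lemma extract {pk : MPK 𝔾} {ID : ZMod 𝔾.p} {R T : 𝔾.G} {c c' z₁ z₂ z₁' z₂' : ZMod 𝔾.p}
    (hc : c - c' ≠ 0) (h : okamotoAccepts pk ID R T c z₁ z₂)
    (h' : okamotoAccepts pk ID R T c' z₁' z₂') :
    R = zpow pk.g (-((z₁ - z₁') * (c - c')⁻¹)) * zpow (idBase pk ID) ((z₂ - z₂') * (c - c')⁻¹) := by
  -- Dividing the two verification equations cancels the common first message `T`; it remains to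
  -- take the root of order `c - c'`.
  have h1 : zpow R (c - c') = zpow pk.g (-(z₁ - z₁')) * zpow (idBase pk ID) (z₂ - z₂') := by
    have e : zpow R c = T⁻¹ * (zpow pk.g (-z₁) * zpow (idBase pk ID) z₂) := by
      rw [show _ = _ from h]; group
    have e' : zpow R c' = T⁻¹ * (zpow pk.g (-z₁') * zpow (idBase pk ID) z₂') := by
      rw [show _ = _ from h']; group
    rw [zpow_sub, e, e', neg_sub, zpow_sub, zpow_sub, zpow_neg, zpow_neg]
    generalize zpow pk.g z₁ = a
    generalize zpow pk.g z₁' = b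
    generalize zpow (idBase pk ID) z₂ = u
    generalize zpow (idBase pk ID) z₂' = v
    rw [mul_inv, inv_inv, mul_inv, inv_inv]
    calc T⁻¹ * (a⁻¹ * u) * (T * (b * v⁻¹)) = (T⁻¹ * T) * (b * a⁻¹ * (u * v⁻¹)) := by
          simp only [mul_comm, mul_left_comm, mul_assoc]
      _ = _ := by simp
  calc R = zpow (zpow R (c - c')) (c - c')⁻¹ := by
        rw [← zpow_mul, mul_inv_cancel₀ hc, zpow_one]
    _ = _ := by rw [h1, mul_zpow, ← zpow_mul, ← zpow_mul, neg_mul]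

/-- The reply of the accountable PKG, computed from the key of Gentry's PKG and a witness. -/
lemma convert_key {pk : MPK 𝔾} {ID α t₀ θ : ZMod 𝔾.p} (hpk : pk.g₁ = zpow pk.g α) (hα : ID ≠ α)
    (t : ZMod 𝔾.p) :
    zpow (pk.h * zpow pk.g (-t)) (α - ID)⁻¹ * zpow pk.g θ =
      zpow (pk.h * (zpow pk.g (-t₀) * zpow (idBase pk ID) θ) * zpow pk.g (-(t - t₀)))
        (α - ID)⁻¹ := by
  have h1 : idBase pk ID = zpow pk.g (α - ID) := by
    rw [idBase, hpk, ← zpow_add, sub_eq_add_neg]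
  -- The factor `g^θ` is computable without `α`, yet it is exactly the contribution of the `θ`-part
  -- of `R` to the key.
  have h2 : zpow pk.g θ = zpow (zpow (idBase pk ID) θ) (α - ID)⁻¹ := by
    rw [h1, ← zpow_mul, ← zpow_mul, mul_left_comm,
      mul_inv_cancel₀ (sub_ne_zero.2 (Ne.symm hα)), mul_one]
  rw [h2, ← mul_zpow]
  congr 1
  have h3 : zpow pk.g (-t) = zpow pk.g (-t₀) * zpow pk.g (-(t - t₀)) := by
    rw [← zpow_add]; congr 1; ring
  rw [h3]
  simp only [mul_comm, mul_left_comm, mul_assoc]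

/-! ## One run of the proof of knowledge -/

/-- Verification of the proof that the responses in `1` and `2` complete. -/
def verifyOps (n : ℕ) : List Op :=
  [.mod (n + 22) 1 (n + 2), .sub (n + 22) (n + 2) (n + 22), .powG (n + 22) (n + 3) (n + 22),
   .powG (n + 23) (n + 11) 2, .mulG (n + 22) (n + 22) (n + 23),
   .powG (n + 23) (n + 9) (n + 13), .mulG (n + 23) (n + 10) (n + 23),
   .sub (n + 24) (n + 22) (n + 23), .sub (n + 25) (n + 23) (n + 22), .add (n + 24) (n + 24) (n + 25),
   .const (n + 25) 1, .sub (n + 24) (n + 25) (n + 24), .mul (n + 14) (n + 24) (n + 12)]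

/-- The private memory `w` describes the proof of knowledge for the commitment `R` with first
message `T`. -/
structure Proving (pk : MPK 𝔾) (ID : ZMod 𝔾.p) (R T : ℕ) (w : Mem) : Prop where
  p : w 2 = 𝔾.p
  g : w 3 = 𝔾.encG pk.g
  eqR : w 9 = R
  eqT : w 10 = T
  base : w 11 = 𝔾.encG (idBase pk ID)
  valid : w 12 = testN 𝔾 R * testN 𝔾 T

lemma size_dist {M a b : ℕ} (ha : a.size ≤ M) (hb : b.size ≤ M) :
    (a - b + (b - a)).size ≤ M := by
  rcases le_total a b with h | h
  · rw [Nat.sub_eq_zero_of_le h, zero_add]; exact (size_sub_le _ _).trans hb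
  · rw [Nat.sub_eq_zero_of_le h, add_zero]; exact (size_sub_le _ _).trans ha

/-- Equality of the two sides `a`, `b` of the verification is tested on representations, which are
injective: with truncated subtraction, `1 - ((a - b) + (b - a))` is `1` if `a = b` and `0`
otherwise. The factor from register `12` rejects an `R` or `T` that represents no group element. -/
lemma verify_spec {n M N : ℕ} (hn : 8 ≤ n) (hR : 𝔾.Room M N) {x w : Mem} (hx : Bounded M x)
    (hw : Bounded M w) {pk : MPK 𝔾} {ID : ZMod 𝔾.p} {R T : ℕ} (hP : Proving pk ID R T w)
    {c : ZMod 𝔾.p} (hc : w 13 = c.val) :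
    ∃ w', Det 𝔾 (block (verifyOps n)) (13 * (1 + 2 * M)) (mem n x w) (mem n x w') ∧
      Bounded M w' ∧ (∀ i, i ≠ 14 → (i < 22 ∨ 30 ≤ i) → w' i = w i) ∧ w' 14 ≤ 1 ∧
      (w' 14 ≠ 0 ↔ (checkProof pk ID R T c (x 1) (x 2)).isSome) := by
  obtain ⟨a, ha⟩ : ∃ a, a = mulN 𝔾 (powN 𝔾 (w 3) (w 2 - x 1 % w 2)) (powN 𝔾 (w 11) (x 2)) :=
    ⟨_, rfl⟩
  obtain ⟨b, hb⟩ : ∃ b, b = mulN 𝔾 (w 10) (powN 𝔾 (w 9) (w 13)) := ⟨_, rfl⟩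
  have sa : a.size ≤ M := ha ▸ size_mulN hR.toSizeLE _ _
  have sb : b.size ≤ M := hb ▸ size_mulN hR.toSizeLE _ _
  have h1 : ∀ i < 8, i < n := fun i hi => by omega
  have hv : w 12 ≤ 1 := by
    rw [hP.valid]
    exact Nat.mul_le_mul (testN_le _) (testN_le _)
  have hacc : (1 - (a - b + (b - a))) * w 12 ≤ 1 :=
    Nat.mul_le_mul (Nat.sub_le _ _) hv
  have hf : Fits 𝔾 M (verifyOps n) (mem n x w) := by
    simp only [verifyOps, Fits, Op.target, Op.val, update_mem_add, mem_add,
      mem_of_lt (h1 1 (by norm_num)), mem_of_lt (h1 2 (by norm_num))]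
    simp only [Function.update_apply]
    norm_num
    rw [← ha, ← hb]
    refine ⟨(size_mod_le _ _).trans (hx 1), (size_sub_le _ _).trans (hw 2), size_powN hR.toSizeLE _ _,
      size_powN hR.toSizeLE _ _, sa, size_powN hR.toSizeLE _ _, sb, (size_sub_le _ _).trans sa,
      (size_sub_le _ _).trans sb, size_dist sa sb, hR.one_le,
      size_le_of_le_one hR.one_le (Nat.sub_le _ _), size_le_of_le_one hR.one_le hacc⟩
  have d := block_det _ _ (hx.mem hw) hf
  have hb' := exec_bounded _ _ (hx.mem hw) hf
  have e : exec 𝔾 (verifyOps n) (mem n x w) =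
      mem n x (fun i => exec 𝔾 (verifyOps n) (mem n x w) (n + i)) := by
    -- All targets are private registers, so the embedded memory `x` stays as it is. The other
    -- blocks of this kind are treated likewise.
    simp only [verifyOps, exec, Op.target, Op.val, update_mem_add, mem_add]
  rw [e] at d
  have e14 : exec 𝔾 (verifyOps n) (mem n x w) (n + 14) = (1 - (a - b + (b - a))) * w 12 := by
    simp only [verifyOps, exec, Op.target, Op.val, update_mem_add, mem_add,
      mem_of_lt (h1 1 (by norm_num)), mem_of_lt (h1 2 (by norm_num))]
    simp only [Function.update_apply]
    norm_num
    rw [← ha, ← hb]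
    exact Or.inl rfl
  refine ⟨_, d, fun i => hb' _, fun i hi hi' => ?_, by rw [e14]; exact hacc, ?_⟩
  · have k1 : i ≠ 22 := by omega
    have k2 : i ≠ 23 := by omega
    have k3 : i ≠ 24 := by omega
    have k4 : i ≠ 25 := by omega
    simp [verifyOps, hi, k1, k2, k3, k4]
  · rw [e14, hP.valid]
    unfold checkProof
    rcases hRd : 𝔾.decG R with _ | R'
    · simp [testN, hRd]
    rcases hTd : 𝔾.decG T with _ | T'
    · simp [testN, hTd]
    rw [hP.p, hP.g, hP.base] at ha
    rw [hP.eqR, hP.eqT, hc, ← encG_of_decG hRd, ← encG_of_decG hTd] at hb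
    simp only [powN_encG, mulN_encG] at ha hb
    rw [pow_eq_zpow, pow_eq_zpow, cast_neg_mod] at ha
    rw [pow_eq_zpow, ZMod.natCast_zmod_val] at hb
    have hab : a = b ↔ okamotoAccepts pk ID R' T' c (x 1) (x 2) := by
      rw [ha, hb, 𝔾.encG_injective.eq_iff]
      rfl
    simp only [testN, hRd, hTd, Option.isSome_some, if_true]
    rw [← hab]
    by_cases h : a = b
    · simp [h]
    · simp only [h, if_false, Option.isSome_none]
      simp
      omega

section best

/-- The best lower bound. -/
def best (𝔾 : BilinearGroup) (P : Prog) (b : ℕ) (v : Mem → ℝ≥0∞) (m : Mem) : ℝ≥0∞ :=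
  ⨆ (q : ℝ≥0∞) (_ : Ach 𝔾 P b m v q), q

lemma best_ach (P : Prog) (b : ℕ) (v : Mem → ℝ≥0∞) (m : Mem) :
    Ach 𝔾 P b m v (best 𝔾 P b v m) :=
  fun t g hg => iSup₂_le fun _ hq => hq t g hg

lemma Ach.le_best {P : Prog} {b : ℕ} {m : Mem} {v : Mem → ℝ≥0∞} {q : ℝ≥0∞}
    (h : Ach 𝔾 P b m v q) : q ≤ best 𝔾 P b v m :=
  le_iSup₂ (f := fun q (_ : Ach 𝔾 P b m v q) => q) q h

/-- Taking the best bound for `Q` as the intermediate value removes the need to write down that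
value explicitly and to prove a bound for `Q` from unreachable memories. -/
lemma Ach.seq_best {P Q : Prog} {b c : ℕ} {m : Mem} {v : Mem → ℝ≥0∞} {q : ℝ≥0∞}
    (hP : Ach 𝔾 P b m (best 𝔾 Q c v) q) : Ach 𝔾 (.seq P Q) (b + c) m v q :=
  hP.seq fun m' => best_ach Q c v m'

end best

lemma wp_add {P : Prog} {t : ℕ} {m : Mem} (f g : ℕ → Mem → ℝ≥0∞) :
    (wp 𝔾 P t m fun t' m' => f t' m' + g t' m') = wp 𝔾 P t m f + wp 𝔾 P t m g := by
  unfold wp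
  rw [← ev_add]
  refine ev_congr fun o _ => ?_
  rcases o with _ | s <;> simp

lemma wp_mul_left {P : Prog} {t : ℕ} {m : Mem} (a : ℝ≥0∞) (f : ℕ → Mem → ℝ≥0∞) :
    (wp 𝔾 P t m fun t' m' => a * f t' m') = a * wp 𝔾 P t m f := by
  unfold wp
  rw [← ev_mul_left]
  refine ev_congr fun o _ => ?_
  rcases o with _ | s <;> simp

/-- Sure termination enters here: otherwise the runs out of time would diminish the constant. -/
lemma wp_const {P : Prog} {t : ℕ} {m : Mem} (h : P.run 𝔾 t m none = 0) (a : ℝ≥0∞) :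
    (wp 𝔾 P t m fun _ _ => a) = a := by
  unfold wp
  refine Eq.trans (ev_congr fun o ho => ?_) (ev_const _ a)
  rcases o with _ | s
  · exact absurd h ho
  · rfl

/-- Replace the message to the embedded machine by the challenge in `13`. -/
def challengeOps (n : ℕ) : List Op :=
  [.copy 0 (n + 13), .const 1 0, .const 2 0, .const 3 0, .const 4 0, .const 5 0, .const 6 0,
    .const 7 0]

lemma deliver_singleton (c : ℕ) (x : Mem) : deliver [c] x =
    Function.update (Function.update (Function.update (Function.update (Function.update
      (Function.update (Function.update (Function.update x 0 c) 1 0) 2 0) 3 0) 4 0) 5 0) 6 0) 7 0 := by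
  funext r
  by_cases hr : r < 8
  · interval_cases r <;> simp [deliver]
  · have h : ∀ i < 8, r ≠ i := fun i hi => by omega
    simp [deliver, hr, h]

lemma challenge_spec {n M : ℕ} (hn : 8 ≤ n) {x w : Mem} (hx : Bounded M x) (hw : Bounded M w) :
    Det 𝔾 (block (challengeOps n)) (8 * (1 + 2 * M)) (mem n x w)
      (mem n (deliver [w 13] x) w) := by
  have hf : Fits 𝔾 M (challengeOps n) (mem n x w) := by
    simpa [challengeOps] using hw 13
  have d := block_det _ _ (hx.mem hw) hf
  have h : ∀ i < 8, i < n := fun i hi => by omega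
  have e : exec 𝔾 (challengeOps n) (mem n x w) = mem n (deliver [w 13] x) w := by
    rw [deliver_singleton]
    simp only [challengeOps, exec, Op.target, Op.val, mem_add]
    repeat rw [update_mem_of_lt (h _ (by norm_num))]
  rwa [e] at d

/-- Run the embedded machine on a random challenge and verify its proof. -/
def trial (A : Prog) (n : ℕ) : Prog :=
  .seq (.instr (.rand (n + 13) (n + 2))) <| .seq (block (challengeOps n)) <| .seq A <|
    block (verifyOps n)

lemma Proving.congr {pk : MPK 𝔾} {ID : ZMod 𝔾.p} {R T : ℕ} {w w' : Mem} (h : Proving pk ID R T w)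
    (hw : ∀ i, i < 13 → i ≠ 7 → w' i = w i) : Proving pk ID R T w' where
  p := by rw [hw 2 (by norm_num) (by norm_num), h.p]
  g := by rw [hw 3 (by norm_num) (by norm_num), h.g]
  eqR := by rw [hw 9 (by norm_num) (by norm_num), h.eqR]
  eqT := by rw [hw 10 (by norm_num) (by norm_num), h.eqT]
  base := by rw [hw 11 (by norm_num) (by norm_num), h.base]
  valid := by rw [hw 12 (by norm_num) (by norm_num), h.valid]

/-- The time of a trial. -/
def trialTime (M : ℕ) : ℕ := (1 + M) + (8 * (1 + 2 * M) + (M + 13 * (1 + 2 * M)))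

/-- A trial reproduces the real distribution of challenge and response and records the verdict in
register `14`. It serves both for the first transcript and for the retries. -/
lemma trial_ach {A : Prog} {n M N : ℕ} (hA : A.bound ≤ n) (hn : 8 ≤ n) (hR : 𝔾.Room M N)
    {x w : Mem} (hx : Bounded M x) (hw : Bounded M w) {pk : MPK 𝔾} {ID : ZMod 𝔾.p} {R T : ℕ}
    (hP : Proving pk ID R T w) {t : ℕ} (ht : t ≤ M) {f : ZMod 𝔾.p → ℕ → Mem → ℝ≥0∞}
    {v : Mem → ℝ≥0∞}
    (hfv : ∀ c : ZMod 𝔾.p, ∀ t' ≤ t, ∀ x', Bounded M x' →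
      A.run 𝔾 t (deliver [c.val] x) (some (t', x')) ≠ 0 → ∀ w', Bounded M w' → w' 13 = c.val →
      w' 14 ≤ 1 → (w' 14 ≠ 0 ↔ (checkProof pk ID R T c (x' 1) (x' 2)).isSome) →
      (∀ i, i ≠ 13 → i ≠ 14 → (i < 22 ∨ 30 ≤ i) → w' i = w i) → f c t' x' ≤ v (mem n x' w')) :
    Ach 𝔾 (trial A n) (trialTime M) (mem n x w) v
      (ev (PMF.uniformOfFintype (ZMod 𝔾.p)) fun c => wp 𝔾 A t (deliver [c.val] x) (f c)) := by
  have hpM : 𝔾.p.size ≤ M := hR.of_lt (by omega)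
  have hr := (Ach.rand (𝔾 := 𝔾) (r := n + 13) (a := n + 2) (m := mem n x w) (p := 𝔾.p)
    (by rw [mem_add, hP.p])
    (best 𝔾 (.seq (block (challengeOps n)) <| .seq A <| block (verifyOps n))
      (8 * (1 + 2 * M) + (M + 13 * (1 + 2 * M))) v)).seq_best
  refine hr.mono (by unfold trialTime; omega) (fun _ => le_rfl) (ev_mono fun c _ => ?_)
  refine Ach.le_best ?_
  have hcM : c.val.size ≤ M := (Nat.size_le_size (ZMod.val_lt c).le).trans hpM
  rw [update_mem_add]
  set w1 := Function.update w 13 c.val with hw1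
  have b1 : Bounded M w1 := hw.update _ hcM
  refine (challenge_spec hn hx b1).seq_ach ?_
  have e13 : w1 13 = c.val := by simp [hw1]
  rw [e13]
  have hdx : Bounded M (deliver [c.val] x) := hx.deliver (by simpa using hcM)
  refine Ach.seq_best ((Ach.frame hR.toSizeLE hA ht hdx w1 (f := f c) ?_).mono ht
    (fun _ => le_rfl) le_rfl)
  intro t' ht' x' hx' hrun
  refine Ach.le_best ?_
  have hP1 : Proving pk ID R T w1 := hP.congr fun i hi _ => by
    rw [hw1, Function.update_of_ne (by omega)]
  obtain ⟨w', d', b', k', l', h'⟩ := verify_spec hn hR hx' b1 hP1 e13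
  refine (d'.ach v).mono le_rfl (fun _ => le_rfl) (hfv c t' ht' x' hx' hrun w' b' ?_ l' h' ?_)
  · rw [k' 13 (by norm_num) (by norm_num), e13]
  · intro i h1 h2 h3
    rw [k' i h2 h3, hw1, Function.update_of_ne h1]

/-! ## Extraction of a witness -/

/-- The witness, from the responses in `16`, `17` and in the registers of the embedded machine, and
the difference of the challenges in `22`. -/
def successOps (n : ℕ) : List Op :=
  [.mod (n + 23) 1 (n + 2), .sub (n + 23) (n + 2) (n + 23), .add (n + 23) (n + 23) (n + 16),
   .mod (n + 23) (n + 23) (n + 2), .mul (n + 23) (n + 23) (n + 27), .mod (n + 18) (n + 23) (n + 2),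
   .mod (n + 23) 2 (n + 2), .sub (n + 23) (n + 2) (n + 23), .add (n + 23) (n + 23) (n + 17),
   .mod (n + 23) (n + 23) (n + 2), .mul (n + 23) (n + 23) (n + 27), .mod (n + 19) (n + 23) (n + 2),
   .const (n + 21) 1, .const (n + 20) 0]

/-- Compute the witness. -/
def success (n : ℕ) : Prog := .seq (invert n) (block (successOps n))

/-- The time for the computation of the witness. -/
def successTime (M : ℕ) : ℕ :=
  3 * (1 + 2 * M) + (M * (7 * (1 + 2 * M) + 2) + 1) + 14 * (1 + 2 * M)

lemma success_spec {n M N : ℕ} (hn : 8 ≤ n) (hR : 𝔾.Room M N) {x w : Mem} (hx : Bounded M x)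
    (hw : Bounded M w) (hp : w 2 = 𝔾.p) (h22 : w 22 < 𝔾.p) (h0 : (w 22 : ZMod 𝔾.p) ≠ 0)
    (h16 : w 16 < 𝔾.p) (h17 : w 17 < 𝔾.p) :
    ∃ w', Det 𝔾 (success n) (successTime M) (mem n x w) (mem n x w') ∧ Bounded M w' ∧
      (∀ i, (i < 18 ∨ 30 ≤ i) → w' i = w i) ∧ w' 20 = 0 ∧ w' 21 = 1 ∧ w' 18 < 𝔾.p ∧ w' 19 < 𝔾.p ∧
      (w' 18 : ZMod 𝔾.p) = (w 16 - x 1) * (w 22 : ZMod 𝔾.p)⁻¹ ∧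
      (w' 19 : ZMod 𝔾.p) = (w 17 - x 2) * (w 22 : ZMod 𝔾.p)⁻¹ := by
  obtain ⟨u, d, b, k, l27, e27⟩ := invert_spec (n := n) hR hx hw hp h22 h0
  have h1 : ∀ i < 8, i < n := fun i hi => by omega
  have hp' : u 2 = 𝔾.p := by rw [k 2 (by norm_num), hp]
  have hm := 𝔾.mod_lt
  have e16 : u 16 = w 16 := k 16 (by norm_num)
  have e17 : u 17 = w 17 := k 17 (by norm_num)
  have hf : Fits 𝔾 M (successOps n) (mem n x u) := by
    simp only [successOps, Fits, Op.target, Op.val, update_mem_add, mem_add,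
      mem_of_lt (h1 1 (by norm_num)), mem_of_lt (h1 2 (by norm_num))]
    simp only [Function.update_apply]
    norm_num
    rw [hp', e16, e17]
    have a1 : ∀ a : ℕ, (a % 𝔾.p).size ≤ M := fun a => hR.of_lt (by have := hm a; omega)
    have a3 : ∀ a : ℕ, (𝔾.p - a).size ≤ M := fun a => hR.of_lt (by omega)
    have a4 : ∀ a b : ℕ, b < 𝔾.p → (𝔾.p - a + b).size ≤ M := fun a b hb => hR.of_lt (by omega)
    refine ⟨a1 _, a3 _, a4 _ _ h16, a1 _, hR.mul (hm _).le l27.le, a1 _, a1 _, a3 _, a4 _ _ h17,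
      a1 _, hR.mul (hm _).le l27.le, a1 _, hR.one_le⟩
  have d' := block_det _ _ (hx.mem b) hf
  have b' := exec_bounded _ _ (hx.mem b) hf
  have e : exec 𝔾 (successOps n) (mem n x u) =
      mem n x (fun i => exec 𝔾 (successOps n) (mem n x u) (n + i)) := by
    simp only [successOps, exec, Op.target, Op.val, update_mem_add, mem_add]
  rw [e] at d'
  have e18 : exec 𝔾 (successOps n) (mem n x u) (n + 18) =
      (𝔾.p - x 1 % 𝔾.p + w 16) % 𝔾.p * u 27 % 𝔾.p := by
    simp only [successOps, exec, Op.target, Op.val, update_mem_add, mem_add,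
      mem_of_lt (h1 1 (by norm_num)), mem_of_lt (h1 2 (by norm_num))]
    simp only [Function.update_apply]
    norm_num
    rw [hp', e16]
  have e19 : exec 𝔾 (successOps n) (mem n x u) (n + 19) =
      (𝔾.p - x 2 % 𝔾.p + w 17) % 𝔾.p * u 27 % 𝔾.p := by
    simp only [successOps, exec, Op.target, Op.val, update_mem_add, mem_add,
      mem_of_lt (h1 1 (by norm_num)), mem_of_lt (h1 2 (by norm_num))]
    simp only [Function.update_apply]
    norm_num
    rw [hp', e17]
  refine ⟨_, d.seq d', fun i => b' _, fun i hi => ?_, by simp [successOps], by simp [successOps],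
    ?_, ?_, ?_, ?_⟩
  · have h : ∀ j, 18 ≤ j → j < 30 → i ≠ j := fun j h1 h2 => by omega
    simp [successOps, h, k i (by omega)]
  · rw [e18]; exact hm _
  · rw [e19]; exact hm _
  · rw [e18, ZMod.natCast_mod, Nat.cast_mul, ZMod.natCast_mod, Nat.cast_add, cast_neg_mod, e27]
    ring
  · rw [e19, ZMod.natCast_mod, Nat.cast_mul, ZMod.natCast_mod, Nat.cast_add, cast_neg_mod, e27]
    ring

/-- Reset the embedded machine to the snapshot, and try another challenge. -/
def retryBody (A : Prog) (n : ℕ) : Prog :=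
  .seq (block (copyOps 8 (n + 40) (n - 8))) <|
  .seq (block [.const (n + 22) 1, .sub (n + 20) (n + 20) (n + 22)]) <|
  .seq (trial A n) <|
  .seq (block [.sub (n + 22) (n + 2) (n + 13), .add (n + 22) (n + 22) (n + 15),
    .mod (n + 22) (n + 22) (n + 2), .mul (n + 23) (n + 22) (n + 14)]) <|
  .ite (n + 23) (success n) .skip

/-- The time of an iteration. -/
def retryTime (n M : ℕ) : ℕ :=
  (n - 8) * (1 + 2 * M) + (2 * (1 + 2 * M) + (trialTime M + (4 * (1 + 2 * M) + (successTime M + 1))))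

/-- The private memory outside of the registers that change in the loop. -/
def Agree (w w' : Mem) : Prop := ∀ i, (i < 13 ∨ (15 ≤ i ∧ i < 18) ∨ 30 ≤ i) → w' i = w i

lemma Agree.trans {w w' w'' : Mem} (h : Agree w w') (h' : Agree w' w'') : Agree w w'' :=
  fun i hi => (h' i hi).trans (h i hi)

/-- `t₀, θ` explain the commitment `R`. -/
def IsWitness (pk : MPK 𝔾) (ID : ZMod 𝔾.p) (R : 𝔾.G) (t₀ θ : ℕ) : Prop :=
  R = zpow pk.g (-(t₀ : ZMod 𝔾.p)) * zpow (idBase pk ID) (θ : ZMod 𝔾.p)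

/-- A run of the proof of knowledge with challenge `c` yields a second accepted transcript. -/
def Second (pk : MPK 𝔾) (ID : ZMod 𝔾.p) (R T : ℕ) (c₁ c : ZMod 𝔾.p) (x : Mem) : Prop :=
  (checkProof pk ID R T c (x 1) (x 2)).isSome ∧ c₁ - c ≠ 0

open scoped Classical in
/-- The probability that a trial does not yield a second accepted transcript. -/
def failProb (A : Prog) (pk : MPK 𝔾) (ID : ZMod 𝔾.p) (R T t : ℕ) (x : Mem) (c₁ : ZMod 𝔾.p) :
    ℝ≥0∞ :=
  ev (PMF.uniformOfFintype (ZMod 𝔾.p)) fun c => wp 𝔾 A t (deliver [c.val] x) fun _ x' =>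
    if Second pk ID R T c₁ c x' then 0 else 1

/-- What the loop starts from: the snapshot, and an accepted transcript. -/
structure Retrying (pk : MPK 𝔾) (ID : ZMod 𝔾.p) (R T n : ℕ) (x : Mem) (c₁ z₁ z₂ : ZMod 𝔾.p)
    (w : Mem) : Prop extends Proving pk ID R T w where
  c₁ : w 15 = c₁.val
  z₁ : w 16 = z₁.val
  z₂ : w 17 = z₂.val
  snapshot : ∀ r, 8 ≤ r → r < n → w (32 + r) = x r

lemma Retrying.congr {pk : MPK 𝔾} {ID : ZMod 𝔾.p} {R T n : ℕ} {x : Mem} {c₁ z₁ z₂ : ZMod 𝔾.p}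
    {w w' : Mem} (h : Retrying pk ID R T n x c₁ z₁ z₂ w) (hw : Agree w w') :
    Retrying pk ID R T n x c₁ z₁ z₂ w' where
  toProving := h.toProving.congr fun i hi _ => hw i (Or.inl hi)
  c₁ := by rw [hw 15 (by norm_num), h.c₁]
  z₁ := by rw [hw 16 (by norm_num), h.z₁]
  z₂ := by rw [hw 17 (by norm_num), h.z₂]
  snapshot r h1 h2 := by rw [hw _ (by omega), h.snapshot r h1 h2]

/-- Restoring a snapshot. -/
lemma restore_spec {n M src : ℕ} (hsrc : 8 ≤ src) {x₀ x w : Mem} (hx : Bounded M x)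
    (hw : Bounded M w) (h : ∀ r, 8 ≤ r → r < n → w (src - 8 + r) = x₀ r) :
    Det 𝔾 (block (copyOps 8 (n + src) (n - 8))) ((n - 8) * (1 + 2 * M)) (mem n x w)
      (mem n (fun r => if r < 8 then x r else x₀ r) w) := by
  have d := block_det _ _ (hx.mem (n := n) hw)
    (fits_copyOps (𝔾 := 𝔾) (dst := 8) (src := n + src) (n - 8) (hx.mem (n := n) hw))
  rw [exec_copyOps _ (by omega), length_copyOps] at d
  convert d using 1
  funext r
  by_cases hr : r < 8
  · by_cases hrn : r < n
    · rw [mem_of_lt hrn, if_pos hr, if_neg (by omega), mem_of_lt hrn]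
    · rw [if_neg (by omega)]
      simp [mem, hrn]
  · by_cases hrn : r < n
    · rw [mem_of_lt hrn, if_neg hr, if_pos (by omega),
        show n + src + (r - 8) = n + (src - 8 + r) by omega, mem_add, h r (by omega) hrn]
    · rw [if_neg (by omega)]
      simp [mem, hrn]

/-- With `y` the value after a successful extraction and `y - l` after a failure, `k` independent
retries from the same snapshot lose `l` times the `k`-th power of the failure probability of one
retry. Success sets the counter to `0`, which ends the loop. -/
lemma retry_ach {A : Prog} {n M N : ℕ} (hA : A.bound ≤ n) (hn : 8 ≤ n) (hR : 𝔾.Room M N)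
    {pk : MPK 𝔾} {ID : ZMod 𝔾.p} {R T : ℕ} {R' : 𝔾.G} {t : ℕ} (ht : t ≤ M)
    {x₀ : Mem} (hx₀ : Bounded M x₀) (hterm : ∀ c : ZMod 𝔾.p, A.run 𝔾 t (deliver [c.val] x₀) none = 0)
    {c₁ : ZMod 𝔾.p} {z₁ z₂ : ℕ} (hacc : checkProof pk ID R T c₁ z₁ z₂ = some R')
    {w₀ : Mem} (h₀ : Retrying pk ID R T n x₀ c₁ z₁ z₂ w₀) {v : Mem → ℝ≥0∞} {y : ℝ≥0∞} {l : ℝ≥0∞}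
    (hfound : ∀ x' w', Bounded M x' → Bounded M w' → Agree w₀ w' → w' 21 = 1 → w' 18 < 𝔾.p →
      w' 19 < 𝔾.p → IsWitness pk ID R' (w' 18) (w' 19) → y ≤ v (mem n x' w'))
    (hlost : ∀ x' w', Bounded M x' → Bounded M w' → Agree w₀ w' → w' 21 = 0 →
      y - l ≤ v (mem n x' w')) :
    ∀ (k : ℕ) (x w : Mem), Bounded M x → Bounded M w → Agree w₀ w → w 20 = k → w 21 = 0 →
      Ach 𝔾 (.while (n + 20) (retryBody A n)) (k * (retryTime n M + 2) + 1) (mem n x w) v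
        (y - l * failProb A pk ID R T t x₀ c₁ ^ k) := by
  classical
  intro k
  induction k with
  | zero =>
    intro x w hx hw hag h20 h21
    refine ((Det.while_done (by simpa using h20)).ach v).mono (by omega) (fun _ => le_rfl) ?_
    simpa using hlost x w hx hw hag h21
  | succ k ih =>
    intro x w hx hw hag h20 h21
    have hM := hR.one_le
    have hm := 𝔾.mod_lt
    set φ := failProb A pk ID R T t x₀ c₁ with hφ
    suffices hbody : Ach 𝔾 (retryBody A n) (retryTime n M) (mem n x w)
        (best 𝔾 (.while (n + 20) (retryBody A n)) (k * (retryTime n M + 2) + 1) v)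
        (y - l * φ ^ (k + 1)) by
      refine (Ach.while_step (by simp [h20]) hbody fun m' => best_ach _ _ v m').mono ?_
        (fun _ => le_rfl) le_rfl
      exact le_of_eq (by ring) |>.trans (by omega : (k+1) * (retryTime n M + 2) ≤ _)
    have hret : Retrying pk ID R T n x₀ c₁ z₁ z₂ w := h₀.congr hag
    set x₁ : Mem := fun r => if r < 8 then x r else x₀ r with hx₁
    have bx₁ : Bounded M x₁ := fun r => by
      simp only [hx₁]; split_ifs
      exacts [hx r, hx₀ r]
    -- Snapshots omit the eight communication registers, since every message overwrites them.
    have hdel : ∀ c : ZMod 𝔾.p, deliver [c.val] x₁ = deliver [c.val] x₀ := fun c => by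
      funext r; by_cases hr : r < 8 <;> simp [deliver, hx₁, hr]
    refine (restore_spec (by norm_num) hx hw hret.snapshot).seq_ach ?_
    have hf1 : Fits 𝔾 M [.const (n + 22) 1, .sub (n + 20) (n + 20) (n + 22)] (mem n x₁ w) := by
      simp [hM]
      exact (size_sub_le _ _).trans (hw 20)
    have d1 := block_det _ _ (bx₁.mem hw) hf1
    have b1 := exec_bounded _ _ (bx₁.mem hw) hf1
    simp only [exec, Op.target, Op.val, update_mem_add, mem_add] at d1 b1
    set w1 := Function.update w 22 1 with hw1
    set w2 := Function.update w1 20 (w1 20 - w1 22) with hw2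
    have bw2 : Bounded M w2 := fun i => by simpa using b1 (n + i)
    have e2 : w2 20 = k := by simp [hw2, hw1, h20]
    have ag2 : Agree w w2 := fun i hi => by
      have h1 : i ≠ 20 := by omega
      have h2 : i ≠ 22 := by omega
      simp [hw2, hw1, h1, h2]
    refine d1.seq_ach ?_
    have hret2 := hret.congr ag2
    refine Ach.seq_best ?_
    refine (trial_ach hA hn hR bx₁ bw2 hret2.toProving ht (f := fun c _ x' =>
      if Second pk ID R T c₁ c x' then y else y - l * φ ^ k) ?_).mono le_rfl (fun _ => le_rfl) ?_
    · intro c t' ht' x' hx' hrun w3 bw3 e13 l14 i14 k3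
      refine Ach.le_best ?_
      have ag3 : Agree w2 w3 := fun i hi => k3 i (by omega) (by omega) (by omega)
      have ag03 := hag.trans (ag2.trans ag3)
      have hret3 := hret2.congr ag3
      have hcp := ZMod.val_lt c
      have hc₁p := ZMod.val_lt c₁
      have hf4 : Fits 𝔾 M [.sub (n + 22) (n + 2) (n + 13), .add (n + 22) (n + 22) (n + 15),
          .mod (n + 22) (n + 22) (n + 2), .mul (n + 23) (n + 22) (n + 14)] (mem n x' w3) := by
        simp [hret3.p, hret3.c₁, e13]
        have := hm (𝔾.p - c.val + c₁.val)
        exact ⟨hR.of_lt (by omega), hR.of_lt (by omega), hR.of_lt (by omega),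
          hR.mul (by omega) (l14.trans 𝔾.prime_p.one_lt.le)⟩
      have d4 := block_det _ _ (hx'.mem bw3) hf4
      have b4 := exec_bounded _ _ (hx'.mem bw3) hf4
      simp only [exec, Op.target, Op.val, update_mem_add, mem_add] at d4 b4
      refine d4.seq_ach ?_
      clear d4
      generalize hu : Function.update _ 23 _ = u at b4 ⊢
      have bu : Bounded M u := fun i => by simpa using b4 (n + i)
      have ag4 : Agree w3 u := fun i hi => by
        have h1 : i ≠ 22 := by omega
        have h2 : i ≠ 23 := by omega
        simp [← hu, h1, h2]
      have e22 : u 22 = (𝔾.p - c.val + c₁.val) % 𝔾.p := by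
        simp [← hu, hret3.p, hret3.c₁, e13]
      have e22' : (u 22 : ZMod 𝔾.p) = c₁ - c := by
        rw [e22, ZMod.natCast_mod, Nat.cast_add, Nat.cast_sub hcp.le]
        simp
        ring
      have e23 : u 23 = u 22 * w3 14 := by simp [← hu]
      have e20 : u 20 = k := by
        rw [show u 20 = w3 20 by simp [← hu], k3 20 (by norm_num) (by norm_num) (by norm_num), e2]
      have e21 : u 21 = 0 := by
        rw [show u 21 = w3 21 by simp [← hu], k3 21 (by norm_num) (by norm_num) (by norm_num)]
        simp [hw2, hw1, h21]
      -- Register `23` is the product of the challenge difference, reduced modulo `p`, with the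
      -- acceptance bit.
      have hsec : u 23 ≠ 0 ↔ Second pk ID R T c₁ c x' := by
        rw [e23, Second, ← i14, ← e22', mul_ne_zero_iff, and_comm]
        refine and_congr_right fun _ => ?_
        rw [not_iff_not, ZMod.natCast_eq_zero_iff]
        refine ⟨fun h => by simp [h], fun h => Nat.eq_zero_of_dvd_of_lt h ?_⟩
        rw [e22]; exact hm _
      split_ifs with hs
      · obtain ⟨R'', hR''⟩ := Option.isSome_iff_exists.1 hs.1
        have hret4 := hret3.congr ag4
        obtain ⟨w5, d5, b5, k5, e5, f5, l18, l19, e18, e19⟩ := success_spec hn hR hx' bu hret4.p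
          (by rw [e22]; exact hm _) (by rw [e22']; exact hs.2)
          (by rw [hret4.z₁]; exact ZMod.val_lt _) (by rw [hret4.z₂]; exact ZMod.val_lt _)
        refine (((d5.ite_pos (by simpa using hsec.2 hs)).ach _).mono le_rfl (fun _ => le_rfl) ?_)
        refine Ach.le_best (((Det.while_done (by simpa using e5)).ach v).mono (by omega)
          (fun _ => le_rfl) ?_)
        refine hfound x' w5 hx' b5 (ag03.trans (ag4.trans fun i hi => k5 i (by omega))) f5 l18 l19 ?_
        rw [hret4.z₁, ZMod.natCast_zmod_val, e22'] at e18
        rw [hret4.z₂, ZMod.natCast_zmod_val, e22'] at e19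
        rw [IsWitness, e18, e19]
        unfold checkProof at hacc hR''
        rcases hRd : 𝔾.decG R with _ | Ra
        · simp [hRd] at hacc
        rcases hTd : 𝔾.decG T with _ | Ta
        · simp [hRd, hTd] at hacc
        rw [hRd, hTd] at hacc hR''
        simp only at hacc hR''
        split_ifs at hacc hR'' with o1 o2
        rw [Option.some.injEq] at hacc
        subst hacc
        exact extract hs.2 o1 o2
      · refine ((((Det.skip _).ite_neg (by
          by_contra h
          exact hs (hsec.1 (by simpa using h)))).ach _).mono (by omega) (fun _ => le_rfl) ?_)
        exact Ach.le_best (ih x' u hx' bu (ag03.trans ag4) e20 e21)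
    · simp only [hdel]
      rw [tsub_le_iff_right]
      -- One retry succeeds with value `y`, or fails with value at least `y - l φ ^ k`; the deficit
      -- `l φ ^ k` is thus weighted with the probability `φ` of failure.
      calc y = ev (PMF.uniformOfFintype (ZMod 𝔾.p)) fun c =>
            wp 𝔾 A t (deliver [c.val] x₀) fun _ _ => y := by
            simp only [fun c : ZMod 𝔾.p => wp_const (hterm c) y, ev_const]
        _ ≤ ev (PMF.uniformOfFintype (ZMod 𝔾.p)) fun c =>
            wp 𝔾 A t (deliver [c.val] x₀) fun _ x' =>
              (if Second pk ID R T c₁ c x' then y else y - l * φ ^ k) +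
                l * φ ^ k * (if Second pk ID R T c₁ c x' then 0 else 1) := by
            refine ev_mono fun c _ => wp_mono fun _ x' _ => ?_
            split_ifs
            · simp
            · rw [mul_one]; exact le_tsub_add
        _ = _ := by
            simp only [wp_add, ev_add, wp_mul_left, ev_mul_left]
            rw [← failProb, ← hφ, pow_succ, mul_assoc]

/-! ## The probability that extraction fails -/

/-- Each of the `N + 1` terms of the geometric sum is at least `ψ ^ N`, and `1 - ψ` times this sum
is `1 - ψ ^ (N + 1)`. -/
lemma succ_mul_pow_le {ψ : ℝ} (h0 : 0 ≤ ψ) (h1 : ψ ≤ 1) (N : ℕ) :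
    (N + 1) * ((1 - ψ) * ψ ^ N) ≤ 1 := by
  have h2 : ((N : ℝ) + 1) * ψ ^ N ≤ ∑ i ∈ Finset.range (N + 1), ψ ^ i := by
    have := Finset.card_nsmul_le_sum (Finset.range (N + 1)) (fun i => ψ ^ i) (ψ ^ N) fun i hi =>
      pow_le_pow_of_le_one h0 h1 (by simpa [Nat.lt_succ_iff] using hi)
    simpa using this
  have h3 := mul_neg_geom_sum ψ (N + 1)
  have h4 := mul_le_mul_of_nonneg_left h2 (sub_nonneg.2 h1)
  have h5 : 0 ≤ ψ ^ (N + 1) := pow_nonneg h0 _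
  calc _ = (1 - ψ) * (((N : ℝ) + 1) * ψ ^ N) := by ring
    _ ≤ 1 - ψ ^ (N + 1) := by rw [← h3]; exact h4
    _ ≤ 1 := by linarith

/-- Here `a` is the probability of acceptance and `ψ` bounds the failure of a retry, so `a ≤ (1 - ψ)
+ q`. The first part is damped by `ψ ^ N` to `1/(N+1)`, and the second is at most `q`. -/
lemma mul_pow_le_of_add_eq_one {a b q ψ : ℝ≥0∞} (hab : a + b = 1) (h1 : ψ ≤ 1) (h2 : ψ ≤ b + q)
    (N : ℕ) : a * ψ ^ N ≤ ((N : ℝ≥0∞) + 1)⁻¹ + q := by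
  have hψ : ψ ≠ ∞ := ne_top_of_le_ne_top ENNReal.one_ne_top h1
  have hb : b ≠ ∞ := ne_top_of_le_ne_top ENNReal.one_ne_top (hab ▸ le_add_self)
  have h3 : a ≤ (1 - ψ) + q := by
    refine (ENNReal.add_le_add_iff_right hb).1 ?_
    calc a + b = 1 - ψ + ψ := by rw [hab, tsub_add_cancel_of_le h1]
      _ ≤ 1 - ψ + (b + q) := by gcongr
      _ = _ := by ring
  have h4 : (1 - ψ) * ψ ^ N ≤ ((N : ℝ≥0∞) + 1)⁻¹ := by
    rw [ENNReal.le_inv_iff_mul_le]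
    lift ψ to NNReal using hψ
    have h1' : ψ ≤ 1 := by exact_mod_cast h1
    have := succ_mul_pow_le ψ.2 (by exact_mod_cast h1') N
    have h5 : ((N : NNReal) + 1) * ((1 - ψ) * ψ ^ N) ≤ 1 := by
      rw [← NNReal.coe_le_coe]
      push_cast [NNReal.coe_sub h1']
      exact this
    rw [mul_comm]
    exact_mod_cast h5
  calc a * ψ ^ N ≤ (1 - ψ + q) * ψ ^ N := by gcongr
    _ = (1 - ψ) * ψ ^ N + q * ψ ^ N := by ring
    _ ≤ _ := add_le_add h4 (mul_le_of_le_one_right' (pow_le_one' h1 N))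

/-- A retry fails only by rejection, or by repeating the first challenge, which has probability
`1/p`. This bound does not depend on the first challenge, so it can be pulled out of the
expectation, leaving the probability of acceptance as a factor. -/
lemma extraction_loss {A : Prog} {pk : MPK 𝔾} {ID : ZMod 𝔾.p} {R T t : ℕ} {x : Mem}
    (hterm : ∀ c : ZMod 𝔾.p, A.run 𝔾 t (deliver [c.val] x) none = 0) (N : ℕ) :
    (ev (PMF.uniformOfFintype (ZMod 𝔾.p)) fun c => wp 𝔾 A t (deliver [c.val] x) fun _ x' =>
      if (checkProof pk ID R T c (x' 1) (x' 2)).isSome then failProb A pk ID R T t x c ^ N else 0) ≤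
    ((N : ℝ≥0∞) + 1)⁻¹ + (𝔾.p : ℝ≥0∞)⁻¹ := by
  classical
  set U := PMF.uniformOfFintype (ZMod 𝔾.p) with hU
  set a := ev U fun c => wp 𝔾 A t (deliver [c.val] x) fun _ x' =>
    if (checkProof pk ID R T c (x' 1) (x' 2)).isSome then 1 else 0 with ha
  set b := ev U fun c => wp 𝔾 A t (deliver [c.val] x) fun _ x' =>
    if (checkProof pk ID R T c (x' 1) (x' 2)).isSome then 0 else 1 with hb
  have hab : a + b = 1 := by
    rw [ha, hb, ← ev_add, ← ev_const U 1]
    refine ev_congr fun c _ => ?_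
    refine ((wp_add _ _).symm.trans ?_).trans (wp_const (hterm c) 1)
    congr 1
    funext _ x'
    split_ifs <;> simp
  have hφ1 : ∀ c, failProb A pk ID R T t x c ≤ 1 := fun c₁ => by
    refine ev_le fun c _ => ?_
    refine (wp_mono (g := fun _ _ => 1) fun _ x' _ => ?_).trans (wp_const (hterm c) 1).le
    split_ifs <;> simp
  have hφ2 : ∀ c, failProb A pk ID R T t x c ≤ b + (𝔾.p : ℝ≥0∞)⁻¹ := fun c₁ => by
    have hone : (ev U fun c => if c = c₁ then 1 else 0) = (𝔾.p : ℝ≥0∞)⁻¹ := by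
      rw [ev_indicator, hU, PMF.uniformOfFintype_apply, ZMod.card]
    rw [← hone, hb, ← ev_add]
    refine ev_mono fun c _ => ?_
    rw [← wp_const (hterm c) (if c = c₁ then 1 else 0), ← wp_add]
    refine wp_mono fun _ x' _ => ?_
    unfold Second
    by_cases h1 : (checkProof pk ID R T c (x' 1) (x' 2)).isSome
    · by_cases h2 : c = c₁
      · simp [h2]
      · have : c₁ - c ≠ 0 := sub_ne_zero.2 (Ne.symm h2)
        simp [h1, this]
    · simp [h1]
  calc _ ≤ ev U fun c => wp 𝔾 A t (deliver [c.val] x) fun _ x' =>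
        min 1 (b + (𝔾.p : ℝ≥0∞)⁻¹) ^ N *
          (if (checkProof pk ID R T c (x' 1) (x' 2)).isSome then 1 else 0) := by
        refine ev_mono fun c _ => wp_mono fun _ x' _ => ?_
        split_ifs
        · rw [mul_one]
          exact pow_le_pow_left' (le_min (hφ1 c) (hφ2 c)) N
        · simp
    _ = a * min 1 (b + (𝔾.p : ℝ≥0∞)⁻¹) ^ N := by
        simp only [wp_mul_left, ev_mul_left]
        rw [mul_comm]
    _ ≤ _ := mul_pow_le_of_add_eq_one hab (min_le_left _ _) (min_le_right _ _) N

/-! ## Key generation requests -/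

/-- The private memory between two activations. -/
structure Stored (pk : MPK 𝔾) (M N code : ℕ) (w : Mem) : Prop where
  bdd : Bounded M w
  init : w 1 = 1
  p : w 2 = 𝔾.p
  g : w 3 = 𝔾.encG pk.g
  g₁ : w 4 = 𝔾.encG pk.g₁
  N : w 5 = N
  code : w 6 = code

lemma Stored.congr {pk : MPK 𝔾} {M N code : ℕ} {w w' : Mem} (h : Stored pk M N code w)
    (hb : Bounded M w') (hw : ∀ i < 7, w' i = w i) : Stored pk M N code w' where
  bdd := hb
  init := by rw [hw 1 (by norm_num), h.init]
  p := by rw [hw 2 (by norm_num), h.p]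
  g := by rw [hw 3 (by norm_num), h.g]
  g₁ := by rw [hw 4 (by norm_num), h.g₁]
  N := by rw [hw 5 (by norm_num), h.N]
  code := by rw [hw 6 (by norm_num), h.code]

/-- Saving a snapshot. -/
lemma save_spec {n M dst : ℕ} {x w : Mem} (hx : Bounded M x) (hw : Bounded M w) :
    Det 𝔾 (block (copyOps (n + dst) 8 (n - 8))) ((n - 8) * (1 + 2 * M)) (mem n x w)
      (mem n x fun i => if dst ≤ i ∧ i < dst + (n - 8) then x (8 + (i - dst)) else w i) := by
  have d := block_det _ _ (hx.mem (n := n) hw)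
    (fits_copyOps (𝔾 := 𝔾) (dst := n + dst) (src := 8) (n - 8) (hx.mem (n := n) hw))
  rw [exec_copyOps _ (by omega), length_copyOps] at d
  convert d using 1
  funext r
  by_cases hr : r < n
  · rw [mem_of_lt hr, if_neg (by omega), mem_of_lt hr]
  · obtain ⟨i, rfl⟩ := Nat.exists_eq_add_of_le (not_lt.1 hr)
    rw [mem_add]
    by_cases hi : dst ≤ i ∧ i < dst + (n - 8)
    · rw [if_pos hi, if_pos (by omega), mem_of_lt (by omega)]
      congr 1
      omega
    · rw [if_neg hi, if_neg (by omega), mem_add]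

/-- Save the request, and prepare the verification. -/
def requestOps (n : ℕ) : List Op :=
  [.copy (n + 8) 1, .copy (n + 9) 2, .copy (n + 10) 3, .mod (n + 22) 1 (n + 2),
   .sub (n + 22) (n + 2) (n + 22), .powG (n + 22) (n + 3) (n + 22),
   .mulG (n + 11) (n + 4) (n + 22), .testG (n + 22) (n + 9), .testG (n + 23) (n + 10),
   .mul (n + 12) (n + 22) (n + 23)]

lemma request_spec {n M N code : ℕ} (hn : 8 ≤ n) (hR : 𝔾.Room M N) {x w : Mem} (hx : Bounded M x)
    {pk : MPK 𝔾} (hw : Stored pk M N code w) :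
    ∃ w', Det 𝔾 (block (requestOps n)) (10 * (1 + 2 * M)) (mem n x w) (mem n x w') ∧
      Bounded M w' ∧ (∀ i, i < 8 → w' i = w i) ∧ w' 8 = x 1 ∧
      Proving pk (x 1) (x 2) (x 3) w' := by
  have h1 : ∀ i < 8, i < n := fun i hi => by omega
  have hT : testN 𝔾 (x 2) * testN 𝔾 (x 3) ≤ 1 := Nat.mul_le_mul (testN_le _) (testN_le _)
  have hf : Fits 𝔾 M (requestOps n) (mem n x w) := by
    simp only [requestOps, Fits, Op.target, Op.val, update_mem_add, mem_add,
      mem_of_lt (h1 1 (by norm_num)), mem_of_lt (h1 2 (by norm_num)),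
      mem_of_lt (h1 3 (by norm_num))]
    simp only [Function.update_apply]
    norm_num
    refine ⟨hx 1, hx 2, hx 3, (size_mod_le _ _).trans (hx 1), (size_sub_le _ _).trans (hw.bdd 2),
      size_powN hR.toSizeLE _ _, size_mulN hR.toSizeLE _ _,
      size_le_of_le_one hR.one_le (testN_le _), size_le_of_le_one hR.one_le (testN_le _),
      size_le_of_le_one hR.one_le hT⟩
  have d := block_det _ _ (hx.mem hw.bdd) hf
  have b := exec_bounded _ _ (hx.mem hw.bdd) hf
  have e : exec 𝔾 (requestOps n) (mem n x w) =
      mem n x (fun i => exec 𝔾 (requestOps n) (mem n x w) (n + i)) := by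
    simp only [requestOps, exec, Op.target, Op.val, update_mem_add, mem_add]
  rw [e] at d
  refine ⟨_, d, fun i => b _, fun i hi => ?_, ?_, ?_, ?_, ?_, ?_, ?_, ?_⟩
  · have h : ∀ j, 8 ≤ j → i ≠ j := fun j h1 => by omega
    simp [requestOps, h]
  · simp [requestOps, mem_of_lt (h1 1 (by norm_num))]
  · simp [requestOps, hw.p]
  · simp [requestOps, hw.g]
  · simp [requestOps, mem_of_lt (h1 2 (by norm_num))]
  · simp [requestOps, mem_of_lt (h1 3 (by norm_num))]
  · simp only [requestOps, exec, Op.target, Op.val, update_mem_add, mem_add,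
      mem_of_lt (h1 1 (by norm_num))]
    simp only [Function.update_apply]
    norm_num
    rw [hw.p, hw.g, hw.g₁, powN_encG, mulN_encG, pow_eq_zpow, cast_neg_mod]
    rfl
  · simp [requestOps, mem_of_lt (h1 2 (by norm_num)), mem_of_lt (h1 3 (by norm_num))]

/-- Save the first transcript, and prepare the loop. -/
def transcriptOps (n : ℕ) : List Op :=
  [.copy (n + 15) (n + 13), .mod (n + 16) 1 (n + 2), .mod (n + 17) 2 (n + 2),
   .copy (n + 20) (n + 5), .const (n + 21) 0, .const (n + 7) 1]

lemma transcript_spec {n M N : ℕ} (hn : 8 ≤ n) (hR : 𝔾.Room M N) {x w : Mem} (hx : Bounded M x)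
    (hw : Bounded M w) (hp : w 2 = 𝔾.p) :
    ∃ w', Det 𝔾 (block (transcriptOps n)) (6 * (1 + 2 * M)) (mem n x w) (mem n x w') ∧
      Bounded M w' ∧
      (∀ i, (i < 7 ∨ (8 ≤ i ∧ i < 15) ∨ 22 ≤ i) → w' i = w i) ∧ w' 7 = 1 ∧ w' 15 = w 13 ∧
      w' 16 = (x 1 : ZMod 𝔾.p).val ∧ w' 17 = (x 2 : ZMod 𝔾.p).val ∧ w' 20 = w 5 ∧ w' 21 = 0 := by
  have h1 : ∀ i < 8, i < n := fun i hi => by omega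
  have hf : Fits 𝔾 M (transcriptOps n) (mem n x w) := by
    simp only [transcriptOps, Fits, Op.target, Op.val, update_mem_add, mem_add,
      mem_of_lt (h1 1 (by norm_num)), mem_of_lt (h1 2 (by norm_num))]
    simp only [Function.update_apply]
    norm_num
    exact ⟨hw 13, (size_mod_le _ _).trans (hx 1), (size_mod_le _ _).trans (hx 2), hw 5, hR.one_le⟩
  have d := block_det _ _ (hx.mem hw) hf
  have b := exec_bounded _ _ (hx.mem hw) hf
  have e : exec 𝔾 (transcriptOps n) (mem n x w) =
      mem n x (fun i => exec 𝔾 (transcriptOps n) (mem n x w) (n + i)) := by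
    simp only [transcriptOps, exec, Op.target, Op.val, update_mem_add, mem_add]
  rw [e] at d
  refine ⟨_, d, fun i => b _, fun i hi => ?_, ?_, ?_, ?_, ?_, ?_, ?_⟩
  · have h7 : i ≠ 7 := by omega
    have h : ∀ j, 15 ≤ j → j < 22 → i ≠ j := fun j h1 h2 => by omega
    simp [transcriptOps, h, h7]
  · simp [transcriptOps]
  · simp [transcriptOps]
  · simp [transcriptOps, mem_of_lt (h1 1 (by norm_num)), hp, ZMod.val_natCast]
  · simp [transcriptOps, mem_of_lt (h1 2 (by norm_num)), hp, ZMod.val_natCast]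
  · simp [transcriptOps]
  · simp [transcriptOps]

/-- Forward the request. -/
def forward (n : ℕ) : Prog := block [.const 0 0, .copy 1 (n + 8)]

/-- End the game by a message of the wrong format. -/
def abort : Prog := block [.const 0 3]

lemma forward_spec {n M : ℕ} (hn : 8 ≤ n) {x w : Mem} (hx : Bounded M x) (hw : Bounded M w) :
    Det 𝔾 (forward n) (2 * (1 + 2 * M)) (mem n x w)
      (mem n (Function.update (Function.update x 0 0) 1 (w 8)) w) := by
  have hf : Fits 𝔾 M [.const 0 0, .copy 1 (n + 8)] (mem n x w) := by
    have : n + 8 ≠ 0 := by omega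
    simpa [Function.update_of_ne this] using hw 8
  have d := block_det _ _ (hx.mem hw) hf
  simp only [exec, Op.target, Op.val, update_mem_of_lt (show 0 < n by omega),
    update_mem_of_lt (show 1 < n by omega), mem_add] at d
  exact d

lemma abort_spec {n M N : ℕ} (hn : 8 ≤ n) (hR : 𝔾.Room M N) {x w : Mem} (hx : Bounded M x)
    (hw : Bounded M w) :
    Det 𝔾 abort (1 * (1 + 2 * M)) (mem n x w) (mem n (Function.update x 0 3) w) := by
  have h3 : Nat.size 3 ≤ M := by
    have h1 : Nat.size 3 = 2 := by decide
    have := hR.size_p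
    omega
  have d := block_det (𝔾 := 𝔾) [.const 0 3] _ (hx.mem (n := n) hw) (by simpa using h3)
  simp only [exec, Op.target, Op.val, update_mem_of_lt (show 0 < n by omega)] at d
  exact d

/-- Run the proof of knowledge, extract a witness, and forward the request. -/
def keygenProg (A : Prog) (n : ℕ) : Prog :=
  .seq (block (requestOps n)) <|
  .seq (block (copyOps (n + 40) 8 (n - 8))) <|
  .seq (trial A n) <|
  .seq (block (transcriptOps n)) <|
  .ite (n + 14)
    (.seq (block (copyOps (n + (40 + n)) 8 (n - 8))) <|
     .seq (.while (n + 20) (retryBody A n)) <|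
     .seq (block (copyOps 8 (n + (40 + n)) (n - 8))) <|
     .ite (n + 21) (forward n) abort)
    (forward n)

/-- The time for a key generation request. -/
def keygenTime (n M N : ℕ) : ℕ :=
  10 * (1 + 2 * M) + ((n - 8) * (1 + 2 * M) + (trialTime M + (6 * (1 + 2 * M) +
    ((n - 8) * (1 + 2 * M) + ((N * (retryTime n M + 2) + 1) + ((n - 8) * (1 + 2 * M) +
      (2 * (1 + 2 * M) + 1))) + 1))))

/-- `F` is the value of the accountable game after the proof of knowledge. The first trial has the
true distribution, and the state of `A` after it is restored at the end, so the only loss is the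
weight `l` of an abort times the probability that an accepted proof yields no witness. A rejected
proof needs no witness and costs nothing. -/
lemma keygen_ach {A : Prog} {n M N code : ℕ} (hA : A.bound ≤ n) (hn : 8 ≤ n) (hR : 𝔾.Room M N)
    {pk : MPK 𝔾} {t : ℕ} (ht : t ≤ M) {x w : Mem} (hx : Bounded M x) (hw : Stored pk M N code w)
    (hterm : ∀ c : ZMod 𝔾.p, A.run 𝔾 t (deliver [c.val] x) none = 0)
    {v : Mem → ℝ≥0∞} {l : ℝ≥0∞} {F : Option 𝔾.G → ℕ → Mem → ℝ≥0∞}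
    (hok : ∀ c : ZMod 𝔾.p, ∀ t' ≤ t, ∀ x', Bounded M x' →
      A.run 𝔾 t (deliver [c.val] x) (some (t', x')) ≠ 0 →
      ∀ x'' w', Bounded M x'' → x'' 0 = 0 → x'' 1 = x 1 →
      (∀ r, 8 ≤ r → r < n → x'' r = x' r) → Stored pk M N code w' → w' 7 = 1 →
      (checkProof pk (x 1) (x 2) (x 3) c (x' 1) (x' 2) = none → w' 21 = 0) →
      (∀ R', checkProof pk (x 1) (x 2) (x 3) c (x' 1) (x' 2) = some R' → w' 21 = 1 ∧
        w' 18 < 𝔾.p ∧ w' 19 < 𝔾.p ∧ IsWitness pk (x 1) R' (w' 18) (w' 19)) →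
      F (checkProof pk (x 1) (x 2) (x 3) c (x' 1) (x' 2)) t' x' ≤ v (mem n x'' w'))
    (habort : ∀ x'' w', Bounded M x'' → Bounded M w' → x'' 0 = 3 → ∀ o t' x',
      F o t' x' - l ≤ v (mem n x'' w')) :
    Ach 𝔾 (keygenProg A n) (keygenTime n M N) (mem n x w) v
      ((ev (PMF.uniformOfFintype (ZMod 𝔾.p)) fun c => wp 𝔾 A t (deliver [c.val] x) fun t' x' =>
        F (checkProof pk (x 1) (x 2) (x 3) c (x' 1) (x' 2)) t' x') -
          l * (((N : ℝ≥0∞) + 1)⁻¹ + (𝔾.p : ℝ≥0∞)⁻¹)) := by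
  obtain ⟨w1, d1, b1, k1, e8, P1⟩ := request_spec hn hR hx hw
  refine d1.seq_ach ?_
  have d2 := save_spec (𝔾 := 𝔾) (n := n) (dst := 40) hx b1
  set w2 : Mem := fun i => if 40 ≤ i ∧ i < 40 + (n - 8) then x (8 + (i - 40)) else w1 i with hw2
  have b2 : Bounded M w2 := fun i => by
    simp only [hw2]; split_ifs
    exacts [hx _, b1 _]
  have k2 : ∀ i < 40, w2 i = w1 i := fun i hi => if_neg (by omega)
  have s2 : ∀ r, 8 ≤ r → r < n → w2 (32 + r) = x r := fun r h1 h2 => by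
    simp only [hw2]
    rw [if_pos (by omega)]
    congr 1
    omega
  have P2 : Proving pk (x 1) (x 2) (x 3) w2 := P1.congr fun i hi _ => k2 i (by omega)
  refine d2.seq_ach (Ach.seq_best ?_)
  refine (trial_ach hA hn hR hx b2 P2 ht (f := fun c t' x' =>
    F (checkProof pk (x 1) (x 2) (x 3) c (x' 1) (x' 2)) t' x' - l *
      if (checkProof pk (x 1) (x 2) (x 3) c (x' 1) (x' 2)).isSome then
        failProb A pk (x 1) (x 2) (x 3) t x c ^ N else 0) ?_).mono le_rfl (fun _ => le_rfl) ?_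
  · intro c t' ht' x' hx' hrun w3 b3 e13 l14 i14 k3
    refine Ach.le_best ?_
    obtain ⟨w4, d4, b4, k4, e7, e15, e16, e17, e20, e21⟩ := transcript_spec hn hR hx' b3
      (by rw [k3 2 (by norm_num) (by norm_num) (by norm_num), P2.p])
    have core : ∀ i < 7, w4 i = w i := fun i hi => by
      rw [k4 i (by omega), k3 i (by omega) (by omega) (by omega), k2 i (by omega), k1 i (by omega)]
    have S4 : Stored pk M N code w4 := hw.congr b4 core
    have e8' : w4 8 = x 1 := by
      rw [k4 8 (by norm_num), k3 8 (by norm_num) (by norm_num) (by norm_num), k2 8 (by norm_num), e8]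
    refine d4.seq_ach ?_
    have hfw : ∀ y u : Mem, Bounded M y → Bounded M u → u 8 = x 1 →
        Bounded M (Function.update (Function.update y 0 0) 1 (u 8)) := fun y u hy hu hu8 =>
      (hy.update _ (by simp)).update _ (hu 8)
    rcases hck : checkProof pk (x 1) (x 2) (x 3) c (x' 1) (x' 2) with _ | R'
    · have h14 : w4 14 = 0 := by
        rw [k4 14 (by norm_num)]
        by_contra h
        simpa [hck] using i14.1 h
      refine (Ach.ite_neg (by simpa using h14) ((forward_spec hn hx' b4).ach v)).mono (by omega)
        (fun _ => le_rfl) ?_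
      simp only [Option.isSome_none, Bool.false_eq_true, if_false, mul_zero, tsub_zero]
      have := hok c t' ht' x' hx' hrun _ w4 (hfw x' w4 hx' b4 e8') (by simp) (by simp [e8'])
        (fun r h1 h2 => by
          have : r ≠ 0 := by omega
          have : r ≠ 1 := by omega
          simp [*]) S4 e7 (fun _ => e21) (fun R' h => by simp [hck] at h)
      rwa [hck] at this
    · have h14 : w4 14 ≠ 0 := by
        rw [k4 14 (by norm_num)]
        exact i14.2 (by simp [hck])
      refine Ach.ite_pos (by simpa using h14) ?_
      -- The second snapshot must not overlap the first, which the retries still need.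
      have d5 := save_spec (𝔾 := 𝔾) (n := n) (dst := 40 + n) hx' b4
      set w5 : Mem := fun i => if 40 + n ≤ i ∧ i < 40 + n + (n - 8) then x' (8 + (i - (40 + n)))
        else w4 i with hw5
      have b5 : Bounded M w5 := fun i => by
        simp only [hw5]; split_ifs
        exacts [hx' _, b4 _]
      have k5 : ∀ i < 40 + n, w5 i = w4 i := fun i hi => if_neg (by omega)
      have s5 : ∀ r, 8 ≤ r → r < n → w5 (40 + n - 8 + r) = x' r := fun r h1 h2 => by
        simp only [hw5]
        rw [if_pos (by omega)]
        congr 1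
        omega
      refine d5.seq_ach (Ach.seq_best ?_)
      have ret5 : Retrying pk (x 1) (x 2) (x 3) n x c (x' 1) (x' 2) w5 :=
        { toProving := P2.congr fun i hi h7 => by
            rw [k5 i (by omega), k4 i (by omega), k3 i (by omega) (by omega) (by omega)]
          c₁ := by rw [k5 15 (by omega), e15, e13]
          z₁ := by rw [k5 16 (by omega), e16]
          z₂ := by rw [k5 17 (by omega), e17]
          snapshot := fun r h1 h2 => by
            rw [k5 _ (by omega), k4 _ (by omega), k3 _ (by omega) (by omega) (by omega), s2 r h1 h2] }
      have S5 : Stored pk M N code w5 := S4.congr b5 fun i hi => k5 i (by omega)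
      refine (retry_ach hA hn hR ht hx hterm hck ret5 (y := F (some R') t' x') (l := l)
        ?_ ?_ N x' w5 hx' b5 (fun _ _ => rfl) (by rw [k5 20 (by omega), e20,
          k3 5 (by norm_num) (by norm_num) (by norm_num), k2 5 (by norm_num), k1 5 (by norm_num),
          hw.N]) (by rw [k5 21 (by omega), e21])).mono le_rfl (fun _ => le_rfl) ?_
      · intro y u hy hu hag f21 l18 l19 hwit
        refine Ach.le_best ?_
        refine (restore_spec (x₀ := x') (by omega) hy hu fun r h1 h2 => by
          rw [hag _ (by omega), s5 r h1 h2]).seq_ach ?_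
        set y' : Mem := fun r => if r < 8 then y r else x' r with hy'
        have by' : Bounded M y' := fun r => by
          simp only [hy']; split_ifs
          exacts [hy r, hx' r]
        have u8 : u 8 = x 1 := by rw [hag 8 (by omega), k5 8 (by omega), e8']
        refine (Ach.ite_pos (by simp [f21]) ((forward_spec hn by' hu).ach v)).mono le_rfl
          (fun _ => le_rfl) ?_
        have := hok c t' ht' x' hx' hrun _ u (hfw y' u by' hu u8) (by simp) (by simp [u8])
          (fun r h1 h2 => by
            have h3 : r ≠ 0 := by omega
            have h4 : r ≠ 1 := by omega
            have h5 : ¬ r < 8 := by omega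
            simp [h3, h4, hy', h5]) (S5.congr hu fun i hi => hag i (by omega))
          (by rw [hag 7 (by omega), k5 7 (by omega), e7]) (fun h => by simp [hck] at h)
          (fun R'' h => by
            rw [hck, Option.some.injEq] at h
            exact ⟨f21, l18, l19, h ▸ hwit⟩)
        rwa [hck] at this
      · intro y u hy hu hag f21
        refine Ach.le_best ?_
        refine (restore_spec (x₀ := x') (by omega) hy hu fun r h1 h2 => by
          rw [hag _ (by omega), s5 r h1 h2]).seq_ach ?_
        set y' : Mem := fun r => if r < 8 then y r else x' r with hy'
        have by' : Bounded M y' := fun r => by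
          simp only [hy']; split_ifs
          exacts [hy r, hx' r]
        refine (Ach.ite_neg (by simp [f21]) ((abort_spec hn hR by' hu).ach v)).mono (by omega)
          (fun _ => le_rfl) ?_
        refine habort _ u (by'.update _ ?_) hu (by simp) _ _ _
        have h1 : Nat.size 3 = 2 := by decide
        have := hR.size_p
        omega
      · simp
  · rw [tsub_le_iff_right]
    calc _ ≤ ev (PMF.uniformOfFintype (ZMod 𝔾.p)) fun c => wp 𝔾 A t (deliver [c.val] x) fun t' x' =>
          (F (checkProof pk (x 1) (x 2) (x 3) c (x' 1) (x' 2)) t' x' - l *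
          if (checkProof pk (x 1) (x 2) (x 3) c (x' 1) (x' 2)).isSome then
            failProb A pk (x 1) (x 2) (x 3) t x c ^ N else 0) + l *
          if (checkProof pk (x 1) (x 2) (x 3) c (x' 1) (x' 2)).isSome then
            failProb A pk (x 1) (x 2) (x 3) t x c ^ N else 0 :=
          ev_mono fun c _ => wp_mono fun t' x' _ => le_tsub_add
      _ ≤ _ := by
          simp only [wp_add, ev_add, wp_mul_left, ev_mul_left]
          gcongr
          exact extraction_loss hterm N

/-! ## The reduction -/

/-- Store the public data, and the number `(k + 2) ^ E` of iterations. -/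
def initOps (n E : ℕ) : List Op :=
  [.const (n + 1) 1, .copy (n + 2) 2, .copy (n + 3) 3, .copy (n + 4) 4, .const (n + 22) 2,
   .add (n + 22) (n + 22) 0, .const (n + 5) 1] ++
  List.replicate E (.mul (n + 5) (n + 5) (n + 22))

/-- The intermediate powers increase because `1 ≤ a`, so the size of the last one bounds all of
them. -/
lemma exec_replicate_mul {n M E : ℕ} (x : Mem) : ∀ (j : ℕ) (w : Mem) (a i : ℕ), w 22 = a →
    w 5 = a ^ i → 1 ≤ a → (a ^ E).size ≤ M → i + j ≤ E →
    Fits 𝔾 M (List.replicate j (.mul (n + 5) (n + 5) (n + 22))) (mem n x w) ∧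
    exec 𝔾 (List.replicate j (.mul (n + 5) (n + 5) (n + 22))) (mem n x w) =
      mem n x (Function.update w 5 (a ^ (i + j)))
  | 0, w, a, i, _, h5, _, _, _ => by simp [← h5]
  | j + 1, w, a, i, h22, h5, ha, hM, hE => by
    obtain ⟨h1, h2⟩ := exec_replicate_mul (E := E) x j (Function.update w 5 (a ^ (i + 1))) a (i + 1)
      (by simp [h22]) (by simp) ha hM (by omega)
    simp only [List.replicate_succ, Fits, exec, Op.target, Op.val, mem_add, update_mem_add, h5, h22,
      ← pow_succ]
    refine ⟨⟨(Nat.size_le_size (Nat.pow_le_pow_right ha (by omega))).trans hM, h1⟩, ?_⟩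
    rw [h2, Function.update_idem, show i + 1 + j = i + (j + 1) by omega]

lemma init_spec {n M E k : ℕ} (hn : 8 ≤ n) (hR : 𝔾.Room M ((k + 2) ^ E)) (hk : (k + 2).size ≤ M)
    {x w : Mem} (hx : Bounded M x) (hw : Bounded M w) {pk : MPK 𝔾} (h0 : x 0 = k) (h2 : x 2 = 𝔾.p)
    (h3 : x 3 = 𝔾.encG pk.g) (h4 : x 4 = 𝔾.encG pk.g₁) :
    ∃ w', Det 𝔾 (block (initOps n E)) ((7 + E) * (1 + 2 * M)) (mem n x w) (mem n x w') ∧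
      Stored pk M ((k + 2) ^ E) (w 6) w' ∧ w' 7 = w 7 := by
  have h1 : ∀ i < 8, i < n := fun i hi => by omega
  have hs2 : Nat.size 2 ≤ M := hR.of_lt (by have := 𝔾.prime_p.two_le; omega)
  set l : List Op := [.const (n + 1) 1, .copy (n + 2) 2, .copy (n + 3) 3, .copy (n + 4) 4,
    .const (n + 22) 2, .add (n + 22) (n + 22) 0, .const (n + 5) 1] with hl
  obtain ⟨w1, hw1⟩ : ∃ w1, w1 = Function.update (Function.update (Function.update (Function.update
    (Function.update (Function.update (Function.update w 1 1) 2 𝔾.p) 3 (𝔾.encG pk.g)) 4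
      (𝔾.encG pk.g₁)) 22 2) 22 (2 + k)) 5 1 := ⟨_, rfl⟩
  have hx1 : exec 𝔾 l (mem n x w) = mem n x w1 := by
    simp [hl, hw1, mem_of_lt (h1 0 (by norm_num)), mem_of_lt (h1 2 (by norm_num)),
      mem_of_lt (h1 3 (by norm_num)), mem_of_lt (h1 4 (by norm_num)), h0, h2, h3, h4]
  have hf : Fits 𝔾 M l (mem n x w) := by
    simp [hl, mem_of_lt (h1 0 (by norm_num)), mem_of_lt (h1 2 (by norm_num)),
      mem_of_lt (h1 3 (by norm_num)), mem_of_lt (h1 4 (by norm_num)), hR.one_le, hs2, hx 2, hx 3,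
      hx 4]
    rwa [h0, add_comm]
  obtain ⟨f2, e2⟩ := exec_replicate_mul (𝔾 := 𝔾) (n := n) (M := M) (E := E) x E w1 (k + 2) 0
    (by simp [hw1, add_comm]) (by simp [hw1]) (by omega) hR.size_N (by omega)
  have hf' : Fits 𝔾 M (initOps n E) (mem n x w) := (fits_append _ _ _).2 ⟨hf, hx1 ▸ f2⟩
  have d := block_det _ _ (hx.mem hw) hf'
  have b := exec_bounded _ _ (hx.mem hw) hf'
  have e : exec 𝔾 (initOps n E) (mem n x w) =
      mem n x (Function.update w1 5 ((k + 2) ^ E)) := by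
    rw [initOps, exec_append, ← hl, hx1, e2, zero_add]
  rw [e] at d b
  refine ⟨_, d.mono ?_, ⟨fun i => by simpa using b (n + i), ?_, ?_, ?_, ?_, ?_, ?_⟩, ?_⟩
  · simp [initOps]
    omega
  all_goals simp [hw1]

/-- The key of the accountable scheme, from a key of Gentry's scheme and the witness. -/
def convertOps (n : ℕ) : List Op :=
  [.sub (n + 22) (n + 2) (n + 18), .add (n + 22) (n + 22) 2, .mod 2 (n + 22) (n + 2),
   .powG (n + 22) (n + 3) (n + 19), .mulG 1 1 (n + 22), .copy (n + 23) 2]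

/-- If a request is pending, turn the answer of Gentry's PKG into one of the accountable PKG.
Register `23` is `0` if that is impossible. -/
def replyProg (n : ℕ) : Prog :=
  .seq (block [.const (n + 23) 1]) <|
  .ite (n + 7)
    (.seq (block [.const (n + 7) 0]) <|
     .ite (n + 21) (.ite 0 (block (convertOps n)) .skip)
      (block [.const 0 0, .const 1 0, .const 2 0]))
    .skip

/-- The time of `replyProg`. -/
def replyTime (M : ℕ) : ℕ := 8 * (1 + 2 * M) + 3

section reply

variable {n M N code : ℕ} {x w : Mem} {pk : MPK 𝔾}

lemma flag_spec (hR : 𝔾.Room M N) (hx : Bounded M x) (hw : Stored pk M N code w) (r : ℕ)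
    (hr : 7 ≤ r) {v : ℕ} (hv : v ≤ 1) :
    Det 𝔾 (block [.const (n + r) v]) (1 * (1 + 2 * M)) (mem n x w)
      (mem n x (Function.update w r v)) ∧ Stored pk M N code (Function.update w r v) := by
  have hM : v.size ≤ M := size_le_of_le_one hR.one_le hv
  have d := block_det (𝔾 := 𝔾) [.const (n + r) v] _ (hx.mem (n := n) hw.bdd) (by simpa using hM)
  simp only [exec, Op.target, Op.val, update_mem_add] at d
  exact ⟨d, hw.congr (hw.bdd.update _ hM) fun i hi => by
    rw [Function.update_of_ne (by omega)]⟩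

lemma reply_idle (hR : 𝔾.Room M N) (hx : Bounded M x) (hw : Stored pk M N code w) (h7 : w 7 = 0) :
    ∃ w', Det 𝔾 (replyProg n) (replyTime M) (mem n x w) (mem n x w') ∧ Stored pk M N code w' ∧
      w' 7 = 0 ∧ w' 23 ≠ 0 := by
  obtain ⟨d1, s1⟩ := flag_spec (n := n) hR hx hw 23 (by norm_num) le_rfl
  exact ⟨_, (d1.seq ((Det.skip _).ite_neg (by simp [h7]))).mono (by unfold replyTime; omega), s1,
    by simp [h7], by simp⟩

/-- After a rejected proof, Gentry's PKG has been asked all the same, so that both games keep the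
same list of requests, and its answer is discarded. An answer has at most three entries, so clearing
three registers makes it the message `0`. -/
lemma reply_reject (hn : 8 ≤ n) (hR : 𝔾.Room M N) (hx : Bounded M x) (hw : Stored pk M N code w)
    (h7 : w 7 = 1) (h21 : w 21 = 0) {l : List ℕ} (hl : l.length ≤ 3) (hlM : ∀ v ∈ l, v.size ≤ M) :
    ∃ w', Det 𝔾 (replyProg n) (replyTime M) (mem n (deliver l x) w) (mem n (deliver [0] x) w') ∧
      Stored pk M N code w' ∧ w' 7 = 0 ∧ w' 23 ≠ 0 := by
  have hx' := hx.deliver hlM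
  obtain ⟨d1, s1⟩ := flag_spec (n := n) hR hx' hw 23 (by norm_num) le_rfl
  obtain ⟨d2, s2⟩ := flag_spec (n := n) hR hx' s1 7 (by norm_num) zero_le_one
  set w2 := Function.update (Function.update w 23 1) 7 0 with hw2
  have d3 := block_det (𝔾 := 𝔾) (M := M) [.const 0 0, .const 1 0, .const 2 0]
    (mem n (deliver l x) w2) (hx'.mem s2.bdd) (by simp)
  have e : exec 𝔾 [.const 0 0, .const 1 0, .const 2 0] (mem n (deliver l x) w2) =
      mem n (deliver [0] x) w2 := by
    simp only [exec, Op.target, Op.val]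
    rw [update_mem_of_lt (by omega), update_mem_of_lt (by omega), update_mem_of_lt (by omega)]
    congr 1
    funext r
    by_cases hr : r < 8
    · interval_cases r <;> simp [deliver] <;> rw [List.getElem?_eq_none (by omega)] <;> rfl
    · have h : ∀ i < 8, r ≠ i := fun i hi => by omega
      simp [deliver, hr, h]
  rw [e] at d3
  exact ⟨w2, (d1.seq ((d2.seq (d3.ite_neg (by simp [hw2, h21]))).ite_pos (by simp [h7]))).mono
    (by simp [replyTime]; omega), s2, by simp [hw2], by simp [hw2]⟩

lemma reply_bot (hn : 8 ≤ n) (hR : 𝔾.Room M N) (hx : Bounded M x) (hw : Stored pk M N code w)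
    (h7 : w 7 = 1) (h21 : w 21 = 1) :
    ∃ w', Det 𝔾 (replyProg n) (replyTime M) (mem n (deliver [0] x) w) (mem n (deliver [0] x) w') ∧
      Stored pk M N code w' ∧ w' 7 = 0 ∧ w' 23 ≠ 0 := by
  have hx' : Bounded M (deliver [0] x) := hx.deliver (by simp)
  obtain ⟨d1, s1⟩ := flag_spec (n := n) hR hx' hw 23 (by norm_num) le_rfl
  obtain ⟨d2, s2⟩ := flag_spec (n := n) hR hx' s1 7 (by norm_num) zero_le_one
  refine ⟨_, (d1.seq ((d2.seq (((Det.skip _).ite_neg ?_).ite_pos (by simp [h21]))).ite_pos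
    (by simp [h7]))).mono (by simp [replyTime]; omega), s2, by simp, by simp⟩
  rw [mem_of_lt (by omega)]
  simp [deliver]

/-- Register `23` receives the new exponent `t - t₀`, so it vanishes exactly if this is the exponent
that the accountable PKG never uses, and then the reduction gives up. -/
lemma reply_convert (hn : 8 ≤ n) (hR : 𝔾.Room M N) (hx : Bounded M x) (hw : Stored pk M N code w)
    (h7 : w 7 = 1) (h21 : w 21 = 1) (h18 : w 18 < 𝔾.p) (d : 𝔾.G) (t : ZMod 𝔾.p) :
    ∃ w', Det 𝔾 (replyProg n) (replyTime M) (mem n (deliver [1, 𝔾.encG d, t.val] x) w)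
      (mem n (deliver [1, 𝔾.encG (d * zpow pk.g (w 19 : ZMod 𝔾.p)), (t - (w 18 : ZMod 𝔾.p)).val] x)
        w') ∧
      Stored pk M N code w' ∧ w' 7 = 0 ∧ w' 23 = (t - (w 18 : ZMod 𝔾.p)).val := by
  have htM : t.val.size ≤ M := hR.of_lt (by have := ZMod.val_lt t; omega)
  have hx' : Bounded M (deliver [1, 𝔾.encG d, t.val] x) := hx.deliver (by
    simp [hR.one_le, hR.encG, htM])
  have h1 : ∀ i < 8, i < n := fun i hi => by omega
  obtain ⟨d1, s1⟩ := flag_spec (n := n) hR hx' hw 23 (by norm_num) le_rfl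
  obtain ⟨d2, s2⟩ := flag_spec (n := n) hR hx' s1 7 (by norm_num) zero_le_one
  obtain ⟨w2, hw2⟩ : ∃ w2, w2 = Function.update (Function.update w 23 1) 7 0 := ⟨_, rfl⟩
  rw [← hw2] at d2 s2
  have e18 : w2 18 = w 18 := by simp [hw2]
  have e19 : w2 19 = w 19 := by simp [hw2]
  obtain ⟨a, ha⟩ : ∃ a, a = (𝔾.p - w 18 + t.val) % 𝔾.p := ⟨_, rfl⟩
  have hat : a = (t - (w 18 : ZMod 𝔾.p)).val := by
    rw [ha, ← ZMod.val_natCast]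
    congr 1
    rw [Nat.cast_add, Nat.cast_sub h18.le]
    simp
    ring
  have hap : a < 𝔾.p := ha ▸ 𝔾.mod_lt _
  have haM : a.size ≤ M := hR.of_lt (by omega)
  set y := deliver [1, 𝔾.encG d, t.val] x with hy
  have y1 : y 1 = 𝔾.encG d := by simp [hy, deliver]
  have y2 : y 2 = t.val := by simp [hy, deliver]
  have hup : ∀ (r v : ℕ) (z u : Mem), r < 8 → Function.update (mem n z u) r v =
      mem n (Function.update z r v) u := fun r v z u hr => update_mem_of_lt (h1 r hr) v z u
  have hme : ∀ (r : ℕ) (z u : Mem), r < 8 → mem n z u r = z r :=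
    fun r z u hr => mem_of_lt (h1 r hr) z u
  have tle := ZMod.val_lt t
  have hf : Fits 𝔾 M (convertOps n) (mem n y w2) := by
    simp only [convertOps, Fits, Op.target, Op.val, update_mem_add, mem_add,
      hup 2 _ _ _ (by norm_num), hup 1 _ _ _ (by norm_num), hme 1 _ _ (by norm_num),
      hme 2 _ _ (by norm_num)]
    simp only [Function.update_apply]
    norm_num
    rw [s2.p, e18, y2, ← ha]
    exact ⟨hR.of_lt (by omega), hR.of_lt (by omega), haM, size_powN hR.toSizeLE _ _,
      size_mulN hR.toSizeLE _ _, haM⟩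
  have d3 := block_det _ _ (hx'.mem s2.bdd) hf
  have b3 := exec_bounded _ _ (hx'.mem s2.bdd) hf
  obtain ⟨u, hu⟩ : ∃ u : Mem, u = fun i => exec 𝔾 (convertOps n) (mem n y w2) (n + i) := ⟨_, rfl⟩
  have e : exec 𝔾 (convertOps n) (mem n y w2) =
      mem n (Function.update (Function.update y 2 a) 1
        (𝔾.encG (d * zpow pk.g (w 19 : ZMod 𝔾.p)))) u := by
    rw [hu]
    simp only [convertOps, exec, Op.target, Op.val, update_mem_add, mem_add,
      hup 2 _ _ _ (by norm_num), hup 1 _ _ _ (by norm_num), hme 1 _ _ (by norm_num),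
      hme 2 _ _ (by norm_num)]
    simp only [Function.update_apply]
    norm_num
    rw [s2.p, e18, e19, s2.g, y1, y2, ← ha, powN_encG, mulN_encG, pow_eq_zpow]
    congr 1
    funext i
    by_cases h23 : i = 23
    · simp [h23]
    · by_cases h22 : i = 22 <;> simp [h23, h22]
  have ey : Function.update (Function.update y 2 a) 1 (𝔾.encG (d * zpow pk.g (w 19 : ZMod 𝔾.p))) =
      deliver [1, 𝔾.encG (d * zpow pk.g (w 19 : ZMod 𝔾.p)), (t - (w 18 : ZMod 𝔾.p)).val] x := by
    funext r
    by_cases hr : r < 8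
    · interval_cases r <;> simp [hy, deliver, hat]
    · have h : ∀ i < 8, r ≠ i := fun i hi => by omega
      simp [hy, deliver, hr, h]
  rw [e, ey] at d3
  have hflag : mem n y w2 0 ≠ 0 := by
    rw [hme 0 _ _ (by norm_num)]
    simp [hy, deliver]
  have k : ∀ i < 18, u i = w2 i := fun i hi => by
    have h22 : i ≠ 22 := by omega
    have h23 : i ≠ 23 := by omega
    simp only [hu, convertOps, exec, Op.target, Op.val, update_mem_add, mem_add,
      hup 2 _ _ _ (by norm_num), hup 1 _ _ _ (by norm_num), hme 1 _ _ (by norm_num),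
      hme 2 _ _ (by norm_num)]
    simp [h22, h23]
  have d4 : Det 𝔾 (.ite (n + 21) (.ite 0 (block (convertOps n)) .skip)
      (block [.const 0 0, .const 1 0, .const 2 0])) _ (mem n y w2) _ :=
    (d3.ite_pos hflag).ite_pos (by simp [hw2, h21])
  refine ⟨u, (d1.seq ((d2.seq d4).ite_pos
    (by simp [h7]))).mono (by simp [replyTime, convertOps]; omega), s2.congr (fun i => ?_)
      (fun i hi => k i (by omega)), ?_, ?_⟩
  · rw [hu]; exact b3 _
  · rw [k 7 (by norm_num)]; simp [hw2]
  · rw [← hat, hu]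
    simp only [convertOps, exec, Op.target, Op.val, update_mem_add, mem_add,
      hup 2 _ _ _ (by norm_num), hup 1 _ _ _ (by norm_num), hme 1 _ _ (by norm_num),
      hme 2 _ _ (by norm_num)]
    simp only [Function.update_apply]
    norm_num
    rw [s2.p, e18, y2, ← ha]

end reply

/-- The numeric code of the challenge identity. -/
def chalCode : Option (ZMod 𝔾.p × Bool) → ℕ
  | none => 0
  | some c => c.1.val + 1

/-- Compare the identity of a request with the challenge identity. -/
def compareOps (n : ℕ) : List Op :=
  [.const (n + 23) 1, .mod (n + 22) 1 (n + 2), .add (n + 22) (n + 22) (n + 23),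
   .sub (n + 24) (n + 22) (n + 6), .sub (n + 25) (n + 6) (n + 22), .add (n + 24) (n + 24) (n + 25)]

/-- Store the challenge identity. -/
def challengeIdOps (n : ℕ) : List Op :=
  [.mod (n + 22) 1 (n + 2), .const (n + 23) 1, .add (n + 6) (n + 22) (n + 23)]

/-- Process the message of the embedded machine. -/
def postProg (A : Prog) (n : ℕ) : Prog :=
  .ite 0 (block (challengeIdOps n))
    (.seq (block (compareOps n)) (.ite (n + 24) (keygenProg A n) .skip))

/-- The time of `postProg`. -/
def postTime (n M N : ℕ) : ℕ := 6 * (1 + 2 * M) + (keygenTime n M N + 1) + 1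

/-- Identities are coded with an offset of one, so that the code `0` of a missing challenge equals
no identity; register `24` is the distance of the codes. For the forbidden identity the request is
passed on at once, and both games end with a coin. -/
lemma compare_spec {n M N : ℕ} (hn : 8 ≤ n) (hR : 𝔾.Room M N) {x w : Mem} (hx : Bounded M x)
    {pk : MPK 𝔾} {chal : Option (ZMod 𝔾.p × Bool)} (hw : Stored pk M N (chalCode chal) w) :
    ∃ w', Det 𝔾 (block (compareOps n)) (6 * (1 + 2 * M)) (mem n x w) (mem n x w') ∧
      Stored pk M N (chalCode chal) w' ∧
      (w' 24 = 0 ↔ chal.map Prod.fst = some (x 1 : ZMod 𝔾.p)) := by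
  have h1 : 1 < n := by omega
  have hm := 𝔾.mod_lt (x 1)
  have hp := 𝔾.prime_p.two_le
  have hcode : chalCode chal ≤ 𝔾.p := by
    rcases chal with _ | c
    · exact Nat.zero_le _
    · exact ZMod.val_lt c.1
  have hf : Fits 𝔾 M (compareOps n) (mem n x w) := by
    simp only [compareOps, Fits, Op.target, Op.val, update_mem_add, mem_add, mem_of_lt h1]
    simp only [Function.update_apply]
    norm_num
    rw [hw.p, hw.code]
    exact ⟨hR.one_le, hR.of_lt (by omega), hR.of_lt (by omega), hR.of_lt (by omega),
      hR.of_lt (by omega), hR.of_lt (by omega)⟩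
  have d := block_det _ _ (hx.mem hw.bdd) hf
  have b := exec_bounded _ _ (hx.mem hw.bdd) hf
  have e : exec 𝔾 (compareOps n) (mem n x w) =
      mem n x (fun i => exec 𝔾 (compareOps n) (mem n x w) (n + i)) := by
    simp only [compareOps, exec, Op.target, Op.val, update_mem_add, mem_add]
  rw [e] at d
  refine ⟨_, d, hw.congr (fun i => b _) fun i hi => ?_, ?_⟩
  · have h : ∀ j, 22 ≤ j → i ≠ j := fun j hj => by omega
    simp [compareOps, h]
  · have hcmp : chal.map Prod.fst = some (x 1 : ZMod 𝔾.p) ↔ x 1 % 𝔾.p + 1 = chalCode chal := by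
      rcases chal with _ | ⟨I, c⟩
      · simp [chalCode]
      · rw [Option.map_some, Option.some.injEq, chalCode, Nat.add_right_cancel_iff,
          ← ZMod.val_natCast, eq_comm]
        exact ⟨fun h => by rw [h], fun h => ZMod.val_injective _ h⟩
    rw [hcmp]
    simp only [compareOps, exec, Op.target, Op.val, update_mem_add, mem_add, mem_of_lt h1]
    simp only [Function.update_apply]
    norm_num
    rw [hw.p, hw.code]
    omega

/-- The identity is recorded for every message other than a key request. This is harmless: unless
the message is a legitimate challenge query, the game ends with it. -/
lemma challengeId_spec {n M N code : ℕ} (hn : 8 ≤ n) (hR : 𝔾.Room M N) {x w : Mem}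
    (hx : Bounded M x) {pk : MPK 𝔾} (hw : Stored pk M N code w) :
    ∃ w', Det 𝔾 (block (challengeIdOps n)) (3 * (1 + 2 * M)) (mem n x w) (mem n x w') ∧
      Stored pk M N ((x 1 : ZMod 𝔾.p).val + 1) w' ∧ w' 7 = w 7 := by
  have h1 : 1 < n := by omega
  have hm := 𝔾.mod_lt (x 1)
  have hp := 𝔾.prime_p.two_le
  have hf : Fits 𝔾 M (challengeIdOps n) (mem n x w) := by
    simp only [challengeIdOps, Fits, Op.target, Op.val, update_mem_add, mem_add, mem_of_lt h1]
    simp only [Function.update_apply]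
    norm_num
    rw [hw.p]
    exact ⟨hR.of_lt (by omega), hR.one_le, hR.of_lt (by omega)⟩
  have d := block_det _ _ (hx.mem hw.bdd) hf
  have b := exec_bounded _ _ (hx.mem hw.bdd) hf
  have e : exec 𝔾 (challengeIdOps n) (mem n x w) =
      mem n x (fun i => exec 𝔾 (challengeIdOps n) (mem n x w) (n + i)) := by
    simp only [challengeIdOps, exec, Op.target, Op.val, update_mem_add, mem_add]
  rw [e] at d
  refine ⟨_, d, ⟨fun i => b _, ?_, ?_, ?_, ?_, ?_, ?_⟩, ?_⟩
  · simp [challengeIdOps, hw.init]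
  · simp [challengeIdOps, hw.p]
  · simp [challengeIdOps, hw.g]
  · simp [challengeIdOps, hw.g₁]
  · simp [challengeIdOps, hw.N]
  · simp [challengeIdOps, mem_of_lt h1, hw.p, ZMod.val_natCast]
  · simp [challengeIdOps]

/-- What the reduction does before it activates the embedded machine. -/
def preProg (n E : ℕ) : Prog := .seq (.ite (n + 1) .skip (block (initOps n E))) (replyProg n)

/-- The time of `preProg`. -/
def preTime (M E : ℕ) : ℕ := (7 + E) * (1 + 2 * M) + 1 + replyTime M

/-- The adversary against Gentry's scheme. -/
def reduction (A : Prog) (n E : ℕ) : Prog :=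
  .seq (preProg n E) (.ite (n + 23) (.seq A (postProg A n)) abort)

lemma pre_of_reply {n M N E code : ℕ} {pk : MPK 𝔾} {x w : Mem} {m : Mem}
    (hw : Stored pk M N code w) (h : Det 𝔾 (replyProg n) (replyTime M) (mem n x w) m) :
    Det 𝔾 (preProg n E) (preTime M E) (mem n x w) m :=
  (((Det.skip _).ite_pos (by simp [hw.init])).seq h).mono (by unfold preTime; omega)

/-! ## One step of the game -/

/-- The game after the adversary has halted with memory `m'`. -/
def step {S : Type} (A : Prog) (pk : MPK 𝔾) (distinct : Bool)
    (keygen : S → ZMod 𝔾.p → ℕ → Mem → PMF (Option (S × ℕ × Mem))) (fuel : ℕ) (σ : S)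
    (asked : List (ZMod 𝔾.p)) (chal : Option (ZMod 𝔾.p × Bool)) (t' : ℕ) (m' : Mem) :
    PMF (Option Bool) :=
  let ID : ZMod 𝔾.p := (m' 1 : ZMod 𝔾.p)
  match m' 0, chal with
  | 0, _ =>
      if chal.map Prod.fst = some ID then coin
      else if distinct = true ∧ ID ∈ asked then pure none
      else do
        match ← keygen σ ID t' m' with
        | none => pure none
        | some (σ', t'', m'') =>
            play A pk distinct keygen fuel t'' m'' σ' (ID :: asked) chal
  | 1, none =>
      match 𝔾.decGT (m' 2), 𝔾.decGT (m' 3) with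
      | some m₀, some m₁ =>
          if ID ∈ asked then coin
          else do
            let b ← PMF.uniformOfFintype Bool
            let C ← encrypt pk ID (if b then m₁ else m₀)
            play A pk distinct keygen fuel t'
              (deliver [𝔾.encG C.1, 𝔾.encGT C.2.1, 𝔾.encGT C.2.2] m') σ asked
              (some (ID, b))
      | _, _ => coin
  | 2, some (_, b) => pure (some (decide (m' 1 ≠ 0) == b))
  | _, _ => coin

section step

variable {S : Type} {A : Prog} {pk : MPK 𝔾} {distinct : Bool}
  {keygen : S → ZMod 𝔾.p → ℕ → Mem → PMF (Option (S × ℕ × Mem))} {fuel : ℕ} {σ : S}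
  {asked : List (ZMod 𝔾.p)} {chal : Option (ZMod 𝔾.p × Bool)} {t : ℕ} {m : Mem}

lemma play_succ : play A pk distinct keygen (fuel + 1) (t + 1) m σ asked chal =
    A.run 𝔾 t m >>= fun o => match o with
      | none => pure none
      | some (t', m') => step A pk distinct keygen fuel σ asked chal t' m' := rfl

lemma play_fuel_zero : play A pk distinct keygen 0 t m σ asked chal = pure none := by
  unfold play; rfl

lemma play_time_zero : play A pk distinct keygen (fuel + 1) 0 m σ asked chal = pure none := by
  change (pure none : PMF (Option (ℕ × Mem))) >>= _ = _
  rw [LawfulMonad.pure_bind]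

lemma ev_play_succ {val : Option Bool → ℝ≥0∞} (h0 : val none = 0) :
    ev (play A pk distinct keygen (fuel + 1) (t + 1) m σ asked chal) val =
      wp 𝔾 A t m fun t' m' => ev (step A pk distinct keygen fuel σ asked chal t' m') val := by
  rw [play_succ, ev_bind, wp]
  congr 1
  funext o
  rcases o with _ | ⟨t', m'⟩
  · simp [h0]
  · rfl

/-- A game that ends in time can be unfolded. -/
lemma play_none (h : play A pk distinct keygen fuel t m σ asked chal none = 0) :
    ∃ fuel' t', fuel = fuel' + 1 ∧ t = t' + 1 ∧
      ∀ t'' m'', A.run 𝔾 t' m (some (t'', m'')) ≠ 0 →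
        step A pk distinct keygen fuel' σ asked chal t'' m'' none = 0 := by
  rcases fuel with _ | fuel
  · simp [play_fuel_zero, pure_apply_eq_zero] at h
  rcases t with _ | t
  · simp [play_time_zero, pure_apply_eq_zero] at h
  refine ⟨fuel, t, rfl, rfl, fun t'' m'' hr => ?_⟩
  rw [play_succ, bind_apply_eq_zero] at h
  exact h _ hr

lemma step_key (h : m 0 = 0) : step A pk distinct keygen fuel σ asked chal t m =
    if chal.map Prod.fst = some (m 1 : ZMod 𝔾.p) then coin
    else if distinct = true ∧ (m 1 : ZMod 𝔾.p) ∈ asked then pure none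
    else keygen σ (m 1) t m >>= fun o => match o with
      | none => pure none
      | some (σ', t'', m'') =>
          play A pk distinct keygen fuel t'' m'' σ' ((m 1 : ZMod 𝔾.p) :: asked) chal := by
  unfold step
  simp only [h]

lemma step_challenge (h : m 0 = 1) : step A pk distinct keygen fuel σ asked none t m =
    match 𝔾.decGT (m 2), 𝔾.decGT (m 3) with
      | some m₀, some m₁ =>
          if (m 1 : ZMod 𝔾.p) ∈ asked then coin
          else PMF.uniformOfFintype Bool >>= fun b =>
            encrypt pk (m 1) (if b then m₁ else m₀) >>= fun C =>
            play A pk distinct keygen fuel t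
              (deliver [𝔾.encG C.1, 𝔾.encGT C.2.1, 𝔾.encGT C.2.2] m) σ asked
              (some ((m 1 : ZMod 𝔾.p), b))
      | _, _ => coin := by
  unfold step
  simp only [h]

lemma step_guess {c : ZMod 𝔾.p × Bool} (h : m 0 = 2) :
    step A pk distinct keygen fuel σ asked (some c) t m =
      pure (some (decide (m 1 ≠ 0) == c.2)) := by
  unfold step
  simp only [h]

lemma step_coin (h0 : m 0 ≠ 0) (h1 : m 0 = 1 → chal ≠ none) (h2 : m 0 = 2 → chal = none) :
    step A pk distinct keygen fuel σ asked chal t m = coin := by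
  unfold step
  rcases hm : m 0 with _ | _ | _ | k
  · exact absurd hm h0
  · rcases chal with _ | c
    · exact absurd rfl (h1 hm)
    · rfl
  · rw [h2 hm]; rfl
  · rfl

end step

/-! ## Key generation in the two games -/

/-- The answer of the accountable PKG to an accepted proof. -/
def accReply (pk : MPK 𝔾) (α ID : ZMod 𝔾.p) (R : 𝔾.G) (u : ZMod 𝔾.p) : List ℕ :=
  if ID = α then [0] else [1, 𝔾.encG (zpow (pk.h * R * zpow pk.g (-u)) (α - ID)⁻¹), u.val]

/-- The answer of Gentry's PKG. -/
def gentryReply (pk : MPK 𝔾) (α ID u : ZMod 𝔾.p) : List ℕ :=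
  if ID = α then [0] else [1, 𝔾.encG (zpow (pk.h * zpow pk.g (-u)) (α - ID)⁻¹), u.val]

/-- Under both conventions the exponent is fresh and uniform: under `fresh` always, under `once`
because no exponent has been stored for this identity. -/
lemma ev_step_gentry {rep : Repetition} {B : Prog} {pk : MPK 𝔾} {α ID : ZMod 𝔾.p}
    {σ : GentryState 𝔾} {fuel : ℕ} {asked : List (ZMod 𝔾.p)} {chal : Option (ZMod 𝔾.p × Bool)}
    {t : ℕ} {m : Mem} (h0 : m 0 = 0) (h1 : (m 1 : ZMod 𝔾.p) = ID)
    (hch : chal.map Prod.fst ≠ some ID) (hσ : rep = .once → σ ID = none)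
    (val : Option Bool → ℝ≥0∞) :
    ev (step B pk false (gentryKeygen rep pk α) fuel σ asked chal t m) val =
    ev (PMF.uniformOfFintype (ZMod 𝔾.p)) fun u =>
      ev (play B pk false (gentryKeygen rep pk α) fuel t (deliver (gentryReply pk α ID u) m)
        (Function.update σ ID (some u)) (ID :: asked) chal) val := by
  have h : gentryExponent rep σ ID = PMF.uniformOfFintype (ZMod 𝔾.p) := by
    unfold gentryExponent
    rcases rep with _ | _
    · rfl
    · rw [hσ rfl]
  rw [step_key h0, h1, if_neg hch, if_neg (by simp)]
  unfold gentryKeygen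
  rw [ev_bind, ev_bind, h]
  simp only [ev_pure]
  rfl

/-- The continuation of the accountable game after the proof of knowledge. -/
def afterProof (pk : MPK 𝔾) (α ID : ZMod 𝔾.p) (κ : ℕ → Mem → PMF (Option Bool))
    (o : Option 𝔾.G) (t : ℕ) (m : Mem) : PMF (Option Bool) :=
  match o with
  | none => κ t (deliver [0] m)
  | some R => PMF.uniformOfFintype (ZMod 𝔾.p)ˣ >>= fun u =>
      κ t (deliver (accReply pk α ID R (u : ZMod 𝔾.p)) m)

lemma step_request {A : Prog} {pk : MPK 𝔾} {α : ZMod 𝔾.p} {distinct : Bool} {fuel : ℕ}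
    {asked : List (ZMod 𝔾.p)} {chal : Option (ZMod 𝔾.p × Bool)} {t : ℕ} {m : Mem} (h0 : m 0 = 0)
    (hch : chal.map Prod.fst ≠ some (m 1 : ZMod 𝔾.p))
    (hdup : ¬ (distinct = true ∧ (m 1 : ZMod 𝔾.p) ∈ asked)) :
    step A pk distinct (accountableKeygen A pk α) fuel () asked chal t m =
    PMF.uniformOfFintype (ZMod 𝔾.p) >>= fun c =>
      activate 𝔾 A t (deliver [c.val] m) >>= fun o => match o with
        | none => pure none
        | some (t', m') =>
          afterProof pk α (m 1) (fun t'' m'' => play A pk distinct (accountableKeygen A pk α) fuel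
            t'' m'' () ((m 1 : ZMod 𝔾.p) :: asked) chal)
            (checkProof pk (m 1) (m 2) (m 3) c (m' 1) (m' 2)) t' m' := by
  rw [step_key h0, if_neg hch, if_neg hdup]
  unfold accountableKeygen
  rw [LawfulMonad.bind_assoc]
  congr 1
  funext c
  rw [LawfulMonad.bind_assoc]
  congr 1
  funext o
  rcases o with _ | ⟨t', m'⟩
  · rw [LawfulMonad.pure_bind]
  · simp only [afterProof]
    rcases checkProof pk (m 1) (m 2) (m 3) c (m' 1) (m' 2) with _ | R
    · simp only [LawfulMonad.pure_bind]
    · simp only [LawfulMonad.bind_assoc, LawfulMonad.pure_bind]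
      rfl

lemma ev_step_request {A : Prog} {pk : MPK 𝔾} {α : ZMod 𝔾.p} {distinct : Bool} {fuel : ℕ}
    {asked : List (ZMod 𝔾.p)} {chal : Option (ZMod 𝔾.p × Bool)} {t : ℕ} {m : Mem} (h0 : m 0 = 0)
    (hch : chal.map Prod.fst ≠ some (m 1 : ZMod 𝔾.p))
    (hdup : ¬ (distinct = true ∧ (m 1 : ZMod 𝔾.p) ∈ asked)) {val : Option Bool → ℝ≥0∞}
    (hval : val none = 0) :
    ev (step A pk distinct (accountableKeygen A pk α) fuel () asked chal (t + 1) m) val =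
    ev (PMF.uniformOfFintype (ZMod 𝔾.p)) fun c => wp 𝔾 A t (deliver [c.val] m) fun t' m' =>
      ev (afterProof pk α (m 1) (fun t'' m'' => play A pk distinct (accountableKeygen A pk α) fuel
            t'' m'' () ((m 1 : ZMod 𝔾.p) :: asked) chal)
            (checkProof pk (m 1) (m 2) (m 3) c (m' 1) (m' 2)) t' m') val := by
  rw [step_request h0 hch hdup, ev_bind]
  congr 1
  funext c
  rw [ev_bind]
  change ev (A.run 𝔾 t (deliver [c.val] m)) _ = _
  unfold wp
  congr 1
  funext o
  rcases o with _ | ⟨t', m'⟩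
  · simp [hval]
  · rfl

/-- The loss by the exponent `0`, which the accountable PKG does not use. -/
lemma unit_loss {p : ℕ} [Fact p.Prime] {V g : ZMod p → ℝ≥0∞} {β l c : ℝ≥0∞}
    (hV : ∀ t, V t ≤ β + l) (t₀ : ZMod p) (hg : ∀ t, t ≠ t₀ → V (t - t₀) ≤ g t + c)
    (hg₀ : β ≤ g t₀) :
    (ev (PMF.uniformOfFintype (ZMod p)ˣ) fun u => V u) ≤
      ev (PMF.uniformOfFintype (ZMod p)) g + (c + l * (p : ℝ≥0∞)⁻¹) := by
  set a := ev (PMF.uniformOfFintype (ZMod p)ˣ) fun u => V u with ha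
  have ha1 : a ≤ β + l := ev_le fun u _ => hV u
  have hp : (p : ℝ≥0∞) ≠ 0 := by exact_mod_cast (Fact.out : p.Prime).ne_zero
  have hcard : Fintype.card (ZMod p)ˣ + 1 = p := by
    rw [ZMod.card_units]
    have := (Fact.out : p.Prime).two_le
    omega
  have hsum : (Fintype.card (ZMod p)ˣ : ℝ≥0∞) * a = ∑ u : (ZMod p)ˣ, V u := by
    rw [ha, ev_uniform, ← mul_assoc, ENNReal.mul_inv_cancel, one_mul]
    · exact_mod_cast Fintype.card_ne_zero
    · exact ENNReal.natCast_ne_top _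
  -- Giving the excluded exponent `0` the average value `a` turns the average over the units into an
  -- average over all residues, which can be shifted by `t₀`.
  have h1 : (p : ℝ≥0∞) * a = ∑ s, Function.update V 0 a s := by
    have h2 : (p : ℝ≥0∞) = (Fintype.card (ZMod p)ˣ : ℝ≥0∞) + 1 := by exact_mod_cast hcard.symm
    rw [h2, add_mul, one_mul, hsum, ← Finset.sum_erase_add _ _ (Finset.mem_univ (0 : ZMod p)),
      Function.update_self]
    congr 1
    refine Finset.sum_bij (fun u _ => (u : ZMod p)) (fun u _ => by simp) (fun u _ v _ h => Units.ext h)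
      (fun s hs => ⟨Units.mk0 s (Finset.ne_of_mem_erase hs), Finset.mem_univ _, rfl⟩)
      (fun u _ => by rw [Function.update_of_ne u.ne_zero])
  have h2 : ∑ s, Function.update V 0 a s ≤ ∑ t, g t + p * c + l := by
    rw [← (Equiv.subRight t₀).sum_comp]
    calc ∑ t, Function.update V 0 a (t - t₀) ≤ ∑ t, (g t + c + if t = t₀ then l else 0) := by
          refine Finset.sum_le_sum fun t _ => ?_
          by_cases ht : t = t₀
          · subst ht
            rw [sub_self, Function.update_self, if_pos rfl]
            calc a ≤ β + l := ha1
              _ ≤ g t + l := by gcongr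
              _ ≤ _ := by gcongr; exact le_self_add
          · rw [Function.update_of_ne (sub_ne_zero.2 ht), if_neg ht, add_zero]
            exact hg t ht
      _ = _ := by
          simp [Finset.sum_add_distrib, ZMod.card]
  have h3 : a = (p : ℝ≥0∞)⁻¹ * (p * a) := by
    rw [← mul_assoc, ENNReal.inv_mul_cancel hp (ENNReal.natCast_ne_top _), one_mul]
  rw [h3, h1, ev_uniform, ZMod.card]
  calc _ ≤ (p : ℝ≥0∞)⁻¹ * (∑ t, g t + p * c + l) := by gcongr
    _ = _ := by
      rw [mul_add, mul_add, ← mul_assoc _ (p : ℝ≥0∞) c,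
        ENNReal.inv_mul_cancel hp (ENNReal.natCast_ne_top _), one_mul, add_assoc, mul_comm _ l]

/-! ## The simulation -/

/-- The assumptions of the simulation. The value of an outcome exceeds that of a fair coin by at most
`l`. -/
structure Setting (pk : MPK 𝔾) (α : ZMod 𝔾.p) (A : Prog) (n M N : ℕ) (rep : Repetition)
    (distinct : Bool) (val : Option Bool → ℝ≥0∞) (l : ℝ≥0∞) : Prop where
  bound_le : A.bound ≤ n
  le_n : 8 ≤ n
  room : 𝔾.Room M N
  pk_eq : pk.g₁ = zpow pk.g α
  distinct_eq : rep = .once → distinct = true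
  val_none : val none = 0
  val_le : ∀ o, val o ≤ ev coin val + l

/-- The loss in one round. -/
def lossPer (p N : ℕ) (l : ℝ≥0∞) : ℝ≥0∞ :=
  l * (((N : ℝ≥0∞) + 1)⁻¹ + (p : ℝ≥0∞)⁻¹) + l * (p : ℝ≥0∞)⁻¹

/-- The time of the reduction in one round. -/
def roundTime (n M N E : ℕ) : ℕ := preTime M E + (M + postTime n M N + 1) + 1

/-- The game for Gentry's scheme simulates `fuel` rounds of the game for the accountable scheme. -/
def Simulates (pk : MPK 𝔾) (α : ZMod 𝔾.p) (A : Prog) (n M N E : ℕ) (rep : Repetition)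
    (distinct : Bool) (val : Option Bool → ℝ≥0∞) (l : ℝ≥0∞) (fuel : ℕ) : Prop :=
  ∀ t ≤ M, ∀ (x w : Mem) (asked : List (ZMod 𝔾.p)) (chal : Option (ZMod 𝔾.p × Bool))
    (σ : GentryState 𝔾), Bounded M x → Stored pk M N (chalCode chal) w → w 7 = 0 → w 23 ≠ 0 →
    (rep = .once → ∀ ID, ID ∉ asked → σ ID = none) →
    play A pk distinct (accountableKeygen A pk α) fuel t x () asked chal none = 0 →
    ∀ fuelB ≥ fuel, ∀ tB ≥ fuel * roundTime n M N E, ∀ mB,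
      Det 𝔾 (preProg n E) (preTime M E) mB (mem n x w) →
      ev (play A pk distinct (accountableKeygen A pk α) fuel t x () asked chal) val ≤
        ev (play (reduction A n E) pk false (gentryKeygen rep pk α) fuelB tB mB σ asked chal) val +
          fuel * lossPer 𝔾.p N l

section

variable {pk : MPK 𝔾} {α : ZMod 𝔾.p} {A : Prog} {n M N E : ℕ} {rep : Repetition} {distinct : Bool}
  {val : Option Bool → ℝ≥0∞} {l : ℝ≥0∞}

/-- The value of the game for Gentry's scheme after an activation of the reduction that leaves time
`T`. -/
def gameValue (pk : MPK 𝔾) (α : ZMod 𝔾.p) (A : Prog) (n E : ℕ) (rep : Repetition)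
    (val : Option Bool → ℝ≥0∞) (fuel T : ℕ) (σ : GentryState 𝔾) (asked : List (ZMod 𝔾.p))
    (chal : Option (ZMod 𝔾.p × Bool)) (m : Mem) : ℝ≥0∞ :=
  ⨅ (t : ℕ) (_ : T ≤ t),
    ev (step (reduction A n E) pk false (gentryKeygen rep pk α) fuel σ asked chal t m) val

lemma le_gameValue {fuel T : ℕ} {σ : GentryState 𝔾} {asked : List (ZMod 𝔾.p)}
    {chal : Option (ZMod 𝔾.p × Bool)} {m : Mem} {q : ℝ≥0∞}
    (h : ∀ t ≥ T, q ≤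
      ev (step (reduction A n E) pk false (gentryKeygen rep pk α) fuel σ asked chal t m) val) :
    q ≤ gameValue pk α A n E rep val fuel T σ asked chal m :=
  le_iInf₂ h

/-- `Ach` admits only values of the memory, whereas the rest of the game also depends on the
remaining time; the infimum `gameValue` over all sufficient times bridges this. -/
lemma le_play_of_ach (h0 : val none = 0) {fuel T : ℕ} {σ : GentryState 𝔾} {asked : List (ZMod 𝔾.p)}
    {chal : Option (ZMod 𝔾.p × Bool)} {m x w : Mem} {q : ℝ≥0∞}
    (hpre : Det 𝔾 (preProg n E) (preTime M E) m (mem n x w))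
    (h : Ach 𝔾 (.ite (n + 23) (.seq A (postProg A n)) abort) (M + postTime n M N + 1) (mem n x w)
      (gameValue pk α A n E rep val fuel T σ asked chal) q) {t : ℕ}
    (ht : t ≥ T + roundTime n M N E) :
    q ≤ ev (play (reduction A n E) pk false (gentryKeygen rep pk α) (fuel + 1) t m σ asked chal)
      val := by
  obtain ⟨t, rfl⟩ : ∃ t', t = t' + 1 := ⟨t - 1, by unfold roundTime at ht; omega⟩
  rw [ev_play_succ h0]
  have := hpre.seq_ach h (t - (preTime M E + (M + postTime n M N + 1))) _
    fun t' ht' m' => iInf₂_le (f := fun t (_ : T ≤ t) =>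
      ev (step (reduction A n E) pk false (gentryKeygen rep pk α) fuel σ asked chal t m') val) t'
      (by unfold roundTime at ht; omega)
  rwa [Nat.sub_add_cancel (by unfold roundTime at ht; omega)] at this

lemma ev_val_le (hs : Setting pk α A n M N rep distinct val l) (μ : PMF (Option Bool)) :
    ev μ val ≤ ev coin val + l := ev_le fun o _ => hs.val_le o

lemma play_abort (hs : Setting pk α A n M N rep distinct val l) {fuel : ℕ} {σ : GentryState 𝔾}
    {asked : List (ZMod 𝔾.p)} {chal : Option (ZMod 𝔾.p × Bool)} {m x w : Mem}
    (hx : Bounded M x) (hw : Bounded M w) (h23 : w 23 = 0)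
    (hpre : Det 𝔾 (preProg n E) (preTime M E) m (mem n x w)) {t : ℕ}
    (ht : t ≥ roundTime n M N E) :
    ev coin val ≤
      ev (play (reduction A n E) pk false (gentryKeygen rep pk α) (fuel + 1) t m σ asked chal)
        val := by
  refine le_play_of_ach (N := N) (T := 0) hs.val_none hpre ((Ach.ite_neg (by simpa using h23)
    ((abort_spec hs.le_n hs.room hx hw).ach _)).mono (by unfold postTime; omega) (fun _ => le_rfl)
      ?_) (by omega)
  refine le_gameValue fun t' _ => ?_
  have h3 : mem n (Function.update x 0 3) w 0 = 3 := by
    rw [mem_of_lt (by have := hs.le_n; omega), Function.update_self]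
  rw [step_coin (by simp [h3]) (by simp [h3]) (by simp [h3])]

lemma roundTime_le {fuel : ℕ} (h : fuel ≠ 0) : roundTime n M N E ≤ fuel * roundTime n M N E :=
  Nat.le_mul_of_pos_left _ (Nat.pos_of_ne_zero h)

/-- The answer to a key generation request with an accepted proof. -/
lemma accepted_le (hs : Setting pk α A n M N rep distinct val l) {fuel : ℕ}
    (ih : Simulates pk α A n M N E rep distinct val l fuel) {t : ℕ} (ht : t ≤ M) {x y w : Mem}
    (hx : Bounded M x) (hy : Bounded M y) (hxy : ∀ r, 8 ≤ r → r < n → y r = x r)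
    {asked : List (ZMod 𝔾.p)} {chal : Option (ZMod 𝔾.p × Bool)} {σ : GentryState 𝔾}
    {ID : ZMod 𝔾.p} (hσ : rep = .once → ∀ I, I ∉ asked → σ I = none)
    (hw : Stored pk M N (chalCode chal) w) (h7 : w 7 = 1) (h21 : w 21 = 1) (h18 : w 18 < 𝔾.p)
    {R : 𝔾.G} (hwit : IsWitness pk ID R (w 18) (w 19))
    (hnone : ∀ u : (ZMod 𝔾.p)ˣ, play A pk distinct (accountableKeygen A pk α) fuel t
      (deliver (accReply pk α ID R (u : ZMod 𝔾.p)) x) () (ID :: asked) chal none = 0)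
    {fuelB : ℕ} (hfuel : fuel ≤ fuelB) {tB : ℕ} (htB : tB ≥ fuel * roundTime n M N E) :
    ev (PMF.uniformOfFintype (ZMod 𝔾.p)ˣ >>= fun u =>
      play A pk distinct (accountableKeygen A pk α) fuel t
        (deliver (accReply pk α ID R (u : ZMod 𝔾.p)) x) () (ID :: asked) chal) val ≤
    (ev (PMF.uniformOfFintype (ZMod 𝔾.p)) fun u =>
      ev (play (reduction A n E) pk false (gentryKeygen rep pk α) fuelB tB
        (deliver (gentryReply pk α ID u) (mem n y w)) (Function.update σ ID (some u)) (ID :: asked)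
          chal) val) + (fuel * lossPer 𝔾.p N l + l * (𝔾.p : ℝ≥0∞)⁻¹) := by
  have hσ' : ∀ u : ZMod 𝔾.p, rep = .once → ∀ I, I ∉ ID :: asked →
      Function.update σ ID (some u) I = none := fun u h I hI => by
    rw [List.mem_cons, not_or] at hI
    rw [Function.update_of_ne hI.1, hσ h I hI.2]
  have h1M := hs.room.one_le
  have hn := hs.le_n
  -- The accountable game still has a round left, hence so has Gentry's; the reduction needs it to
  -- be able to abort.
  obtain ⟨f0, -, rfl, -, -⟩ := play_none (hnone 1)
  obtain ⟨fB, rfl⟩ : ∃ fB, fuelB = fB + 1 := ⟨fuelB - 1, by omega⟩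
  rw [ev_bind]
  by_cases hα : ID = α
  · simp only [accReply, gentryReply, if_pos hα, ev_const] at hnone ⊢
    refine le_trans ?_ (add_le_add_right le_self_add _)
    rw [← tsub_le_iff_right]
    refine le_ev fun u _ => ?_
    rw [tsub_le_iff_right]
    obtain ⟨w', d', s', h7', h23'⟩ := reply_bot hn hs.room hy hw h7 h21
    rw [deliver_congr [0] hxy w'] at d'
    rw [deliver_mem hn]
    exact ih t ht _ w' (ID :: asked) chal _ (hx.deliver (by simp)) s' h7' h23' (hσ' u) (hnone 1) _
      hfuel _ htB _ (pre_of_reply hw d')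
  · simp only [accReply, gentryReply, if_neg hα] at hnone ⊢
    have hsz : ∀ u : ZMod 𝔾.p, u.val.size ≤ M := fun u =>
      hs.room.of_lt (by have := ZMod.val_lt u; omega)
    have key : ∀ u : ZMod 𝔾.p, ∃ w', Det 𝔾 (preProg n E) (preTime M E)
        (deliver [1, 𝔾.encG (zpow (pk.h * zpow pk.g (-u)) (α - ID)⁻¹), u.val] (mem n y w))
        (mem n (deliver [1, 𝔾.encG (zpow (pk.h * R * zpow pk.g (-(u - (w 18 : ZMod 𝔾.p))))
          (α - ID)⁻¹), (u - (w 18 : ZMod 𝔾.p)).val] x) w') ∧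
        Stored pk M N (chalCode chal) w' ∧ w' 7 = 0 ∧ w' 23 = (u - (w 18 : ZMod 𝔾.p)).val := by
      intro u
      obtain ⟨w', d', s', h7', h23'⟩ := reply_convert hn hs.room hy hw h7 h21 h18
        (zpow (pk.h * zpow pk.g (-u)) (α - ID)⁻¹) u
      rw [convert_key hs.pk_eq hα (t₀ := (w 18 : ZMod 𝔾.p)), ← hwit, deliver_congr _ hxy w'] at d'
      refine ⟨w', ?_, s', h7', h23'⟩
      rw [deliver_mem hn]
      exact pre_of_reply hw d'
    refine unit_loss (β := ev coin val) (l := l) (t₀ := (w 18 : ZMod 𝔾.p))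
      (V := fun u => ev (play A pk distinct (accountableKeygen A pk α) (f0 + 1) t
        (deliver [1, 𝔾.encG (zpow (pk.h * R * zpow pk.g (-u)) (α - ID)⁻¹), u.val] x) ()
        (ID :: asked) chal) val) (fun u => ev_val_le hs _) ?_ ?_
    · intro u hu
      obtain ⟨w', d', s', h7', h23'⟩ := key u
      have hne : u - (w 18 : ZMod 𝔾.p) ≠ 0 := sub_ne_zero.2 hu
      refine ih t ht _ w' (ID :: asked) chal _ (hx.deliver (by
        simp [h1M, hs.room.encG, hsz])) s' h7' (by rw [h23', ne_eq, ZMod.val_eq_zero]; exact hne)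
        (hσ' u) (hnone (Units.mk0 _ hne)) _ hfuel _ htB _ d'
    -- The exponent `t = t₀` corresponds to `t₁ = 0`: the reduction aborts and gets the value of a
    -- coin.
    · obtain ⟨w', d', s', -, h23'⟩ := key (w 18 : ZMod 𝔾.p)
      refine play_abort hs (hx.deliver (by simp [h1M, hs.room.encG])) s'.bdd ?_ d'
        ((roundTime_le (by omega)).trans htB)
      rw [h23', sub_self, ZMod.val_zero]

/-- The simulation of a key generation request. -/
lemma request_ach (hs : Setting pk α A n M N rep distinct val l) {fuel : ℕ}
    (ih : Simulates pk α A n M N E rep distinct val l fuel) {t : ℕ} (ht : t ≤ M) {x w : Mem}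
    (hx : Bounded M x) (h0 : x 0 = 0)
    {asked : List (ZMod 𝔾.p)} {chal : Option (ZMod 𝔾.p × Bool)} {σ : GentryState 𝔾}
    (hσ : rep = .once → ∀ I, I ∉ asked → σ I = none) (hw : Stored pk M N (chalCode chal) w)
    (hnone : step A pk distinct (accountableKeygen A pk α) fuel () asked chal t x none = 0)
    {fuelB : ℕ} (hfuel : fuel ≤ fuelB) :
    Ach 𝔾 (postProg A n) (postTime n M N) (mem n x w)
      (gameValue pk α A n E rep val fuelB (fuel * roundTime n M N E) σ asked chal)
      (ev (step A pk distinct (accountableKeygen A pk α) fuel () asked chal t x) val -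
        (fuel + 1) * lossPer 𝔾.p N l) := by
  have hn := hs.le_n
  set ID : ZMod 𝔾.p := (x 1 : ZMod 𝔾.p) with hID
  obtain ⟨w1, d1, s1, hcmp⟩ := compare_spec hn hs.room hx hw
  refine (Ach.ite_neg (by rwa [mem_of_lt (by omega)])
    (d1.seq_ach (c := keygenTime n M N + 1) ?_)).mono le_rfl (fun _ => le_rfl) le_rfl
  by_cases hch : chal.map Prod.fst = some ID
  · rw [step_key h0, ← hID, if_pos hch]
    refine ((Ach.ite_neg (by rw [mem_add]; exact hcmp.2 hch) ((Det.skip _).ach _)).mono (by omega)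
      (fun _ => le_rfl) ?_)
    refine tsub_le_self.trans (le_gameValue fun t' _ => ?_)
    rw [step_key (by rwa [mem_of_lt (by omega)]), mem_of_lt (by omega), if_pos hch]
  by_cases hdup : distinct = true ∧ ID ∈ asked
  · rw [step_key h0, ← hID, if_neg hch, if_pos hdup] at hnone
    exact absurd hnone (by simp [pure_apply_eq_zero])
  set κ : ℕ → Mem → PMF (Option Bool) := fun t'' m'' =>
    play A pk distinct (accountableKeygen A pk α) fuel t'' m'' () (ID :: asked) chal with hκ
  rw [step_request h0 hch hdup, ← hID, ← hκ] at hnone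
  rw [bind_apply_eq_zero] at hnone
  rcases t with _ | t
  · exfalso
    have h := hnone 0 (uniform_ne_zero _)
    change ((pure none : PMF (Option (ℕ × Mem))) >>= _) none = 0 at h
    rw [LawfulMonad.pure_bind] at h
    exact absurd h (by simp [pure_apply_eq_zero])
  have hrun : ∀ c : ZMod 𝔾.p, ∀ o, A.run 𝔾 t (deliver [c.val] x) o ≠ 0 → (match o with
        | none => pure none
        | some (t', m') =>
          afterProof pk α ID κ (checkProof pk ID (x 2) (x 3) c (m' 1) (m' 2)) t' m' :
            PMF (Option Bool)) none = 0 := fun c o ho =>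
    bind_apply_eq_zero.1 (hnone c (uniform_ne_zero c)) o ho
  -- Every challenge has positive probability, so sure termination of the game gives termination for
  -- every challenge, and therefore also in the retries.
  have hterm : ∀ c : ZMod 𝔾.p, A.run 𝔾 t (deliver [c.val] x) none = 0 := fun c => by
    by_contra h
    exact absurd (hrun c none h) (by simp [pure_apply_eq_zero])
  rw [ev_step_request h0 hch hdup hs.val_none, ← hID, ← hκ]
  set a : ℝ≥0∞ := fuel * lossPer 𝔾.p N l + l * (𝔾.p : ℝ≥0∞)⁻¹ with ha
  refine Ach.ite_pos (by rw [mem_add]; exact fun h => hch (hcmp.1 h)) ?_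
  refine (keygen_ach hs.bound_le hn hs.room (by omega) hx s1 hterm (l := l)
    (F := fun o t' m' => ev (afterProof pk α ID κ o t' m') val - a) ?_ ?_).mono le_rfl
      (fun _ => le_rfl) ?_
  · intro c t' ht' x' hx' hsup y w' hy hy0 hy1 hyx s' h7 hrej hacc
    refine le_gameValue fun tB htB => ?_
    have hy1' : ((mem n y w' 1 : ℕ) : ZMod 𝔾.p) = ID := by
      rw [mem_of_lt (by omega), hy1]
    rw [ev_step_gentry (by rwa [mem_of_lt (by omega)]) hy1' hch
      (fun h => hσ h ID fun hmem => hdup ⟨hs.distinct_eq h, hmem⟩)]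
    have hafter := hrun c _ hsup
    simp only at hafter
    rw [tsub_le_iff_right]
    rcases hck : checkProof pk ID (x 2) (x 3) c (x' 1) (x' 2) with _ | R
    · rw [hck] at hafter
      have h21 := hrej hck
      refine le_trans ?_ (add_le_add_right (le_self_add : fuel * lossPer 𝔾.p N l ≤ a) _)
      rw [← tsub_le_iff_right]
      refine le_ev fun u _ => ?_
      rw [tsub_le_iff_right]
      have hl : (gentryReply pk α ID u).length ≤ 3 := by
        unfold gentryReply; split_ifs <;> simp
      have hlM : ∀ v ∈ gentryReply pk α ID u, v.size ≤ M := by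
        have : u.val.size ≤ M := hs.room.of_lt (by have := ZMod.val_lt u; omega)
        unfold gentryReply; split_ifs <;> simp [hs.room.one_le, hs.room.encG, this]
      obtain ⟨w2, d2, s2, h72, h232⟩ := reply_reject hn hs.room hy s' h7 h21 hl hlM
      rw [deliver_congr [0] hyx w2] at d2
      rw [deliver_mem hn]
      refine ih t' (by omega) _ w2 (ID :: asked) chal _ (hx'.deliver (by simp)) s2 h72 h232
        (fun h I hI => ?_) hafter _ hfuel _ htB _ ?_
      · rw [List.mem_cons, not_or] at hI
        rw [Function.update_of_ne hI.1, hσ h I hI.2]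
      · exact ((Det.skip _).ite_pos (by rw [mem_add, s'.init]; exact one_ne_zero) |>.seq d2).mono
          (by unfold preTime; omega)
    · rw [hck] at hafter
      obtain ⟨h21, h18, -, hwit⟩ := hacc R hck
      exact accepted_le hs ih (by omega) hx' hy hyx hσ s' h7 h21 h18 hwit
        (fun u => bind_apply_eq_zero.1 hafter u (uniform_ne_zero u)) hfuel htB
  · intro y w' hy hw' hy0 o t' x'
    refine (tsub_le_tsub_right tsub_le_self l).trans ?_
    rw [tsub_le_iff_right]
    refine (ev_val_le hs _).trans (add_le_add_left (le_gameValue fun tB _ => ?_) l)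
    have h3 : mem n y w' 0 = 3 := by rw [mem_of_lt (by omega), hy0]
    rw [step_coin (by simp [h3]) (by simp [h3]) (by simp [h3])]
  · rw [tsub_le_iff_right]
    -- This round loses the extraction error; `a` collects the loss `l/p` of its key conversion and
    -- that of the later rounds.
    have hsplit : ((fuel : ℝ≥0∞) + 1) * lossPer 𝔾.p N l =
        l * (((N : ℝ≥0∞) + 1)⁻¹ + (𝔾.p : ℝ≥0∞)⁻¹) + a := by
      rw [ha, lossPer]
      ring
    rw [hsplit, ← add_assoc]
    refine le_trans ?_ (add_le_add_left le_tsub_add a)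
    calc _ ≤ ev (PMF.uniformOfFintype (ZMod 𝔾.p)) fun c => wp 𝔾 A t (deliver [c.val] x) fun t' m' =>
          (ev (afterProof pk α ID κ (checkProof pk ID (x 2) (x 3) c (m' 1) (m' 2)) t' m') val - a)
            + a := ev_mono fun c _ => wp_mono fun t' m' _ => le_tsub_add
      _ = _ := by
          simp only [wp_add, ev_add, fun c : ZMod 𝔾.p => wp_const (hterm c) a, ev_const]
          rfl

/-- The simulation of the other messages. -/
lemma message_ach (hs : Setting pk α A n M N rep distinct val l) {fuel : ℕ}
    (ih : Simulates pk α A n M N E rep distinct val l fuel) {t : ℕ} (ht : t ≤ M) {x w : Mem}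
    (hx : Bounded M x) (h0 : x 0 ≠ 0)
    {asked : List (ZMod 𝔾.p)} {chal : Option (ZMod 𝔾.p × Bool)} {σ : GentryState 𝔾}
    (hσ : rep = .once → ∀ I, I ∉ asked → σ I = none) (hw : Stored pk M N (chalCode chal) w)
    (h7 : w 7 = 0)
    (hnone : step A pk distinct (accountableKeygen A pk α) fuel () asked chal t x none = 0)
    {fuelB : ℕ} (hfuel : fuel ≤ fuelB) :
    Ach 𝔾 (postProg A n) (postTime n M N) (mem n x w)
      (gameValue pk α A n E rep val fuelB (fuel * roundTime n M N E) σ asked chal)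
      (ev (step A pk distinct (accountableKeygen A pk α) fuel () asked chal t x) val -
        (fuel + 1) * lossPer 𝔾.p N l) := by
  have hn := hs.le_n
  obtain ⟨w1, d1, s1, h71⟩ := challengeId_spec hn hs.room hx hw
  refine ((d1.ite_pos (by rwa [mem_of_lt (by omega)])).ach _).mono (by unfold postTime; omega)
    (fun _ => le_rfl) (le_gameValue fun tB htB => ?_)
  have e : ∀ r < 8, mem n x w1 r = x r := fun r hr => mem_of_lt (by omega) _ _
  have e0 := e 0 (by norm_num)
  by_cases h1 : x 0 = 1 ∧ chal = none
  · obtain ⟨h1, rfl⟩ := h1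
    rw [step_challenge h1] at hnone
    rw [step_challenge h1, step_challenge (by rwa [e0]), e 1 (by norm_num), e 2 (by norm_num),
      e 3 (by norm_num)]
    rcases hd2 : 𝔾.decGT (x 2) with _ | m₀
    · exact tsub_le_self
    rcases hd3 : 𝔾.decGT (x 3) with _ | m₁
    · exact tsub_le_self
    simp only [hd2, hd3] at hnone ⊢
    split_ifs at hnone ⊢
    · exact tsub_le_self
    rw [bind_apply_eq_zero] at hnone
    rw [tsub_le_iff_right, ev_bind, ev_bind]
    rw [← ev_const (PMF.uniformOfFintype Bool) (((fuel : ℝ≥0∞) + 1) * lossPer 𝔾.p N l), ← ev_add]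
    refine ev_mono fun b hb => ?_
    rw [ev_bind, ev_bind, ← ev_const (encrypt pk (x 1) (if b then m₁ else m₀))
      (((fuel : ℝ≥0∞) + 1) * lossPer 𝔾.p N l), ← ev_add]
    refine ev_mono fun C hC => ?_
    -- Encryption is the same in both schemes, so bit and ciphertext are coupled identically, and
    -- the ciphertext reaches `A` unchanged.
    obtain ⟨w2, d2, s2, h72, h232⟩ := reply_idle (n := n) (x := deliver [𝔾.encG C.1,
      𝔾.encGT C.2.1, 𝔾.encGT C.2.2] x) hs.room (hx.deliver (by
        simp [hs.room.encG, hs.room.encGT])) s1 (by rw [h71, h7])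
    refine (ih t ht _ w2 asked (some ((x 1 : ZMod 𝔾.p), b)) σ (hx.deliver (by
        simp [hs.room.encG, hs.room.encGT])) s2 h72 h232
      hσ (bind_apply_eq_zero.1 (hnone b hb) C hC) fuelB hfuel tB htB
        (deliver [𝔾.encG C.1, 𝔾.encGT C.2.1, 𝔾.encGT C.2.2] (mem n x w1)) ?_).trans ?_
    · rw [deliver_mem hn]
      exact pre_of_reply s1 d2
    · gcongr
      exact le_self_add
  by_cases h2 : x 0 = 2 ∧ chal ≠ none
  · obtain ⟨h2, hc⟩ := h2
    obtain ⟨c, rfl⟩ := Option.ne_none_iff_exists'.1 hc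
    rw [step_guess h2, step_guess (by rwa [e0]), e 1 (by norm_num)]
    exact tsub_le_self
  · have g1 : x 0 = 1 → chal ≠ none := fun h hc => h1 ⟨h, hc⟩
    have g2 : x 0 = 2 → chal = none := fun h => by
      by_contra hc
      exact h2 ⟨h, hc⟩
    rw [step_coin h0 g1 g2, step_coin (by rwa [e0]) (by rwa [e0]) (by rwa [e0])]
    exact tsub_le_self

/-- Induction on the rounds of `A`. The invariant speaks of the memory after `preProg`, which treats
the start of the game and the conversion of replies alike. One round of `A`, including its answer to
a proof challenge, takes one activation of the reduction, since rewinding needs no oracle. -/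
theorem simulates (hs : Setting pk α A n M N rep distinct val l) :
    ∀ fuel, Simulates pk α A n M N E rep distinct val l fuel := by
  intro fuel
  induction fuel with
  | zero =>
    intro t ht x w asked chal σ _ _ _ _ _ hnone
    obtain ⟨f, -, hf, -⟩ := play_none hnone
    omega
  | succ fuel ih =>
    intro t ht x w asked chal σ hx hw h7 h23 hσ hnone fuelB hfuelB tB htB mB hpre
    obtain ⟨f, t, hf, rfl, hstep⟩ := play_none hnone
    obtain rfl : fuel = f := by omega
    obtain ⟨fB, rfl⟩ : ∃ fB, fuelB = fB + 1 := ⟨fuelB - 1, by omega⟩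
    rw [← tsub_le_iff_right]
    refine le_play_of_ach (N := N) (T := fuel * roundTime n M N E) hs.val_none hpre ?_
      (by rw [← Nat.succ_mul]; exact htB)
    refine Ach.ite_pos (by rwa [mem_add]) (Ach.seq_best ?_)
    refine (Ach.frame hs.room.toSizeLE hs.bound_le (by omega : t ≤ M) hx w (f := fun t' x' =>
      ev (step A pk distinct (accountableKeygen A pk α) fuel () asked chal t' x') val -
        (fuel + 1) * lossPer 𝔾.p N l) ?_).mono (by omega) (fun _ => le_rfl) ?_
    · intro t' ht' x' hx' hrun
      refine Ach.le_best ?_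
      by_cases h0 : x' 0 = 0
      · exact request_ach hs ih (by omega) hx' h0 hσ hw (hstep _ _ hrun) (by omega)
      · exact message_ach hs ih (by omega) hx' h0 hσ hw h7 (hstep _ _ hrun) (by omega)
    · rw [tsub_le_iff_right, ev_play_succ hs.val_none]
      push_cast
      have hle : (wp 𝔾 A t x fun _ _ => ((fuel : ℝ≥0∞) + 1) * lossPer 𝔾.p N l) ≤
          (fuel + 1) * lossPer 𝔾.p N l := ev_le fun o _ => by rcases o with _ | s <;> simp
      refine le_trans ?_ (add_le_add_right hle _)
      rw [← wp_add]
      exact wp_mono fun t' x' _ => le_tsub_add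

end

/-! ## The reduction in the complete game -/

lemma setup_spec {pk : MPK 𝔾} {α : ZMod 𝔾.p} (h : setup 𝔾 (pk, α) ≠ 0) :
    pk.g₁ = zpow pk.g α := by
  unfold setup at h
  obtain ⟨g, -, h⟩ := bind_apply_ne_zero.1 h
  obtain ⟨h', -, h⟩ := bind_apply_ne_zero.1 h
  obtain ⟨a, -, h⟩ := bind_apply_ne_zero.1 h
  rw [pure_apply_ne_zero, Prod.mk.injEq] at h
  rw [h.1, h.2]

/-- The `p` group elements have distinct representations below `2 ^ L`, hence `p ≤ 2 ^ L`. No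
separate bound on the length of the order is thus needed. -/
lemma BilinearGroup.size_p_le {L : ℕ} (h : ∀ x, (𝔾.encG x).size ≤ L) : 𝔾.p.size ≤ L + 1 := by
  rw [Nat.size_le, pow_succ]
  have h1 : Fintype.card 𝔾.G ≤ Fintype.card (Fin (2 ^ L)) :=
    Fintype.card_le_of_injective (fun x => ⟨𝔾.encG x, Nat.size_le.1 (h x)⟩) fun x y hxy =>
      𝔾.encG_injective (Fin.mk.inj_iff.1 hxy)
  rw [𝔾.card_G, Fintype.card_fin] at h1
  have := Nat.two_pow_pos L
  omega

lemma start_det {n M E k d : ℕ} (hn : 8 ≤ n) (hR : 𝔾.Room M ((k + 2) ^ E))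
    (hk : (k + 2).size ≤ M) (pk : MPK 𝔾) (hx : Bounded M (startMem k d pk)) :
    ∃ w, Det 𝔾 (preProg n E) (preTime M E) (startMem k d pk) (mem n (startMem k d pk) w) ∧
      Stored pk M ((k + 2) ^ E) 0 w ∧ w 7 = 0 ∧ w 23 ≠ 0 := by
  have e : mem n (startMem k d pk) (fun _ => 0) = startMem k d pk := by
    funext r
    by_cases hr : r < n
    · rw [mem_of_lt hr]
    · simp [mem, hr, startMem, deliver, show ¬ r < 8 by omega]
  have h0 : Bounded M fun _ => 0 := fun r => by simp
  obtain ⟨w1, d1, s1, h7⟩ := init_spec (n := n) hn hR hk hx h0 (pk := pk) rfl rfl rfl rfl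
  obtain ⟨w2, d2, s2, h72, h232⟩ := reply_idle (n := n) hR hx s1 h7
  rw [← e]
  nth_rw 2 [e]
  exact ⟨w2, ((d1.ite_neg (by simp)).seq d2).mono (by unfold preTime; omega), s2, h72, h232⟩

lemma lossPer_anti {p q N : ℕ} (h : q ≤ p) (l : ℝ≥0∞) : lossPer p N l ≤ lossPer q N l := by
  unfold lossPer
  gcongr

/-- Both games draw the same description and keys, so it suffices to compare them for each choice;
`2 ^ k < p` makes the loss uniform over the groups. -/
lemma game_le {F : BilinearFamily} {rep : Repetition} {A : Prog} {n M E T T' k : ℕ}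
    (hA : A.bound ≤ n) (hn : 8 ≤ n) (hT : T ≤ M) (hlen : 2 * F.len.eval k + 4 ≤ M)
    (hN : ((k + 2) ^ E).size ≤ M) (hk : (k + 2).size ≤ M) (hTT' : T ≤ T')
    (hround : T * roundTime n M ((k + 2) ^ E) E ≤ T')
    (hnone : accountableGame F rep A T k none = 0) {val : Option Bool → ℝ≥0∞} {l : ℝ≥0∞}
    (hval : val none = 0) (hle : ∀ o, val o ≤ ev coin val + l) :
    ev (accountableGame F rep A T k) val ≤
      ev (gentryGame F rep (reduction A n E) T' k) val +
        T * lossPer (2 ^ k) ((k + 2) ^ E) l := by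
  unfold accountableGame at hnone ⊢
  unfold gentryGame
  rw [bind_apply_eq_zero] at hnone
  rw [ev_bind, ev_bind, ← ev_const (F.gen k) (T * _), ← ev_add]
  refine ev_mono fun d hd => ?_
  replace hnone := bind_apply_eq_zero.1 (hnone d hd)
  rw [ev_bind, ev_bind, ← ev_const (setup (F.group d)) (T * _), ← ev_add]
  refine ev_mono fun ⟨pk, α⟩ hpk => ?_
  replace hnone := hnone ⟨pk, α⟩ hpk
  have hd' : d ∈ (F.gen k).support := (PMF.mem_support_iff _ _).2 hd
  have hG := F.size_encG k d hd'
  have hGT := F.size_encGT k d hd'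
  have hp := (F.group d).size_p_le hG
  have hR : (F.group d).Room M ((k + 2) ^ E) :=
    { one_le := by omega
      encG := fun x => (hG x).trans (by omega)
      encGT := fun x => (hGT x).trans (by omega)
      size_p := by omega
      size_N := hN }
  have hx : Bounded M (startMem k d pk) := by
    refine Bounded.deliver (fun r => by simp) ?_
    have h1 : k.size ≤ M := (Nat.size_le_size (by omega)).trans hk
    have h2 : d.size ≤ M := (F.size_desc k d hd').trans (by omega)
    have h3 : (F.group d).p.size ≤ M := by omega
    simp [h1, h2, h3, hR.encG]
  obtain ⟨w, hw, s, h7, h23⟩ := start_det hn hR hk pk hx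
  have hs : ∀ {distinct : Bool}, (rep = .once → distinct = true) →
      Setting pk α A n M ((k + 2) ^ E) rep distinct val l := fun hdist =>
    { bound_le := hA
      le_n := hn
      room := hR
      pk_eq := setup_spec hpk
      distinct_eq := hdist
      val_none := hval
      val_le := hle }
  refine (simulates (hs fun h => by subst h; rfl) T T hT _ w [] none (fun _ => none) hx s h7 h23 (fun _ _ _ => rfl) hnone T'
    hTT' T' hround _ hw).trans ?_
  gcongr
  exact lossPer_anti (F.two_pow_lt k d hd').le l

/-! ## Polynomial bounds -/

/-- Functions that are evaluations of polynomials. -/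
def IsPoly (f : ℕ → ℕ) : Prop := ∃ Q : Polynomial ℕ, ∀ k, Q.eval k = f k

namespace IsPoly

variable {f g : ℕ → ℕ}

lemma eval (Q : Polynomial ℕ) : IsPoly fun k => Q.eval k := ⟨Q, fun _ => rfl⟩

lemma const (c : ℕ) : IsPoly fun _ => c := ⟨Polynomial.C c, fun _ => Polynomial.eval_C⟩

lemma id : IsPoly fun k => k := ⟨Polynomial.X, fun _ => Polynomial.eval_X⟩

lemma add (hf : IsPoly f) (hg : IsPoly g) : IsPoly fun k => f k + g k := by
  obtain ⟨P, hP⟩ := hf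
  obtain ⟨Q, hQ⟩ := hg
  exact ⟨P + Q, fun k => by rw [Polynomial.eval_add, hP, hQ]⟩

lemma mul (hf : IsPoly f) (hg : IsPoly g) : IsPoly fun k => f k * g k := by
  obtain ⟨P, hP⟩ := hf
  obtain ⟨Q, hQ⟩ := hg
  exact ⟨P * Q, fun k => by rw [Polynomial.eval_mul, hP, hQ]⟩

lemma pow (hf : IsPoly f) (n : ℕ) : IsPoly fun k => f k ^ n := by
  obtain ⟨P, hP⟩ := hf
  exact ⟨P ^ n, fun k => by rw [Polynomial.eval_pow, hP]⟩

lemma roundTime (n E : ℕ) (hf : IsPoly f) (hg : IsPoly g) :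
    IsPoly fun k => roundTime n (f k) (g k) E := by
  unfold AIBE.roundTime preTime replyTime postTime keygenTime retryTime trialTime successTime
  repeat' first
    | exact hf
    | exact hg
    | exact const _
    | refine add ?_ ?_
    | refine mul ?_ ?_

end IsPoly

/-- The base `k + 2 ≥ 2` absorbs coefficients, by `a ≤ 2 ^ a`, and sums of two terms, at the price
of a larger exponent. -/
lemma exists_eval_le_pow (Q : Polynomial ℕ) : ∃ e, ∀ k, Q.eval k ≤ (k + 2) ^ e := by
  induction Q using Polynomial.induction_on' with
  | add P Q hP hQ =>
    obtain ⟨a, ha⟩ := hP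
    obtain ⟨b, hb⟩ := hQ
    refine ⟨max a b + 1, fun k => ?_⟩
    have h1 : (k + 2) ^ a ≤ (k + 2) ^ max a b := Nat.pow_le_pow_right (by omega) (le_max_left _ _)
    have h2 : (k + 2) ^ b ≤ (k + 2) ^ max a b := Nat.pow_le_pow_right (by omega) (le_max_right _ _)
    rw [Polynomial.eval_add, pow_succ]
    nlinarith [ha k, hb k]
  | monomial m a =>
    refine ⟨a + m, fun k => ?_⟩
    rw [Polynomial.eval_monomial, pow_add]
    refine Nat.mul_le_mul ?_ (Nat.pow_le_pow_left (by omega) m)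
    exact a.lt_two_pow_self.le.trans (Nat.pow_le_pow_left (by omega) a)

open scoped Topology
open Filter

/-! ## Advantages -/

lemma ev_coin (val : Option Bool → ℝ≥0∞) :
    ev coin val = 2⁻¹ * (val (some true) + val (some false)) := by
  rw [coin, ev_map, ev_uniform]
  simp

lemma sum_outcomes {μ : PMF (Option Bool)} (h : μ none = 0) :
    (μ (some true)).toReal + (μ (some false)).toReal = 1 := by
  have h1 := μ.tsum_coe
  rw [tsum_fintype, Fintype.sum_option, h, zero_add, Fintype.sum_bool] at h1
  rw [← ENNReal.toReal_add (PMF.apply_ne_top _ _) (PMF.apply_ne_top _ _), h1, ENNReal.toReal_one]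

/-- An advantage may come from guessing wrongly too often. The bound for the other outcome supplies
the missing lower bound on `a`. -/
lemma abs_sub_half_le {a b a' b' ε : ℝ} (h : a + b = 1) (h' : a' + b' = 1) (ha : a ≤ a' + ε)
    (hb : b ≤ b' + ε) : |a - 1 / 2| ≤ |a' - 1 / 2| + ε := by
  have := le_abs_self (a' - 1 / 2)
  have := neg_abs_le (a' - 1 / 2)
  rw [abs_le]
  constructor <;> linarith

lemma exists_reduction (F : BilinearFamily) (rep : Repetition) (A : Prog) (T : Polynomial ℕ)
    (hT : RunsIn (accountableGame F rep) A T) (E : ℕ) :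
    ∃ (B : Prog) (T' : Polynomial ℕ), RunsIn (gentryGame F rep) B T' ∧
      ∀ k, advantage (accountableGame F rep) A T k ≤ advantage (gentryGame F rep) B T' k +
        ((T.eval k : ℕ) : ℝ) * ((((k + 2 : ℕ) : ℝ) ^ E + 1)⁻¹ + 2 * (2 ^ k)⁻¹) := by
  set n := 8 + A.bound with hn
  set M : ℕ → ℕ := fun k => T.eval k + 2 * F.len.eval k + (k + 2) ^ E + (k + 2) + 4 with hM
  have hMpoly : IsPoly M := by
    refine .add (.add (.add (.add (.eval T) (.mul (.const 2) (.eval F.len))) (.pow ?_ E)) ?_)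
      (.const 4)
    all_goals exact .add .id (.const 2)
  obtain ⟨T', hT'⟩ := (IsPoly.eval T).mul (hMpoly.roundTime n E (.pow (.add .id (.const 2)) E))
  have hsize : ∀ a : ℕ, a.size ≤ a := fun a => Nat.size_le.2 a.lt_two_pow_self
  have key : ∀ (k : ℕ) (val : Option Bool → ℝ≥0∞) (l : ℝ≥0∞), val none = 0 →
      (∀ o, val o ≤ ev coin val + l) → ev (accountableGame F rep A (T.eval k) k) val ≤
        ev (gentryGame F rep (reduction A n E) (T'.eval k) k) val +
          T.eval k * lossPer (2 ^ k) ((k + 2) ^ E) l := by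
    intro k val l h0 hle
    have h1 := hsize ((k + 2) ^ E)
    have h2 := hsize (k + 2)
    refine game_le (M := M k) (by omega) (by omega) ?_ ?_ ?_ ?_ ?_ (hT' k).ge (hT k) h0 hle
    · simp only [hM]; omega
    · simp only [hM]; omega
    · simp only [hM]; omega
    · simp only [hM]; omega
    · rw [hT' k]
      exact Nat.le_mul_of_pos_right _ (Nat.succ_pos _)
  have hB : RunsIn (gentryGame F rep) (reduction A n E) T' := by
    intro k
    -- A coin has the maximal value `1` here, so aborts cost nothing, `l = 0`, and the reduction
    -- halts in time with probability exactly `1`.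
    have h := key k (fun o => if o = none then 0 else 1) 0 rfl fun o => by
      rw [ev_coin]
      simp only [reduceCtorEq, if_false, add_zero]
      rw [one_add_one_eq_two, ENNReal.inv_mul_cancel (by norm_num) (by norm_num)]
      split_ifs <;> simp
    rw [ev_indicator_ne, ev_indicator_ne, hT k] at h
    simp only [lossPer, zero_mul, mul_zero, add_zero, tsub_zero] at h
    by_contra hne
    exact absurd h (not_le.2 (ENNReal.sub_lt_self (by simp) (by simp) hne))
  refine ⟨reduction A n E, T', hB, fun k => ?_⟩
  have hloss : (T.eval k * lossPer (2 ^ k) ((k + 2) ^ E) 1).toReal =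
      ((T.eval k : ℕ) : ℝ) * ((((k + 2 : ℕ) : ℝ) ^ E + 1)⁻¹ + 2 * (2 ^ k)⁻¹) := by
    unfold lossPer
    rw [ENNReal.toReal_mul, one_mul, one_mul, ENNReal.toReal_add, ENNReal.toReal_add,
      ENNReal.toReal_inv, ENNReal.toReal_inv, ENNReal.toReal_add]
    · simp only [ENNReal.toReal_natCast, ENNReal.toReal_one]
      push_cast
      ring
    all_goals simp [ENNReal.add_eq_top]
  have hfin : T.eval k * lossPer (2 ^ k) ((k + 2) ^ E) 1 ≠ ⊤ := by
    unfold lossPer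
    simp [ENNReal.mul_eq_top, ENNReal.add_eq_top]
  have hb : ∀ b : Bool, (accountableGame F rep A (T.eval k) k (some b)).toReal ≤
      (gentryGame F rep (reduction A n E) (T'.eval k) k (some b)).toReal +
        ((T.eval k : ℕ) : ℝ) * ((((k + 2 : ℕ) : ℝ) ^ E + 1)⁻¹ + 2 * (2 ^ k)⁻¹) := by
    intro b
    have h := key k (fun o => if o = some b then 1 else 0) 1 (by simp) fun o =>
      le_add_left (by split_ifs <;> simp)
    rw [ev_indicator, ev_indicator] at h
    rw [← hloss, ← ENNReal.toReal_add (PMF.apply_ne_top _ _) hfin]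
    exact ENNReal.toReal_mono (ENNReal.add_ne_top.2 ⟨PMF.apply_ne_top _ _, hfin⟩) h
  exact abs_sub_half_le (sum_outcomes (hT k)) (sum_outcomes (hB k)) (hb true) (hb false)

lemma loss_tendsto {T : Polynomial ℕ} {e : ℕ} (he : ∀ k, T.eval k ≤ (k + 2) ^ e) (c : ℕ) :
    Tendsto (fun k : ℕ => (k : ℝ) ^ c *
      (((T.eval k : ℕ) : ℝ) * ((((k + 2 : ℕ) : ℝ) ^ (e + c + 1) + 1)⁻¹ + 2 * (2 ^ k)⁻¹))) atTop (𝓝 0) := by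
  have h1 : Tendsto (fun k : ℕ => (((k + 2 : ℕ) : ℝ))⁻¹) atTop (𝓝 0) :=
    tendsto_inv_atTop_zero.comp (tendsto_natCast_atTop_atTop.comp (tendsto_add_atTop_nat 2))
  have h2 : Tendsto (fun k : ℕ => ((k + 2 : ℕ) : ℝ) ^ (e + c) / 2 ^ (k + 2)) atTop (𝓝 0) :=
    (tendsto_pow_const_div_const_pow_of_one_lt (e + c) one_lt_two).comp (tendsto_add_atTop_nat 2)
  -- With `x = k + 2`, the factor in front is at most `x ^ (e + c)`. The extra power of `x` in `N`
  -- leaves `1/x`, and `8 = 2 · 2 ^ 2` comes from rewriting `2 / 2 ^ k` with denominator `2 ^ (k +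
  -- 2)`.
  have h3 := h1.add (h2.const_mul 8)
  rw [mul_zero, add_zero] at h3
  refine squeeze_zero (fun k => by positivity) (fun k => ?_) h3
  have hx : (0 : ℝ) < ((k + 2 : ℕ) : ℝ) := by positivity
  have hkx : (k : ℝ) ≤ ((k + 2 : ℕ) : ℝ) := by push_cast; linarith
  have hTx : ((T.eval k : ℕ) : ℝ) ≤ ((k + 2 : ℕ) : ℝ) ^ e := by exact_mod_cast he k
  set x : ℝ := ((k + 2 : ℕ) : ℝ)
  have h4 : (k : ℝ) ^ c * (T.eval k : ℕ) ≤ x ^ (e + c) := by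
    rw [pow_add, mul_comm]
    gcongr
  calc _ = (k : ℝ) ^ c * (T.eval k : ℕ) * ((x ^ (e + c + 1) + 1)⁻¹ + 2 * (2 ^ k)⁻¹) := by ring
    _ ≤ x ^ (e + c) * ((x ^ (e + c + 1))⁻¹ + 2 * (2 ^ k)⁻¹) := by
        gcongr
        linarith
    _ = _ := by
        rw [mul_add, pow_succ x, mul_inv, ← mul_assoc, mul_inv_cancel₀ (pow_ne_zero _ hx.ne'),
          one_mul, pow_add 2]
        ring

end AIBE

end

theorem mainTheorem6 (F : AIBE.BilinearFamily) (rep : AIBE.Repetition) (A : AIBE.Prog)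
    (hA : AIBE.Breaks (AIBE.accountableGame F rep) A) :
    ∃ B : AIBE.Prog, AIBE.Breaks (AIBE.gentryGame F rep) B := by
  obtain ⟨T, hT, hadv⟩ := hA
  unfold AIBE.Negligible Asymptotics.SuperpolynomialDecay at hadv
  push Not at hadv
  obtain ⟨c, hc⟩ := hadv
  obtain ⟨e, he⟩ := AIBE.exists_eval_le_pow T
  -- The number of retries is chosen after the exponent `c` for which `k ^ c` times the advantage of
  -- `A` does not tend to `0`; thus the loss stays negligible at this scale without being negligible
  -- altogether.
  obtain ⟨B, T', hB, hle⟩ := AIBE.exists_reduction F rep A T hT (e + c + 1)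
  refine ⟨B, T', hB, fun hneg => hc ?_⟩
  have h := (hneg c).add (AIBE.loss_tendsto he c)
  rw [add_zero] at h
  refine squeeze_zero (fun k => mul_nonneg (by positivity) (abs_nonneg _)) (fun k => ?_) h
  rw [← mul_add]
  exact mul_le_mul_of_nonneg_left (hle k) (by positivity)
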